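/- Let $p$ be a prime, let $G$ be the group of $\mathbb{Q}_p$-rational points of a split connected reductive group over $\mathbb{Q}_p$ with connected center $Z$, let $T$ be a split maximal torus with irreducible root system $\Phi$, let $\Phi^+\subset\Phi$ be a positive system with simple roots $\alpha_1,\dots,\alpha_d$ and highest root $\theta$, and put $\alpha_0=-\theta$. For $\alpha\in\Phi$ let $N_\alpha$ be the root subgroup, and let $N=\prod_{\alpha\in\Phi^+}N_\alpha$. Put $\check T=T/Z$. Let $A=X_*(\check T)\otimes\mathbb{R}$ be the apartment of $T$ in the semisimple Bruhat--Tits building, with a hyperspecial vertex $x_0$ as origin, let $K$ be the hyperspecial maximal compact subgroup fixing $x_0$, put $N_0=N\cap K$, and let $T_0=T\cap K$. For a (closed) chamber $D$ of $A$ let $I_D$ be the Iwahori subgroup fixing $D$. The action of $N(T)$ on $A$ is normalized so that $\xi(p)$ acts as the translation by $\xi$, for $\xi\in X_*(T)$; let $C=\{x\in A: -1\le\alpha(x)\le0\text{ for all }\alpha\in\Phi^+\}$, so that $I_C\cap N=N_0$. Let $\widehat W=N(T)/ZT_0=X_*(\check T)\rtimes W$ be the extended affine Weyl group, acting on $A$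 by affine transformations. Let $s_i=s_{\alpha_i}$ for $1\le i\le d$ and $s_0=t_{\alpha_0^\vee}\circ s_{\alpha_0}$, where $t_{\alpha_0^\vee}$ is the translation by $\alpha_0^\vee$; let $W_{\rm aff}\subset\widehat W$ be the affine Weyl group generated by the Coxeter generators $s_0,\dots,s_d$, with its length function $\ell$, extended to $\widehat W$ by $\ell(w'v)=\ell(w')$ for $w'\in W_{\rm aff}$ and $v\in\widehat W$ with $vC=C$. Let $\tau\in X_*(\check T)$ be a fundamental coweight which is minuscule, i.e. $\langle\alpha,\tau\rangle\in\{0,1\}$ for all $\alpha\in\Phi^+$. Let $\phi\in\widehat W$, $\phi\ne1$, be power multiplicative (straight), i.e. $\ell(\phi^m)=m\,\ell(\phi)$ for all $m\ge0$, and suppose that $\phi^n=\tau^m$ in $\widehat W$ for some integers $m,n\ge1$. Write $\phi=\phi'v$ with $\phi'\in W_{\rm aff}$ and $v\in\widehat W$, $vC=C$, choose a reduced expression $\phi'=s_{\beta(1)}\cdots s_{\beta(r)}$ (so $r=\ell(\phi')=\ell(\phi)$), and put $$C^{(ar+b)}=\phi^a s_{\beta(1)}\cdots s_{\beta(b)}C\qquad(a\ge0,\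 0\le b<r).$$ Lift $\tau$ to an element of $X_*(T)$ and denote the corresponding homomorphism $\mathbb{Z}_p^\times\to T_0$ again by $\tau$. Then: (i) $C=C^{(0)},C^{(1)},C^{(2)},\dots$ is a gallery of chambers (consecutive chambers are distinct and share a facet of codimension $1$), and the groups $N_0^{(j)}=I_{C^{(j)}}\cap N$ satisfy $$N_0=N_0^{(0)}\supset N_0^{(1)}\supset N_0^{(2)}\supset\cdots,\qquad [N_0^{(j)}:N_0^{(j+1)}]=p\ \text{ for all } j\ge0.$$ In particular, for every $j\ge0$ the root $\alpha^{(j)}$ crossed between $C^{(j)}$ and $C^{(j+1)}$ is positive. Here $\alpha^{(j)}$ is the unique $\delta\in\Phi$ such that $I_{C^{(j)}}\cap N_{\alpha}=I_{C^{(j+1)}}\cap N_{\alpha}$ for all $\alpha\in\Phi\setminus\{\pm\delta\}$, while $I_{C^{(j)}}\cap N_{-\delta}\subset I_{C^{(j+1)}}\cap N_{-\delta}$ and $I_{C^{(j+1)}}\cap N_{\delta}\subset I_{C^{(j)}}\cap N_{\delta}$, both with index $p$. (ii) For every $j\ge0$ we have $\alpha^{(j)}\circ\tau={\rm id}_{\mathbb{Z}_p^\times}$.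 (iii) For every lifting $\dot\phi\in N(T)$ of $\phi\in\widehat W$ and every $a\in\mathbb{Z}_p^\times$ we have $\tau(a)\dot\phi=\dot\phi\,\tau(a)$ in $N(T)$. -/

import Mathlib

noncomputable section

namespace RootPairing

variable {ι X Y : Type*} [AddCommGroup X] [AddCommGroup Y]

/-- The root system of a root datum is irreducible: it is nonempty and is not the union of two
nonempty mutually orthogonal subsets. (Mathlib's `RootPairing.IsIrreducible` is meant for field
coefficients: it also refuses central tori, and over `ℤ` the lattice `2X` would violate it.) -/
def IsIrreducibleDatum (P : RootPairing ι ℤ X Y) : Prop :=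
  Nonempty ι ∧ ∀ s : Set ι, s.Nonempty →
    (∀ i ∈ s, ∀ j ∉ s, P.pairing i j = 0) → s = Set.univ

/-- The centre of the split reductive group with root datum `P` is the diagonalizable group with
character group `X / ℤΦ`; it is connected if and only if this group is torsion free. -/
def HasConnectedCenter (P : RootPairing ι ℤ X Y) : Prop :=
  ∀ (n : ℤ) (x : X), n ≠ 0 → n • x ∈ P.rootSpan ℤ → x ∈ P.rootSpan ℤ

/-- `θ` is the highest root with respect to the base `b`: for every root `β`, the difference
`θ - β` is a sum of simple roots. -/
def Base.IsHighestRoot {P : RootPairing ι ℤ X Y} (b : P.Base) (θ : ι) : Prop :=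
  ∀ j, P.root θ - P.root j ∈ AddSubmonoid.closure (P.root '' b.support)

/-! ### The apartment, the extended affine Weyl group and the chambers -/

/-- The cocharacter group `X_*(Ť)` of the adjoint torus `Ť = T / Z`: as `X^*(Ť)` is the root
lattice `ℤΦ`, this is `Hom(ℤΦ, ℤ)`. -/
abbrev AdjointCochar (P : RootPairing ι ℤ X Y) : Type _ := P.rootSpan ℤ →ₗ[ℤ] ℤ

/-- The apartment `A = X_*(Ť) ⊗ ℝ = Hom(ℤΦ, ℝ)`, with the special vertex `x₀` as origin. -/
abbrev Apartment (P : RootPairing ι ℤ X Y) : Type _ := P.rootSpan ℤ →ₗ[ℤ] ℝ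

/-- The root `αᵢ` as a linear functional on the apartment. -/
def rootFunctional (P : RootPairing ι ℤ X Y) (i : ι) : P.Apartment →ₗ[ℝ] ℝ where
  toFun x := x (P.rootSpanMem ℤ i)
  map_add' _ _ := rfl
  map_smul' _ _ := rfl

/-- The inclusion `X_*(Ť) ⊆ A`. -/
def adjointCocharToApartment (P : RootPairing ι ℤ X Y) (ξ : P.AdjointCochar) : P.Apartment :=
  (Int.castAddHom ℝ).toIntLinearMap ∘ₗ ξ

/-- The coroot `αᵢ^∨`, as a cocharacter of `Ť`. -/
def adjointCoroot (P : RootPairing ι ℤ X Y) (i : ι) : P.AdjointCochar :=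
  P.coroot' i ∘ₗ (P.rootSpan ℤ).subtype

lemma rootFunctional_adjointCoroot (P : RootPairing ι ℤ X Y) (i : ι) :
    P.rootFunctional i (P.adjointCocharToApartment (P.adjointCoroot i)) = 2 := by
  have h : P.toLinearMap (P.root i) (P.coroot i) = 2 := P.root_coroot_two i
  simp [rootFunctional, adjointCocharToApartment, adjointCoroot, h]

/-- The affine transformations of the apartment. -/
abbrev AffineTransf (P : RootPairing ι ℤ X Y) : Type _ := P.Apartment ≃ᵃ[ℝ] P.Apartment

/-- The reflection `s_α : x ↦ x - α(x) α^∨` of the apartment. -/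
def affReflection (P : RootPairing ι ℤ X Y) (i : ι) : P.AffineTransf :=
  (Module.reflection (P.rootFunctional_adjointCoroot i)).toAffineEquiv

/-- The translation `t_ξ : x ↦ x + ξ` of the apartment, for `ξ ∈ X_*(Ť)`. -/
def translation (P : RootPairing ι ℤ X Y) (ξ : P.AdjointCochar) : P.AffineTransf :=
  AffineEquiv.constVAdd ℝ P.Apartment (P.adjointCocharToApartment ξ)

/-- The extended affine Weyl group `Ŵ = X_*(Ť) ⋊ W`, as a group of affine transformations of the
apartment: it is generated by the translations by `X_*(Ť)` and the reflections `s_α`. -/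
def extAffineWeyl (P : RootPairing ι ℤ X Y) : Subgroup P.AffineTransf :=
  Subgroup.closure (Set.range P.translation ∪ Set.range P.affReflection)

/-- A subset of the apartment is a (closed) chamber if it is the closure of a connected component
of the complement of all the hyperplanes `{α = k}`, `α ∈ Φ`, `k ∈ ℤ`. Such a component is the
nonempty set of solutions of `k_α < α(x) < k_α + 1` (all `α`), for some integers `k_α`. -/
def IsChamber (P : RootPairing ι ℤ X Y) (D : Set P.Apartment) : Prop :=
  ∃ k : ι → ℤ,
    (∃ x, ∀ i, (k i : ℝ) < P.rootFunctional i x ∧ P.rootFunctional i x < k i + 1) ∧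
    D = {x | ∀ i, (k i : ℝ) ≤ P.rootFunctional i x ∧ P.rootFunctional i x ≤ k i + 1}

/-- Two chambers are adjacent if they are distinct and share a common facet of codimension `1`.
The latter means that they share a point which lies on exactly one of the hyperplanes `{α = k}`,
where `{α = k}` and `{-α = -k}` count as the same hyperplane. -/
def Adjacent (P : RootPairing ι ℤ X Y) (D₁ D₂ : Set P.Apartment) : Prop :=
  D₁ ≠ D₂ ∧ ∃ x ∈ D₁ ∩ D₂, ∃ i, (∃ k : ℤ, P.rootFunctional i x = k) ∧
    ∀ j, (∃ k : ℤ, P.rootFunctional j x = k) → j = i ∨ j = P.reflectionPerm i i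

namespace Base

variable {P : RootPairing ι ℤ X Y} (b : P.Base)

/-- The base chamber `C`: the chamber at the top (at `x₀`) of the cone spanned by the negatives of
the fundamental coweights, i.e. the chamber on which `-1 ≤ α ≤ 0` for all positive roots `α`. -/
def chamber : Set P.Apartment :=
  {x | ∀ i, b.IsPos i → -1 ≤ P.rootFunctional i x ∧ P.rootFunctional i x ≤ 0}

/-- The Coxeter generators: `some i` is sent to the simple reflection `s_i`, and `none` to
`s₀ = t_{α₀^∨} ∘ s_{α₀}`, where `α₀ = -θ` is the negative of the highest root `θ`. -/
def coxeterGen (θ : ι) : Option b.support → P.AffineTransf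
  | none => P.translation (P.adjointCoroot (P.reflectionPerm θ θ)) *
      P.affReflection (P.reflectionPerm θ θ)
  | some i => P.affReflection i

/-- The affine Weyl group, generated by `s₀, s₁, …, s_d`. -/
def affineWeyl (θ : ι) : Subgroup P.AffineTransf :=
  Subgroup.closure (Set.range (b.coxeterGen θ))

/-- The length function on the extended affine Weyl group: the length of `w` is the least number
of factors in an expression `w = s_{i₁} ⋯ s_{iₙ} v` with `v ∈ Ŵ` and `v C = C`. On the affine
Weyl group, whose only element fixing `C` is `1`, this is the length as a Coxeter group. -/
def length (θ : ι) (w : P.AffineTransf) : ℕ :=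
  sInf {n | ∃ (l : List (Option b.support)) (v : P.AffineTransf), v ∈ P.extAffineWeyl ∧
    v '' b.chamber = b.chamber ∧ l.length = n ∧ w = (l.map (b.coxeterGen θ)).prod * v}

/-- `w` is power multiplicative (or straight) if `ℓ(w ^ m) = m ℓ(w)` for all `m ≥ 0`. -/
def IsPowerMultiplicative (θ : ι) (w : P.AffineTransf) : Prop :=
  ∀ m : ℕ, b.length θ (w ^ m) = m * b.length θ w

/-- `τ` is a fundamental coweight: it is part of the basis of `X_*(Ť)` dual to the simple roots. -/
def IsFundamentalCoweight (τ : P.AdjointCochar) : Prop :=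
  ∃ i ∈ b.support, ∀ j ∈ b.support,
    (j = i → τ (P.rootSpanMem ℤ j) = 1) ∧ (j ≠ i → τ (P.rootSpanMem ℤ j) = 0)

/-- `τ` is minuscule: `⟨α, τ⟩ ∈ {0, 1}` for all positive roots `α`. -/
def IsMinuscule (τ : P.AdjointCochar) : Prop :=
  ∀ i, b.IsPos i → τ (P.rootSpanMem ℤ i) = 0 ∨ τ (P.rootSpanMem ℤ i) = 1

/-- The sequence of chambers `C^{(ar+b)} = φ^a s_{β(1)} ⋯ s_{β(b)} C` (`0 ≤ b < r`), for a word
`β` of length `r`. -/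
def gallery (θ : ι) (φ : P.AffineTransf) {r : ℕ} (β : Fin r → Option b.support) (j : ℕ) :
    Set P.Apartment :=
  (φ ^ (j / r) * (((List.ofFn β).take (j % r)).map (b.coxeterGen θ)).prod) '' b.chamber

end Base

end RootPairing

/-- A split connected reductive group over `ℚ_p`, together with a split maximal torus `T` and a
hyperspecial vertex `x₀` of the apartment of `T`, given in the way of Chevalley, by a faithful
matrix representation `G ⊆ GL_κ` in which `T` is diagonal.

Here `P` is the root datum of `(G, T)` (with `X = X^*(T)`, `Y = X_*(T)`), `κ` is the index set of
a basis of weight vectors, and `wt k` is the weight of the `k`-th basis vector. The representation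
is faithful on `T` if and only if its weights generate `X^*(T)`. The matrices `E i` give the action
of root vectors `e_α ∈ Lie(G)` which, together with the coroots, form a Chevalley basis of
the derived algebra of `Lie(G)`; the choice of a hyperspecial vertex `x₀` in the apartment is
the choice of such root vectors, up to units of `ℤ_p`.

The groups `T`, `N_α`, `G`, `K`, `I_D` are constructed below from these matrices. -/
structure ChevalleyRep (p : ℕ) [Fact p.Prime] {ι X Y : Type*} [Finite ι]
    [AddCommGroup X] [AddCommGroup Y] (P : RootPairing ι ℤ X Y)
    (κ : Type*) [Fintype κ] [DecidableEq κ] where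
  /-- the weights of the basis vectors -/
  wt : κ → X
  closure_wt : AddSubgroup.closure (Set.range wt) = ⊤
  /-- the root vectors -/
  E : ι → Matrix κ κ ℚ_[p]
  /-- `e_α` maps the weight space of `μ` to the weight space of `μ + α`. -/
  wt_eq_of_E_ne_zero : ∀ i k l, E i k l ≠ 0 → wt k = wt l + P.root i
  /-- `[e_α, e_{-α}] = h_α`, where `h_α` acts by `⟨μ, α^∨⟩` on the weight space of `μ`. -/
  bracket_neg : ∀ i, ⁅E i, E (P.reflectionPerm i i)⁆ =
    Matrix.diagonal fun k => ((P.toLinearMap (wt k) (P.coroot i) : ℤ) : ℚ_[p])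
  /-- `[e_α, e_β] = ± (q + 1) e_{α + β}` if `α + β` is a root, where `q` is the greatest integer
  such that `β - q α` is a root. -/
  bracket_root : ∀ i j k, P.root k = P.root i + P.root j →
    ⁅E i, E j⁆ = ((P.chainBotCoeff i j : ℚ_[p]) + 1) • E k ∨
    ⁅E i, E j⁆ = -(((P.chainBotCoeff i j : ℚ_[p]) + 1) • E k)
  /-- `[e_α, e_β] = 0` if `α + β` is nonzero and not a root. -/
  bracket_eq_zero : ∀ i j, P.root i + P.root j ≠ 0 →
    P.root i + P.root j ∉ Set.range P.root → ⁅E i, E j⁆ = 0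

namespace ChevalleyRep

variable {p : ℕ} [Fact p.Prime] {ι X Y : Type*} [Finite ι] [AddCommGroup X] [AddCommGroup Y]
  {P : RootPairing ι ℤ X Y} {κ : Type*} [Fintype κ] [DecidableEq κ]

lemma wt_eq_of_E_pow_ne_zero (R : ChevalleyRep p P κ) (i : ι) (n : ℕ) (k l : κ)
    (h : (R.E i ^ n) k l ≠ 0) : R.wt k = R.wt l + n • P.root i := by
  induction n generalizing k with
  | zero =>
    rw [pow_zero, Matrix.one_apply] at h
    have hkl : k = l := by
      by_contra hkl
      simp [hkl] at h
    simp [hkl]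
  | succ n ih =>
    rw [pow_succ', Matrix.mul_apply] at h
    obtain ⟨m, -, hm⟩ := Finset.exists_ne_zero_of_sum_ne_zero h
    rw [R.wt_eq_of_E_ne_zero i k m (left_ne_zero_of_mul hm), ih m (right_ne_zero_of_mul hm),
      succ_nsmul, add_assoc]

lemma isNilpotent_E (R : ChevalleyRep p P κ) (i : ι) : IsNilpotent (R.E i) := by
  have hX : Module.IsReflexive ℤ X := .of_isPerfPair P.toLinearMap
  have hT : IsAddTorsionFree X := .of_isTorsionFree ℤ X
  have hinj : Function.Injective fun n : ℕ => n • P.root i := by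
    intro m n hmn
    have h : (m : ℤ) • P.root i = (n : ℤ) • P.root i := by simpa using hmn
    exact_mod_cast smul_left_injective ℤ (P.ne_zero i) h
  have hfin : (Set.range fun q : κ × κ => R.wt q.1 - R.wt q.2).Finite := Set.finite_range _
  obtain ⟨n, hn⟩ := (hfin.preimage hinj.injOn).exists_notMem
  refine ⟨n, ?_⟩
  ext k l
  by_contra h
  refine hn ⟨(k, l), ?_⟩
  have := R.wt_eq_of_E_pow_ne_zero i n k l h
  simp [this]

/-- The group `T = T(ℚ_p) = Hom(X^*(T), ℚ_pˣ)`. -/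
abbrev Torus (p : ℕ) [Fact p.Prime] (X : Type*) [AddCommGroup X] : Type _ :=
  Multiplicative X →* ℚ_[p]ˣ

/-- The value `μ(t)` of the character `μ ∈ X^*(T)` at `t ∈ T`. -/
def evalChar (μ : X) (t : Torus p X) : ℚ_[p]ˣ := t (Multiplicative.ofAdd μ)

/-- The cocharacter `ℚ_pˣ → T` belonging to `y ∈ Y = X_*(T)`: one has
`μ(y(a)) = a ^ ⟨μ, y⟩` for all characters `μ`. -/
def cochar (p : ℕ) [Fact p.Prime] (P : RootPairing ι ℤ X Y) (y : Y) (a : ℚ_[p]ˣ) : Torus p X where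
  toFun μ := a ^ (P.toLinearMap μ.toAdd y)
  map_one' := by simp
  map_mul' μ ν := by simp [zpow_add]

variable (R : ChevalleyRep p P κ)

/-- The embedding of `T` into `GL_κ(ℚ_p)` as a group of diagonal matrices. -/
def torusHom : Torus p X →* GL κ ℚ_[p] where
  toFun t := Units.map (Matrix.diagonalRingHom κ ℚ_[p]).toMonoidHom
    (MulEquiv.piUnits.symm fun k => evalChar (R.wt k) t)
  map_one' := by
    ext
    simp [evalChar, MulEquiv.piUnits, Matrix.one_apply]
  map_mul' s t := by
    ext i j
    by_cases h : i = j
    · subst h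
      simp [evalChar, MulEquiv.piUnits]
    · simp [MulEquiv.piUnits, h]

/-- The torus `T` as a subgroup of `GL_κ(ℚ_p)`. -/
def T : Subgroup (GL κ ℚ_[p]) := R.torusHom.range

/-- The maximal bounded subgroup `T₀ = Hom(X^*(T), ℤ_pˣ)` of `T`. -/
def T₀ : Subgroup (GL κ ℚ_[p]) :=
  Subgroup.closure (R.torusHom '' {t | ∀ μ, ‖(evalChar μ t : ℚ_[p])‖ = 1})

/-- The one-parameter group `x_α(u) = exp(u e_α)`, for `u ∈ ℚ_p`. -/
def rootHom (i : ι) : Multiplicative ℚ_[p] →* GL κ ℚ_[p] :=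
  MonoidHom.toHomUnits
    { toFun := fun u => IsNilpotent.exp (u.toAdd • R.E i)
      map_one' := by simp
      map_mul' := fun u v => by
        rw [toAdd_mul, add_smul]
        exact IsNilpotent.exp_add_of_commute
          ((Commute.refl (R.E i)).smul_left _ |>.smul_right _)
          ((R.isNilpotent_E i).smul _) ((R.isNilpotent_E i).smul _) }

/-- The root subgroup `N_α = {x_α(u) | u ∈ ℚ_p}`. -/
def rootSubgroup (i : ι) : Subgroup (GL κ ℚ_[p]) := (R.rootHom i).range

/-- The group `G` of `ℚ_p`-rational points; it is generated by `T` and the root subgroups. -/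
def G : Subgroup (GL κ ℚ_[p]) := R.T ⊔ ⨆ i, R.rootSubgroup i

/-- The group `N`, generated by the `N_α` for the positive roots `α`. -/
def N (b : P.Base) : Subgroup (GL κ ℚ_[p]) := ⨆ (i) (_ : b.IsPos i), R.rootSubgroup i

/-- For a subset `Ω` of the apartment, the subgroup
`N_{α,Ω} = {x_α(u) | v(u) ≥ α(x) for all x ∈ Ω}` of `N_α`. -/
def rootSubgroupFix (i : ι) (Ω : Set P.Apartment) : Subgroup (GL κ ℚ_[p]) :=
  Subgroup.closure ((fun u : ℚ_[p] => R.rootHom i (Multiplicative.ofAdd u)) ''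
    {u | ∀ x ∈ Ω, ‖u‖ ≤ (p : ℝ) ^ (-P.rootFunctional i x)})

/-- The (connected) fixator of a subset `Ω` of the apartment: the group generated by `T₀` and
the `N_{α,Ω}` for all `α ∈ Φ`. For a point or a facet `Ω` this is the parahoric subgroup of `G`
attached to it; for a chamber `D` it is the Iwahori subgroup `I_D`. -/
def parahoric (Ω : Set P.Apartment) : Subgroup (GL κ ℚ_[p]) :=
  R.T₀ ⊔ ⨆ i, R.rootSubgroupFix i Ω

/-- The Iwahori subgroup `I_D` of `G` fixing the chamber `D`. -/
def iwahori (D : Set P.Apartment) : Subgroup (GL κ ℚ_[p]) := R.parahoric D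

/-- The hyperspecial maximal compact subgroup `K` of `G` fixing the special vertex `x₀ = 0`. -/
def K : Subgroup (GL κ ℚ_[p]) := R.parahoric {0}

/-- `N₀ = N ∩ K`. -/
def N₀ (b : P.Base) : Subgroup (GL κ ℚ_[p]) := R.N b ⊓ R.K

/-- The normalizer `N(T)` of `T` in `G`. -/
def normalizerT : Subgroup (GL κ ℚ_[p]) := R.G ⊓ Subgroup.normalizer (R.T : Set (GL κ ℚ_[p]))

/-- `n ∈ N(T)` is a lifting of the element `w` of the extended affine Weyl group `N(T) / Z T₀`:
the element `n` acts on the apartment as `w`. This action is given by transport of structure on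
the filtered root subgroups, i.e. if `β` is the image of `α` under the linear part
of `w` then `n N_{α,x} n⁻¹ = N_{β,w(x)}` for all points `x` of the apartment. -/
def IsLift (n : GL κ ℚ_[p]) (w : P.AffineTransf) : Prop :=
  n ∈ R.normalizerT ∧ ∀ i, ∃ j,
    (∀ x, P.rootFunctional j (w.linear x) = P.rootFunctional i x) ∧
    ∀ x, (R.rootSubgroupFix i {x}).map (MulAut.conj n).toMonoidHom = R.rootSubgroupFix j {w x}

/-- A sequence of chambers `C^{(0)}, C^{(1)}, …` is a semiinfinite gallery starting at `C` which
satisfies the following condition: the groups `N₀^{(j)} = I_{C^{(j)}} ∩ N` satisfy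
`N₀ = N₀^{(0)} ⊇ N₀^{(1)} ⊇ N₀^{(2)} ⊇ …`, with `[N₀^{(j)} : N₀^{(j+1)}] = p` for all `j`. -/
def IsIndexPGallery (b : P.Base) (c : ℕ → Set P.Apartment) : Prop :=
  c 0 = b.chamber ∧ (∀ j, P.IsChamber (c j)) ∧ (∀ j, P.Adjacent (c j) (c (j + 1))) ∧
  R.iwahori (c 0) ⊓ R.N b = R.N₀ b ∧
  ∀ j, R.iwahori (c (j + 1)) ⊓ R.N b ≤ R.iwahori (c j) ⊓ R.N b ∧
    (R.iwahori (c (j + 1)) ⊓ R.N b).relIndex (R.iwahori (c j) ⊓ R.N b) = p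

/-- `δ` is the root crossed in passing from the chamber `D₁` to the chamber `D₂`: one has
`I_{D₁} ∩ N_α = I_{D₂} ∩ N_α` for all `α ≠ ±δ`, while `I_{D₁} ∩ N_{-δ} ⊆ I_{D₂} ∩ N_{-δ}` and
`I_{D₂} ∩ N_δ ⊆ I_{D₁} ∩ N_δ`, both with index `p`. -/
def IsCrossingRoot (D₁ D₂ : Set P.Apartment) (δ : ι) : Prop :=
  (∀ j, j ≠ δ → j ≠ P.reflectionPerm δ δ →
    R.iwahori D₁ ⊓ R.rootSubgroup j = R.iwahori D₂ ⊓ R.rootSubgroup j) ∧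
  (R.iwahori D₁ ⊓ R.rootSubgroup (P.reflectionPerm δ δ) ≤
      R.iwahori D₂ ⊓ R.rootSubgroup (P.reflectionPerm δ δ) ∧
    (R.iwahori D₁ ⊓ R.rootSubgroup (P.reflectionPerm δ δ)).relIndex
      (R.iwahori D₂ ⊓ R.rootSubgroup (P.reflectionPerm δ δ)) = p) ∧
  (R.iwahori D₂ ⊓ R.rootSubgroup δ ≤ R.iwahori D₁ ⊓ R.rootSubgroup δ ∧
    (R.iwahori D₂ ⊓ R.rootSubgroup δ).relIndex (R.iwahori D₁ ⊓ R.rootSubgroup δ) = p)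

end ChevalleyRep

/-- A unit of `ℤ_p` as a unit of `ℚ_p`. -/
def PadicInt.unitToPadic {p : ℕ} [Fact p.Prime] : ℤ_[p]ˣ →* ℚ_[p]ˣ :=
  Units.map (PadicInt.Coe.ringHom (p := p)).toMonoidHom

end

/-! The proof has a combinatorial half, in the apartment, and a group-theoretic half, in the adjoint
action on matrices.

Combinatorics. A chamber is recorded by the integers `⌊α(x)⌋` at an interior point `x`. One step of
the gallery raises this integer by one for a single root ε, lowers it by one for -ε and changes
nothing else, so `J` steps have total variation `2J`. Because φ^n = τ^m, after `J = nqr` steps the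
gallery has reached the translate of `C` by mqτ. Twice the length is at most the sum over all roots
of the absolute net changes (`Base.two_mul_length_le`), and straightness makes the length of φ^(nq)
equal to `J`. Hence net change and total variation agree, and every root varies monotonically along
the gallery. A positive root α has net change mq⟨α, τ⟩ ≥ 0, so crossed roots are positive; a root
with ⟨α, τ⟩ = 0 never changes, so minuscule τ pairs to 1 with each crossed root
(`Base.gallery_crossing`). This gives positivity and (ii).

Groups. The parahoric group of a point `x` stabilizes the lattice generated by the `c e_α` with v(c)
≥ α(x) and the integral Cartan elements. If g ∈ N is 1 plus terms of height at least m, then gχg⁻¹ -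
χ shows its coefficients in height m; peeling off one height after the other, I_D ∩ N is generated
by its root subgroups (`mem_unipotentGroup_of_mem_N`, `parahoric_inf_N`). For the index, take `y` on
the common facet and on no other wall. Modulo the elements acting trivially on the Cartan part of
the reduced lattice at `y`, only the root subgroup of ε survives, and there the index is p
(`iwahori_inf_N_of_isCrossing`). Connectedness of the centre lets functionals extend from ℤΦ to X;
this supplies integral Cartan elements with α(χ) = 1.

For (iii), a lift acts on characters by some σ which follows the linear part of φ on roots and is
trivial modulo ℤΦ. That linear part fixes τ, as φ commutes with its own powers. So τ∘σ - τ is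
σ-invariant, and it vanishes because σ preserves the finite set of weights
(`torusHom_mul_comm_of_isLift`). -/

namespace RootPairing

variable {ι X Y : Type*} [AddCommGroup X] [AddCommGroup Y]

/-! ### Roots as functionals, and the action of the extended affine Weyl group on them -/

section Apartment

variable (P : RootPairing ι ℤ X Y)

lemma rootSpanMem_reflectionPerm (i j : ι) :
    P.rootSpanMem ℤ (P.reflectionPerm i j) =
      P.rootSpanMem ℤ j - P.pairing j i • P.rootSpanMem ℤ i := by
  apply Subtype.ext
  change P.root (P.reflectionPerm i j) = P.root j - P.pairing j i • P.root i
  rw [root_reflectionPerm, reflection_apply_root]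

lemma rootSpanMem_neg (i : ι) :
    P.rootSpanMem ℤ (P.reflectionPerm i i) = -P.rootSpanMem ℤ i := by
  rw [rootSpanMem_reflectionPerm, pairing_same]
  module

@[simp]
lemma rootFunctional_neg (i : ι) (x : P.Apartment) :
    P.rootFunctional (P.reflectionPerm i i) x = -P.rootFunctional i x := by
  simp [rootFunctional, rootSpanMem_neg]

lemma rootFunctional_adjointCochar (ξ : P.AdjointCochar) (i : ι) :
    P.rootFunctional i (P.adjointCocharToApartment ξ) = ξ (P.rootSpanMem ℤ i) := rfl

lemma adjointCoroot_apply (i j : ι) :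
    P.adjointCoroot i (P.rootSpanMem ℤ j) = P.pairing j i := rfl

lemma affReflection_apply (i : ι) (x : P.Apartment) :
    P.affReflection i x =
      x - P.rootFunctional i x • P.adjointCocharToApartment (P.adjointCoroot i) := rfl

lemma translation_apply (ξ : P.AdjointCochar) (x : P.Apartment) :
    P.translation ξ x = P.adjointCocharToApartment ξ + x := rfl

lemma rootFunctional_affReflection (i j : ι) (x : P.Apartment) :
    P.rootFunctional j (P.affReflection i x) = P.rootFunctional (P.reflectionPerm i j) x := by
  rw [affReflection_apply, map_sub, map_smul, rootFunctional_adjointCochar, adjointCoroot_apply]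
  simp only [rootFunctional, LinearMap.coe_mk, AddHom.coe_mk, rootSpanMem_reflectionPerm, map_sub,
    map_zsmul, smul_eq_mul, zsmul_eq_mul]
  ring

lemma rootFunctional_translation (ξ : P.AdjointCochar) (i : ι) (x : P.Apartment) :
    P.rootFunctional i (P.translation ξ x) = P.rootFunctional i x + ξ (P.rootSpanMem ℤ i) := by
  rw [translation_apply, map_add, rootFunctional_adjointCochar, add_comm]

/-- The generators permute the roots up to integral constants, and this form is stable under
products and inverses. All later arguments use elements of the group through this description. -/
lemma exists_perm_of_mem_extAffineWeyl {w : P.AffineTransf} (hw : w ∈ P.extAffineWeyl) :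
    ∃ (π : Equiv.Perm ι) (c : ι → ℤ), ∀ i x,
      P.rootFunctional i (w x) = P.rootFunctional (π i) x + c i := by
  induction hw using Subgroup.closure_induction with
  | mem w hw =>
    rcases hw with ⟨ξ, rfl⟩ | ⟨k, rfl⟩
    · exact ⟨1, fun i => ξ (P.rootSpanMem ℤ i), P.rootFunctional_translation ξ⟩
    · exact ⟨P.reflectionPerm k, 0, fun i x => by
        simp [rootFunctional_affReflection]⟩
  | one => exact ⟨1, 0, fun i x => by simp⟩
  | mul w w' _ _ h h' =>
    obtain ⟨π, c, h⟩ := h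
    obtain ⟨π', c', h'⟩ := h'
    refine ⟨π' * π, fun i => c' (π i) + c i, fun i x => ?_⟩
    rw [AffineEquiv.mul_def, AffineEquiv.trans_apply, h, h']
    push_cast
    simp [add_assoc]
  | inv w _ h =>
    obtain ⟨π, c, h⟩ := h
    refine ⟨π⁻¹, fun i => -c (π⁻¹ i), fun i x => ?_⟩
    have := h (π⁻¹ i) (w⁻¹ x)
    have hx : w (w⁻¹ x) = x := w.apply_symm_apply x
    rw [hx, ← Equiv.Perm.mul_apply, mul_inv_cancel, Equiv.Perm.one_apply] at this
    push_cast
    linarith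

lemma translation_pow_apply (ξ : P.AdjointCochar) (m : ℕ) (i : ι) (x : P.Apartment) :
    P.rootFunctional i ((P.translation ξ ^ m) x) =
      P.rootFunctional i x + m * ξ (P.rootSpanMem ℤ i) := by
  induction m with
  | zero => simp
  | succ m ih =>
    rw [pow_succ', AffineEquiv.mul_def, AffineEquiv.trans_apply, rootFunctional_translation, ih]
    push_cast
    ring

end Apartment

/-! ### Heights and the highest root -/

section Base

variable {P : RootPairing ι ℤ X Y} (b : P.Base)

/-- The point of the apartment with prescribed values at the simple roots. -/
noncomputable def Base.point (f : b.support → ℝ) : P.Apartment := b.toWeightBasisInt.constr ℤ f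

lemma Base.toWeightBasisInt_eq (i : b.support) :
    b.toWeightBasisInt i = P.rootSpanMem ℤ i :=
  Subtype.ext (b.coe_toWeightBasisInt_apply i)

lemma Base.rootFunctional_point (f : b.support → ℝ) (i : b.support) :
    P.rootFunctional i (b.point f) = f i := by
  change b.toWeightBasisInt.constr ℤ f (P.rootSpanMem ℤ i) = f i
  rw [← b.toWeightBasisInt_eq, Module.Basis.constr_basis]

include b in
-- The coordinate functionals of the basis of simple roots are themselves points of the apartment,
-- and they separate the root lattice.
lemma Base.rootFunctional_injective {i j : ι} (h : P.rootFunctional i = P.rootFunctional j) :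
    i = j := by
  apply P.root.injective
  have : P.rootSpanMem ℤ i = P.rootSpanMem ℤ j := by
    apply b.toWeightBasisInt.ext_elem
    intro k
    have := LinearMap.congr_fun h (P.adjointCocharToApartment (b.toWeightBasisInt.coord k))
    rw [rootFunctional_adjointCochar, rootFunctional_adjointCochar] at this
    exact_mod_cast this
  exact congrArg Subtype.val this

variable {b} in
lemma Base.IsPos.rootFunctional_lt_zero [Finite ι] {x : P.Apartment}
    (hx : ∀ i ∈ b.support, P.rootFunctional i x < 0) {i : ι} (hi : b.IsPos i) :
    P.rootFunctional i x < 0 := by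
  refine hi.induction_on_add hx fun i j k hk h hj => ?_
  have : P.rootSpanMem ℤ k = P.rootSpanMem ℤ i + P.rootSpanMem ℤ j := Subtype.ext hk
  change x _ < 0
  rw [this, map_add]
  exact add_neg h (hx j hj)

lemma Base.exists_apply_of_mem_closure {x : P.Apartment}
    (hx : ∀ i ∈ b.support, P.rootFunctional i x < 0) {m : X}
    (hm : m ∈ AddSubmonoid.closure (P.root '' b.support)) :
    ∃ h : m ∈ P.rootSpan ℤ, m = 0 ∨ x ⟨m, h⟩ < 0 := by
  induction hm using AddSubmonoid.closure_induction with
  | mem m hm =>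
    obtain ⟨i, hi, rfl⟩ := hm
    exact ⟨(P.rootSpanMem ℤ i).2, Or.inr (hx i hi)⟩
  | zero => exact ⟨zero_mem _, Or.inl rfl⟩
  | add m m' _ _ h h' =>
    obtain ⟨h, h1⟩ := h
    obtain ⟨h', h1'⟩ := h'
    refine ⟨add_mem h h', ?_⟩
    rcases h1 with rfl | h1
    · simpa using h1'
    rcases h1' with rfl | h1'
    · simpa using Or.inr h1
    refine Or.inr ?_
    have := map_add x ⟨m, h⟩ ⟨m', h'⟩
    rw [AddMemClass.mk_add_mk] at this
    rw [this]
    exact add_neg h1 h1'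

variable {b}

lemma Base.IsHighestRoot.rootFunctional_lt {θ : ι} (hθ : b.IsHighestRoot θ) {x : P.Apartment}
    (hx : ∀ i ∈ b.support, P.rootFunctional i x < 0) {j : ι} (hj : j ≠ θ) :
    P.rootFunctional θ x < P.rootFunctional j x := by
  obtain ⟨h, h1⟩ := b.exists_apply_of_mem_closure hx (hθ j)
  rcases h1 with h1 | h1
  · exact absurd (P.root.injective (sub_eq_zero.1 h1)).symm hj
  · have : (⟨P.root θ - P.root j, h⟩ : P.rootSpan ℤ) = P.rootSpanMem ℤ θ - P.rootSpanMem ℤ j := rfl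
    rw [this, map_sub] at h1
    exact sub_neg.1 h1

variable (b) in
/-- The point of the apartment at which all simple roots take the value `-1`. -/
noncomputable def Base.negRho : P.Apartment := b.point fun _ => -1

/-- Minus the height is evaluation at a point of the open antidominant cone, so inequalities between
roots on that cone become inequalities between heights. -/
lemma Base.rootFunctional_negRho (i : ι) : P.rootFunctional i b.negRho = -b.height i := by
  obtain ⟨f, -, -, hf⟩ := b.exists_root_eq_sum_int i
  have h : P.rootSpanMem ℤ i = ∑ j ∈ b.support, f j • P.rootSpanMem ℤ j := by
    apply Subtype.ext
    simp only [AddSubmonoidClass.coe_finsetSum, SetLike.val_smul]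
    exact hf
  change b.negRho (P.rootSpanMem ℤ i) = _
  rw [h, map_sum, b.height_eq_sum hf, Int.cast_sum, ← Finset.sum_neg_distrib]
  refine Finset.sum_congr rfl fun j hj => ?_
  have : b.negRho (P.rootSpanMem ℤ j) = -1 := b.rootFunctional_point _ ⟨j, hj⟩
  rw [map_zsmul, this]
  simp

lemma Base.rootFunctional_negRho_lt_zero :
    ∀ i ∈ b.support, P.rootFunctional i b.negRho < 0 := fun i hi => by
  rw [rootFunctional_negRho, Base.height_one_of_mem_support hi]
  norm_num

lemma Base.IsHighestRoot.height_lt {θ : ι} (hθ : b.IsHighestRoot θ) {j : ι} (hj : j ≠ θ) :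
    b.height j < b.height θ := by
  have := hθ.rootFunctional_lt b.rootFunctional_negRho_lt_zero hj
  rw [Base.rootFunctional_negRho, Base.rootFunctional_negRho] at this
  exact_mod_cast neg_lt_neg_iff.1 this

lemma Base.height_neg (i : ι) : b.height (P.reflectionPerm i i) = -b.height i :=
  b.height_reflectionPerm_self i

lemma Base.isPos_neg_iff (i : ι) : b.IsPos (P.reflectionPerm i i) ↔ ¬b.IsPos i :=
  Base.IsPos.neg_iff_not b i

variable (P) in
lemma reflectionPerm_ne_self (i : ι) : P.reflectionPerm i i ≠ i := fun h => by
  have h1 := P.pairing_reflectionPerm_self_left i i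
  rw [h, pairing_same] at h1
  norm_num at h1

@[simp]
lemma reflectionPerm_neg_neg (i : ι) :
    P.reflectionPerm (P.reflectionPerm i i) (P.reflectionPerm i i) = i := by
  let := P.indexNeg
  exact neg_neg i

lemma Base.IsHighestRoot.isPos {θ : ι} (hθ : b.IsHighestRoot θ) : b.IsPos θ := by
  have := hθ.height_lt (P.reflectionPerm_ne_self θ)
  rw [Base.height_neg] at this
  rw [Base.isPos_iff]
  omega

/-- The reflection of `j` in θ has height ht(j) - ⟨j, θ^∨⟩ ht(θ), which must lie between -ht(θ) and
ht(θ). With 0 < ht(j) < ht(θ) only the pairings 0 and 1 remain. -/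
lemma Base.IsHighestRoot.pairing_eq {θ : ι} (hθ : b.IsHighestRoot θ) {j : ι} (hj : b.IsPos j)
    (hjθ : j ≠ θ) : P.pairing j θ = 0 ∨ P.pairing j θ = 1 := by
  have hk : P.root (P.reflectionPerm θ j) = P.root j + (-P.pairing j θ) • P.root θ := by
    rw [root_reflectionPerm, reflection_apply_root, neg_smul, sub_eq_add_neg]
  have h1 := b.height_add_zsmul hk
  have h2 := hθ.height_lt hjθ
  have h3 : b.height (P.reflectionPerm θ j) ≤ b.height θ := by
    by_cases h : P.reflectionPerm θ j = θ
    · rw [h]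
    · exact (hθ.height_lt h).le
  have h4 : -b.height (P.reflectionPerm θ j) ≤ b.height θ := by
    rw [← Base.height_neg]
    by_cases h : P.reflectionPerm (P.reflectionPerm θ j) (P.reflectionPerm θ j) = θ
    · rw [h]
    · exact (hθ.height_lt h).le
  rw [Base.isPos_iff] at hj
  have h5 := hθ.isPos
  rw [Base.isPos_iff] at h5
  rw [h1, smul_eq_mul] at h3 h4
  have h6 : -1 < P.pairing j θ := by
    by_contra h
    nlinarith
  have h7 : P.pairing j θ < 2 := by
    by_contra h
    nlinarith
  omega

end Base

end RootPairing

namespace RootPairing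

variable {ι X Y : Type*} [AddCommGroup X] [AddCommGroup Y]

/-! ### The base chamber and its Coxeter generators -/

section Alcove

variable {P : RootPairing ι ℤ X Y} (b : P.Base)

/-- The interior of the base chamber. -/
def Base.openChamber : Set P.Apartment :=
  {x | ∀ i, b.IsPos i → -1 < P.rootFunctional i x ∧ P.rootFunctional i x < 0}

open Classical in
/-- The integers `k` such that the base chamber is given by the inequalities `k i ≤ αᵢ ≤ k i + 1`. -/
noncomputable def Base.chamberFloor (i : ι) : ℤ := if b.IsPos i then -1 else 0

variable {b}

lemma Base.chamberFloor_le_iff (x : P.Apartment) :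
    x ∈ b.chamber ↔ ∀ i, (b.chamberFloor i : ℝ) ≤ P.rootFunctional i x ∧
      P.rootFunctional i x ≤ b.chamberFloor i + 1 := by
  constructor
  · intro h i
    by_cases hi : b.IsPos i
    · simpa [chamberFloor, hi] using h i hi
    · have := h _ ((b.isPos_neg_iff i).2 hi)
      simp only [rootFunctional_neg] at this
      simp only [chamberFloor, hi, if_false, Int.cast_zero]
      constructor <;> linarith
  · intro h i hi
    simpa [chamberFloor, hi] using h i

lemma Base.mem_openChamber_iff (x : P.Apartment) :
    x ∈ b.openChamber ↔ ∀ i, (b.chamberFloor i : ℝ) < P.rootFunctional i x ∧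
      P.rootFunctional i x < b.chamberFloor i + 1 := by
  constructor
  · intro h i
    by_cases hi : b.IsPos i
    · simpa [chamberFloor, hi] using h i hi
    · have := h _ ((b.isPos_neg_iff i).2 hi)
      simp only [rootFunctional_neg] at this
      simp only [chamberFloor, hi, if_false, Int.cast_zero]
      constructor <;> linarith
  · intro h i hi
    simpa [chamberFloor, hi] using h i

lemma Base.floor_eq_chamberFloor {x : P.Apartment} (hx : x ∈ b.openChamber) (i : ι) :
    ⌊P.rootFunctional i x⌋ = b.chamberFloor i := by
  rw [Int.floor_eq_iff]
  exact ⟨((b.mem_openChamber_iff x).1 hx i).1.le, ((b.mem_openChamber_iff x).1 hx i).2⟩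

/-- A point of the apartment is regular if it lies on no hyperplane `{α = k}`. -/
def IsRegularPoint (P : RootPairing ι ℤ X Y) (x : P.Apartment) : Prop :=
  ∀ i (k : ℤ), P.rootFunctional i x ≠ k

lemma IsRegularPoint.floor_lt {x : P.Apartment} (hx : P.IsRegularPoint x) (i : ι) :
    (⌊P.rootFunctional i x⌋ : ℝ) < P.rootFunctional i x :=
  lt_of_le_of_ne (Int.floor_le _) (hx i _).symm

lemma IsRegularPoint.floor_neg {x : P.Apartment} (hx : P.IsRegularPoint x) (i : ι) :
    ⌊P.rootFunctional (P.reflectionPerm i i) x⌋ = -⌊P.rootFunctional i x⌋ - 1 := by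
  rw [rootFunctional_neg, Int.floor_eq_iff]
  have h1 := hx.floor_lt i
  have h2 := Int.lt_floor_add_one (P.rootFunctional i x)
  push_cast
  constructor <;> linarith

lemma Base.isRegularPoint_of_mem_openChamber {x : P.Apartment} (hx : x ∈ b.openChamber) :
    P.IsRegularPoint x := fun i k h => by
  obtain ⟨h1, h2⟩ := (b.mem_openChamber_iff x).1 hx i
  rw [h] at h1 h2
  norm_cast at h1 h2
  omega

lemma IsRegularPoint.map {x : P.Apartment} (hx : P.IsRegularPoint x) {w : P.AffineTransf}
    (hw : w ∈ P.extAffineWeyl) : P.IsRegularPoint (w x) := by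
  obtain ⟨π, c, h⟩ := P.exists_perm_of_mem_extAffineWeyl hw
  intro i k hk
  rw [h] at hk
  refine hx (π i) (k - c i) ?_
  push_cast
  linarith

lemma Base.exists_mem_openChamber {θ : ι} (hθ : b.IsHighestRoot θ) :
    ∃ x, x ∈ b.openChamber := by
  have hpos : (0 : ℝ) < b.height θ := by
    have := hθ.isPos
    rw [isPos_iff] at this
    exact_mod_cast this
  -- At this point a root takes the value -ht/(ht(θ) + 1), and ht(θ) is the maximal height.
  refine ⟨((b.height θ : ℝ) + 1)⁻¹ • b.negRho, fun i hi => ?_⟩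
  rw [map_smul, rootFunctional_negRho, smul_eq_mul]
  rw [isPos_iff] at hi
  have h1 : (0 : ℝ) < b.height i := by exact_mod_cast hi
  have h2 : (b.height i : ℝ) ≤ b.height θ := by
    by_cases h : i = θ
    · rw [h]
    · exact_mod_cast (hθ.height_lt h).le
  constructor
  · rw [inv_mul_eq_div, lt_div_iff₀ (by linarith)]
    linarith
  · rw [inv_mul_eq_div, div_lt_iff₀ (by linarith)]
    linarith

/-- `w` maps the base chamber to the chamber containing the image of an interior point. -/
lemma Base.image_chamber {w : P.AffineTransf} (hw : w ∈ P.extAffineWeyl) {x₀ : P.Apartment}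
    (hx₀ : x₀ ∈ b.openChamber) :
    w '' b.chamber = {x | ∀ i, (⌊P.rootFunctional i (w x₀)⌋ : ℝ) ≤ P.rootFunctional i x ∧
      P.rootFunctional i x ≤ ⌊P.rootFunctional i (w x₀)⌋ + 1} := by
  obtain ⟨π, c, h⟩ := P.exists_perm_of_mem_extAffineWeyl hw
  ext y
  constructor
  · rintro ⟨x, hx, rfl⟩ i
    have := (b.chamberFloor_le_iff x).1 hx (π i)
    rw [h, h, Int.floor_add_intCast, floor_eq_chamberFloor hx₀]
    push_cast
    constructor <;> linarith
  · intro hy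
    refine ⟨w.symm y, ?_, w.apply_symm_apply y⟩
    rw [chamberFloor_le_iff]
    intro i
    have h1 := hy (π.symm i)
    have h2 := h (π.symm i) (w.symm y)
    rw [w.apply_symm_apply, Equiv.apply_symm_apply] at h2
    rw [h2, h, Int.floor_add_intCast, Equiv.apply_symm_apply, floor_eq_chamberFloor hx₀] at h1
    push_cast at h1
    constructor <;> linarith

lemma Base.isChamber_image {w : P.AffineTransf} (hw : w ∈ P.extAffineWeyl) {x₀ : P.Apartment}
    (hx₀ : x₀ ∈ b.openChamber) : P.IsChamber (w '' b.chamber) :=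
  ⟨fun i => ⌊P.rootFunctional i (w x₀)⌋, ⟨w x₀, fun i =>
    ⟨((isRegularPoint_of_mem_openChamber hx₀).map hw).floor_lt i, Int.lt_floor_add_one _⟩⟩,
    image_chamber hw hx₀⟩

lemma Base.mem_chamber_of_mem_openChamber {x : P.Apartment} (hx : x ∈ b.openChamber) :
    x ∈ b.chamber := fun i hi => ⟨(hx i hi).1.le, (hx i hi).2.le⟩

/-- The image is regular because `v` permutes the hyperplanes, and a regular point of the closed
chamber is interior. -/
lemma Base.map_mem_openChamber {v : P.AffineTransf} (hv : v ∈ P.extAffineWeyl)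
    (hvC : v '' b.chamber = b.chamber) {x : P.Apartment} (hx : x ∈ b.openChamber) :
    v x ∈ b.openChamber := by
  have h1 := (isRegularPoint_of_mem_openChamber hx).map hv
  have h2 : v x ∈ b.chamber := hvC ▸ Set.mem_image_of_mem v (mem_chamber_of_mem_openChamber hx)
  intro i hi
  refine ⟨lt_of_le_of_ne (h2 i hi).1 ?_, lt_of_le_of_ne (h2 i hi).2 ?_⟩
  · have := h1 i (-1)
    push_cast at this
    exact this.symm
  · have := h1 i 0
    push_cast at this
    exact this

lemma Base.image_chamber_eq_of_mem {w : P.AffineTransf} (hw : w ∈ P.extAffineWeyl)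
    {x₀ : P.Apartment} (hx₀ : x₀ ∈ b.openChamber) (h : w x₀ ∈ b.openChamber) :
    w '' b.chamber = b.chamber := by
  rw [image_chamber hw hx₀]
  ext x
  rw [chamberFloor_le_iff]
  simp only [floor_eq_chamberFloor h, Set.mem_ofPred_eq]

variable (b) in
/-- The root which is negative on the base chamber side of the wall of the Coxeter generator. -/
def Base.genRoot (θ : ι) : Option b.support → ι
  | none => P.reflectionPerm θ θ
  | some i => i

variable (b) in
/-- The value of `genRoot` on the wall of the Coxeter generator. -/
def Base.genLevel : Option b.support → ℤ
  | none => 1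
  | some _ => 0

lemma Base.coxeterGen_mem (θ : ι) (s : Option b.support) :
    b.coxeterGen θ s ∈ P.extAffineWeyl := by
  cases s with
  | none =>
    exact mul_mem (S := Subgroup P.AffineTransf) (Subgroup.subset_closure (Or.inl ⟨_, rfl⟩))
      (Subgroup.subset_closure (Or.inr ⟨_, rfl⟩))
  | some i => exact Subgroup.subset_closure (Or.inr ⟨_, rfl⟩)

/-- Treats s₀ and the simple reflections uniformly, as reflections in the hyperplane on which
`genRoot` takes the value `genLevel`. -/
lemma Base.coxeterGen_apply (θ : ι) (s : Option b.support) (x : P.Apartment) :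
    b.coxeterGen θ s x = x - (P.rootFunctional (b.genRoot θ s) x - b.genLevel s) •
      P.adjointCocharToApartment (P.adjointCoroot (b.genRoot θ s)) := by
  cases s with
  | none =>
    rw [coxeterGen, AffineEquiv.mul_def, AffineEquiv.trans_apply, translation_apply,
      affReflection_apply]
    simp only [genRoot, genLevel, Int.cast_one]
    module
  | some i =>
    rw [coxeterGen, affReflection_apply]
    simp [genRoot, genLevel]

lemma Base.rootFunctional_coxeterGen (θ : ι) (s : Option b.support) (x : P.Apartment) (j : ι) :
    P.rootFunctional j (b.coxeterGen θ s x) = P.rootFunctional j x -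
      (P.rootFunctional (b.genRoot θ s) x - b.genLevel s) * P.pairing j (b.genRoot θ s) := by
  rw [coxeterGen_apply, map_sub, map_smul, rootFunctional_adjointCochar, adjointCoroot_apply,
    smul_eq_mul]

lemma Base.genRoot_coxeterGen (θ : ι) (s : Option b.support) (x : P.Apartment) :
    P.rootFunctional (b.genRoot θ s) (b.coxeterGen θ s x) =
      2 * b.genLevel s - P.rootFunctional (b.genRoot θ s) x := by
  rw [rootFunctional_coxeterGen, pairing_same]
  push_cast
  ring

lemma Base.coxeterGen_coxeterGen (θ : ι) (s : Option b.support) (x : P.Apartment) :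
    b.coxeterGen θ s (b.coxeterGen θ s x) = x := by
  rw [coxeterGen_apply θ s (b.coxeterGen θ s x), genRoot_coxeterGen, coxeterGen_apply]
  module

lemma Base.coxeterGen_mul_self (θ : ι) (s : Option b.support) :
    b.coxeterGen θ s * b.coxeterGen θ s = 1 := by
  ext x
  simp [AffineEquiv.mul_def, coxeterGen_coxeterGen]

lemma Base.genRoot_floor {θ : ι} (hθ : b.IsHighestRoot θ) (s : Option b.support) :
    b.chamberFloor (b.genRoot θ s) = b.genLevel s - 1 := by
  cases s with
  | none =>
    have : ¬b.IsPos (P.reflectionPerm θ θ) := by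
      rw [isPos_neg_iff, not_not]
      exact hθ.isPos
    simp [genRoot, genLevel, chamberFloor, this]
  | some i => simp [genRoot, genLevel, chamberFloor, isPos_of_mem_support i.2]

/-- A Coxeter generator moves the base chamber across a single hyperplane. -/
lemma Base.coxeterGen_apply_lt [Finite ι] [P.IsReduced] {θ : ι} (hθ : b.IsHighestRoot θ)
    (s : Option b.support) {x : P.Apartment} (hx : x ∈ b.openChamber) {j : ι}
    (h1 : j ≠ b.genRoot θ s)
    (h2 : j ≠ P.reflectionPerm (b.genRoot θ s) (b.genRoot θ s)) :
    (b.chamberFloor j : ℝ) < P.rootFunctional j (b.coxeterGen θ s x) ∧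
      P.rootFunctional j (b.coxeterGen θ s x) < b.chamberFloor j + 1 := by
  suffices H : ∀ j, b.IsPos j → j ≠ b.genRoot θ s →
      j ≠ P.reflectionPerm (b.genRoot θ s) (b.genRoot θ s) →
      -1 < P.rootFunctional j (b.coxeterGen θ s x) ∧
        P.rootFunctional j (b.coxeterGen θ s x) < 0 by
    by_cases hj : b.IsPos j
    · simpa [chamberFloor, hj] using H j hj h1 h2
    · have := H _ ((b.isPos_neg_iff j).2 hj) ?_ ?_
      · simp only [rootFunctional_neg] at this
        simp only [chamberFloor, hj, if_false, Int.cast_zero]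
        constructor <;> linarith
      · rintro h
        rw [← h] at h2
        simp at h2
      · intro h
        apply h1
        rw [← P.reflectionPerm_neg_neg j, h, reflectionPerm_neg_neg]
  intro j hj h1 h2
  cases s with
  | some i =>
    change -1 < P.rootFunctional j (P.affReflection i x) ∧
      P.rootFunctional j (P.affReflection i x) < 0
    rw [rootFunctional_affReflection]
    exact hx _ (hj.reflectionPerm i.2 h1)
  | none =>
    simp only [genRoot, reflectionPerm_neg_neg] at h1 h2
    rw [rootFunctional_coxeterGen]
    simp only [genRoot, genLevel, rootFunctional_neg, pairing_reflectionPerm_self_right]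
    have h3 := hx j hj
    have h4 := hx θ hθ.isPos
    rcases hθ.pairing_eq hj h2 with h | h
    · simpa [h] using h3
    -- When the pairing is 1, s_θ(j) = j - θ has negative height, so θ - j is a positive root. The
    -- new value of `j` is -(θ - j)(x) - 1, and the bounds for θ - j on the chamber finish the case.
    · rw [h]
      have hk : b.IsPos (P.reflectionPerm (P.reflectionPerm θ j) (P.reflectionPerm θ j)) := by
        rw [isPos_neg_iff, isPos_iff]
        have hk : P.root (P.reflectionPerm θ j) = P.root j - P.root θ := by
          rw [root_reflectionPerm, reflection_apply_root, h, one_smul]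
        rw [b.height_sub hk]
        have := hθ.height_lt h2
        omega
      have h5 := hx _ hk
      rw [rootFunctional_neg] at h5
      have h6 : P.rootFunctional (P.reflectionPerm θ j) x =
          P.rootFunctional j x - P.rootFunctional θ x := by
        rw [← rootFunctional_affReflection, affReflection_apply, map_sub, map_smul,
          rootFunctional_adjointCochar, adjointCoroot_apply, h]
        simp
      rw [h6] at h5
      push_cast
      constructor <;> linarith

lemma Base.floor_coxeterGen [Finite ι] [P.IsReduced] {θ : ι} (hθ : b.IsHighestRoot θ)
    (s : Option b.support) {x : P.Apartment} (hx : x ∈ b.openChamber) :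
    (∀ j, j ≠ b.genRoot θ s → j ≠ P.reflectionPerm (b.genRoot θ s) (b.genRoot θ s) →
      ⌊P.rootFunctional j (b.coxeterGen θ s x)⌋ = b.chamberFloor j) ∧
    ⌊P.rootFunctional (b.genRoot θ s) (b.coxeterGen θ s x)⌋ = b.genLevel s ∧
    ⌊P.rootFunctional (P.reflectionPerm (b.genRoot θ s) (b.genRoot θ s))
      (b.coxeterGen θ s x)⌋ = -b.genLevel s - 1 := by
  have h0 : ⌊P.rootFunctional (b.genRoot θ s) (b.coxeterGen θ s x)⌋ = b.genLevel s := by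
    have := (b.mem_openChamber_iff x).1 hx (b.genRoot θ s)
    rw [genRoot_floor hθ] at this
    push_cast at this
    rw [genRoot_coxeterGen, Int.floor_eq_iff]
    constructor <;> linarith
  refine ⟨fun j h1 h2 => ?_, h0, ?_⟩
  · rw [Int.floor_eq_iff]
    exact ⟨(coxeterGen_apply_lt hθ s hx h1 h2).1.le, (coxeterGen_apply_lt hθ s hx h1 h2).2⟩
  · rw [((isRegularPoint_of_mem_openChamber hx).map (b.coxeterGen_mem θ s)).floor_neg, h0]

/-- A regular point outside the base chamber is separated from it by a wall of the chamber. -/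
lemma Base.exists_genLevel_lt [Finite ι] {θ : ι} (hθ : b.IsHighestRoot θ) {y : P.Apartment}
    (hy : P.IsRegularPoint y) (hyC : y ∉ b.openChamber) :
    ∃ s : Option b.support, (b.genLevel s : ℝ) < P.rootFunctional (b.genRoot θ s) y := by
  by_contra! hcon
  apply hyC
  have h1 : ∀ i ∈ b.support, P.rootFunctional i y < 0 := fun i hi => by
    have := hcon (some ⟨i, hi⟩)
    simp only [genLevel, genRoot, Int.cast_zero] at this
    exact lt_of_le_of_ne this (by simpa using hy i 0)
  have h2 : -1 < P.rootFunctional θ y := by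
    have := hcon none
    simp only [genLevel, genRoot, Int.cast_one, rootFunctional_neg] at this
    refine lt_of_le_of_ne (by linarith) (by simpa using (hy θ (-1)).symm)
  intro i hi
  refine ⟨?_, hi.rootFunctional_lt_zero h1⟩
  by_cases h : i = θ
  · rwa [h]
  · exact h2.trans (hθ.rootFunctional_lt h1 h)

end Alcove

/-! ### Counting separating hyperplanes, and the upper bound for the length -/

section Distance

variable {P : RootPairing ι ℤ X Y} {b : P.Base} [Fintype ι]

/-- Twice the number of hyperplanes separating two points. -/
noncomputable def wallDist (P : RootPairing ι ℤ X Y) (x y : P.Apartment) : ℤ :=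
  ∑ i, |⌊P.rootFunctional i x⌋ - ⌊P.rootFunctional i y⌋|

lemma wallDist_nonneg (x y : P.Apartment) : 0 ≤ P.wallDist x y :=
  Finset.sum_nonneg fun _ _ => abs_nonneg _

/-- The permutation of roots reindexes the sum, and the integral shifts cancel in each difference of
floors. -/
lemma wallDist_map {w : P.AffineTransf} (hw : w ∈ P.extAffineWeyl) (x y : P.Apartment) :
    P.wallDist (w x) (w y) = P.wallDist x y := by
  obtain ⟨π, c, h⟩ := P.exists_perm_of_mem_extAffineWeyl hw
  rw [wallDist, wallDist,
    ← Equiv.sum_comp π fun i => |⌊P.rootFunctional i x⌋ - ⌊P.rootFunctional i y⌋|]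
  refine Finset.sum_congr rfl fun i _ => ?_
  rw [h, h, Int.floor_add_intCast, Int.floor_add_intCast, add_sub_add_right_eq_sub]

lemma sum_eq_sum_add_of_ne (f g : ι → ℤ) {i j : ι} (hij : i ≠ j)
    (h : ∀ k, k ≠ i → k ≠ j → f k = g k) :
    ∑ k, f k = ∑ k, g k + (f i - g i) + (f j - g j) := by
  classical
  have h1 : ∑ k, (f k - g k) = ∑ k ∈ {i, j}, (f k - g k) := by
    symm
    apply Finset.sum_subset (Finset.subset_univ _)
    intro k _ hk
    simp only [Finset.mem_insert, Finset.mem_singleton, not_or] at hk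
    rw [h k hk.1 hk.2, sub_self]
  rw [Finset.sum_pair hij, Finset.sum_sub_distrib] at h1
  linarith

/-- By invariance the generator may be applied to `x` instead of `y`. It then changes the floors at
`genRoot` and its negative only, each by one towards `y`. -/
lemma Base.wallDist_coxeterGen [P.IsReduced] {θ : ι} (hθ : b.IsHighestRoot θ)
    (s : Option b.support) {x y : P.Apartment} (hx : x ∈ b.openChamber) (hy : P.IsRegularPoint y)
    (hs : (b.genLevel s : ℝ) < P.rootFunctional (b.genRoot θ s) y) :
    P.wallDist x (b.coxeterGen θ s y) + 2 = P.wallDist x y := by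
  have h1 : P.wallDist x (b.coxeterGen θ s y) = P.wallDist (b.coxeterGen θ s x) y := by
    rw [← wallDist_map (b.coxeterGen_mem θ s), coxeterGen_coxeterGen]
  have hne := (P.reflectionPerm_ne_self (b.genRoot θ s)).symm
  have hfl : b.genLevel s ≤ ⌊P.rootFunctional (b.genRoot θ s) y⌋ := Int.le_floor.2 hs.le
  obtain ⟨hf1, hf2, hf3⟩ := floor_coxeterGen hθ s hx
  rw [h1, wallDist, wallDist, sum_eq_sum_add_of_ne _
    (fun i => |⌊P.rootFunctional i x⌋ - ⌊P.rootFunctional i y⌋|) hne]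
  · rw [hf2, hf3, hy.floor_neg, (isRegularPoint_of_mem_openChamber hx).floor_neg,
      floor_eq_chamberFloor hx (b.genRoot θ s), genRoot_floor hθ]
    rw [abs_of_nonpos, abs_of_nonpos, abs_of_nonneg, abs_of_nonneg] <;> omega
  · intro k hk1 hk2
    rw [hf1 k hk1 hk2, floor_eq_chamberFloor hx]

/-- Greedy descent: as long as the image of `x₀` is outside the base chamber, some wall of the
chamber separates it, and reflecting in this wall lowers the distance by 2. Once inside, the
remaining element stabilizes the chamber. -/
lemma Base.exists_word [P.IsReduced] {θ : ι} (hθ : b.IsHighestRoot θ) {x₀ : P.Apartment}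
    (hx₀ : x₀ ∈ b.openChamber) {w : P.AffineTransf} (hw : w ∈ P.extAffineWeyl) :
    ∃ (l : List (Option b.support)) (v : P.AffineTransf), v ∈ P.extAffineWeyl ∧
      v '' b.chamber = b.chamber ∧ w = (l.map (b.coxeterGen θ)).prod * v ∧
      2 * (l.length : ℤ) ≤ P.wallDist x₀ (w x₀) := by
  obtain ⟨N, hN⟩ : ∃ N : ℕ, P.wallDist x₀ (w x₀) ≤ N :=
    ⟨_, Int.self_le_toNat _⟩
  induction N using Nat.strong_induction_on generalizing w with
  | _ N ih =>
    by_cases hC : w x₀ ∈ b.openChamber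
    · refine ⟨[], w, hw, image_chamber_eq_of_mem hw hx₀ hC, by simp, ?_⟩
      simpa using wallDist_nonneg x₀ (w x₀)
    · have hreg := (isRegularPoint_of_mem_openChamber hx₀).map hw
      obtain ⟨s, hs⟩ := exists_genLevel_lt hθ hreg hC
      have hd := wallDist_coxeterGen hθ s hx₀ hreg hs
      have h0 : 0 ≤ P.wallDist x₀ (b.coxeterGen θ s (w x₀)) :=
        wallDist_nonneg _ _
      obtain ⟨l, v, hv, hvC, hl, hle⟩ := ih (N - 1) (by omega)
        (mul_mem (b.coxeterGen_mem θ s) hw) (by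
          rw [AffineEquiv.mul_def, AffineEquiv.trans_apply]; omega)
      refine ⟨s :: l, v, hv, hvC, ?_, ?_⟩
      · rw [List.map_cons, List.prod_cons, mul_assoc, ← hl, ← mul_assoc, coxeterGen_mul_self,
          one_mul]
      · rw [AffineEquiv.mul_def, AffineEquiv.trans_apply] at hle
        rw [List.length_cons]
        push_cast
        omega

/-- Only this half of the equality between length and number of separating hyperplanes is needed:
straightness makes the left side large, which forces a large net displacement. -/
lemma Base.two_mul_length_le [P.IsReduced] {θ : ι} (hθ : b.IsHighestRoot θ) {x₀ : P.Apartment}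
    (hx₀ : x₀ ∈ b.openChamber) {w : P.AffineTransf} (hw : w ∈ P.extAffineWeyl) :
    2 * (b.length θ w : ℤ) ≤ P.wallDist x₀ (w x₀) := by
  obtain ⟨l, v, hv, hvC, hl, hle⟩ := exists_word hθ hx₀ hw
  have : b.length θ w ≤ l.length := Nat.sInf_le ⟨l, v, hv, hvC, rfl, hl⟩
  omega

end Distance

end RootPairing

/-! ### Crossings of a single wall, and galleries of straight elements -/

namespace RootPairing

variable {ι X Y : Type*} [AddCommGroup X] [AddCommGroup Y] {P : RootPairing ι ℤ X Y} {b : P.Base}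

/-- The interiors of two chambers given by the integers `k` and `k'` are adjacent, the hyperplane
between them belongs to the root `ε`, which increases from the first to the second, and `y` is a
point of this hyperplane which lies on no other hyperplane and belongs to both chambers. -/
structure IsCrossing (P : RootPairing ι ℤ X Y) (k k' : ι → ℤ) (ε : ι) (y : P.Apartment) :
    Prop where
  apply_self : k' ε = k ε + 1
  apply_neg : k' (P.reflectionPerm ε ε) = k (P.reflectionPerm ε ε) - 1
  apply_of_ne : ∀ i, i ≠ ε → i ≠ P.reflectionPerm ε ε → k' i = k i
  wall : P.rootFunctional ε y = k ε + 1
  lt_wall : ∀ i, i ≠ ε → i ≠ P.reflectionPerm ε ε →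
    (k i : ℝ) < P.rootFunctional i y ∧ P.rootFunctional i y < k i + 1

lemma Base.isCrossing_coxeterGen [Finite ι] [P.IsReduced] {θ : ι} (hθ : b.IsHighestRoot θ)
    (s : Option b.support) {x : P.Apartment} (hx : x ∈ b.openChamber) :
    ∃ y, P.IsCrossing (fun i => ⌊P.rootFunctional i x⌋)
      (fun i => ⌊P.rootFunctional i (b.coxeterGen θ s x)⌋) (b.genRoot θ s) y := by
  obtain ⟨hf1, hf2, hf3⟩ := floor_coxeterGen hθ s hx
  -- The midpoint of `x` and its mirror image lies on the wall. Every other root lies in the same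
  -- open unit interval at both ends, hence also at the midpoint.
  refine ⟨(2⁻¹ : ℝ) • (x + b.coxeterGen θ s x), ?_, ?_, ?_, ?_, ?_⟩
  · simp only [hf2, floor_eq_chamberFloor hx, genRoot_floor hθ]
    ring
  · simp only [hf3, (isRegularPoint_of_mem_openChamber hx).floor_neg]
    rw [floor_eq_chamberFloor hx, genRoot_floor hθ]
    ring
  · intro i h1 h2
    simp only [hf1 i h1 h2, floor_eq_chamberFloor hx]
  · rw [map_smul, map_add, genRoot_coxeterGen, floor_eq_chamberFloor hx, genRoot_floor hθ]
    push_cast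
    rw [smul_eq_mul]
    ring
  · intro i h1 h2
    rw [floor_eq_chamberFloor hx, map_smul, map_add, smul_eq_mul]
    have h3 := coxeterGen_apply_lt hθ s hx h1 h2
    have h4 := (b.mem_openChamber_iff x).1 hx i
    constructor <;> linarith

variable (b) in
include b in
-- Evaluation at 0 shows that the constants attached to a root and its negative are opposite; after
-- removing them the linear parts can be compared.
lemma Base.perm_neg {w : P.AffineTransf} {π : Equiv.Perm ι} {c : ι → ℤ}
    (h : ∀ i x, P.rootFunctional i (w x) = P.rootFunctional (π i) x + c i) (i : ι) :
    π (P.reflectionPerm i i) = P.reflectionPerm (π i) (π i) := by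
  apply b.rootFunctional_injective
  ext x
  have h1 := h (P.reflectionPerm i i) x
  have h2 := h (P.reflectionPerm i i) 0
  rw [rootFunctional_neg, h] at h1 h2
  rw [map_zero, map_zero] at h2
  rw [rootFunctional_neg]
  linarith

/-- Transports the crossing at the base chamber by `w`: the wall point becomes `w y`, and the
crossed root is the preimage of `genRoot` under the permutation of roots attached to `w`. -/
lemma Base.isCrossing_mul_coxeterGen [Finite ι] [P.IsReduced] {θ : ι} (hθ : b.IsHighestRoot θ)
    {w : P.AffineTransf} (hw : w ∈ P.extAffineWeyl)
    (s : Option b.support) {x : P.Apartment} (hx : x ∈ b.openChamber) :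
    ∃ ε y, P.IsCrossing (fun i => ⌊P.rootFunctional i (w x)⌋)
      (fun i => ⌊P.rootFunctional i (w (b.coxeterGen θ s x))⌋) ε y := by
  obtain ⟨π, c, h⟩ := P.exists_perm_of_mem_extAffineWeyl hw
  obtain ⟨y, hy⟩ := isCrossing_coxeterGen hθ s hx
  have hinv : π (π.symm (b.genRoot θ s)) = b.genRoot θ s := π.apply_symm_apply _
  have hneg := b.perm_neg h (π.symm (b.genRoot θ s))
  rw [hinv] at hneg
  have hne : ∀ i, i ≠ π.symm (b.genRoot θ s) → π i ≠ b.genRoot θ s := fun i hi hi' =>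
    hi (by rw [← hi', Equiv.symm_apply_apply])
  have hne' : ∀ i, i ≠ P.reflectionPerm (π.symm (b.genRoot θ s)) (π.symm (b.genRoot θ s)) →
      π i ≠ P.reflectionPerm (b.genRoot θ s) (b.genRoot θ s) := fun i hi hi' =>
    hi (π.injective (hi'.trans hneg.symm))
  refine ⟨π.symm (b.genRoot θ s), w y, ?_, ?_, ?_, ?_, ?_⟩
  · have := hy.apply_self
    simp only [h, Int.floor_add_intCast, hinv] at this ⊢
    omega
  · have := hy.apply_neg
    simp only [h, Int.floor_add_intCast, hneg] at this ⊢
    omega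
  · intro i h1 h2
    have := hy.apply_of_ne (π i) (hne i h1) (hne' i h2)
    simp only [h, Int.floor_add_intCast] at this ⊢
    omega
  · have := hy.wall
    simp only [h, Int.floor_add_intCast, hinv] at this ⊢
    push_cast
    linarith
  · intro i h1 h2
    have := hy.lt_wall (π i) (hne i h1) (hne' i h2)
    simp only [h, Int.floor_add_intCast] at this ⊢
    push_cast
    constructor <;> linarith

/-- The elements `φ ^ a s_{β(1)} ⋯ s_{β(b)}` mapping the base chamber to those of the gallery. -/
def Base.galleryElt (b : P.Base) (θ : ι) (φ : P.AffineTransf) {r : ℕ}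
    (β : Fin r → Option b.support) (j : ℕ) : P.AffineTransf :=
  φ ^ (j / r) * (((List.ofFn β).take (j % r)).map (b.coxeterGen θ)).prod

lemma Base.prod_coxeterGen_mem (θ : ι) (l : List (Option b.support)) :
    (l.map (b.coxeterGen θ)).prod ∈ P.extAffineWeyl := by
  refine Subgroup.list_prod_mem _ fun x hx => ?_
  obtain ⟨s, -, rfl⟩ := List.mem_map.1 hx
  exact b.coxeterGen_mem θ s

lemma Base.galleryElt_mem {θ : ι} {φ : P.AffineTransf} (hφ : φ ∈ P.extAffineWeyl) {r : ℕ}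
    (β : Fin r → Option b.support) (j : ℕ) : b.galleryElt θ φ β j ∈ P.extAffineWeyl :=
  mul_mem (S := Subgroup P.AffineTransf) (pow_mem hφ _) (prod_coxeterGen_mem θ _)

/-- The factor `u` absorbs the wrap-around. At the end of the word the next element begins with a
new factor φ, which is the full word times `v`, and `v` does not move the base chamber. -/
lemma Base.galleryElt_succ {θ : ι} {φ v : P.AffineTransf} {r : ℕ} (hr : 0 < r)
    {β : Fin r → Option b.support}
    (hφ : φ = ((List.ofFn β).map (b.coxeterGen θ)).prod * v) (j : ℕ) :
    ∃ s u, (u = 1 ∨ u = v) ∧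
      b.galleryElt θ φ β (j + 1) = b.galleryElt θ φ β j * b.coxeterGen θ s * u := by
  have hlt : j % r < r := Nat.mod_lt _ hr
  have htake : ((List.ofFn β).take (j % r + 1)) =
      (List.ofFn β).take (j % r) ++ [β ⟨j % r, hlt⟩] := by
    rw [List.take_add_one]
    simp [hlt]
  refine ⟨β ⟨j % r, hlt⟩, ?_⟩
  by_cases h : j % r + 1 < r
  · refine ⟨1, Or.inl rfl, ?_⟩
    have h1 : (j + 1) / r = j / r := by
      have hnd : ¬r ∣ j + 1 := fun hd => by
        have := Nat.mod_eq_zero_of_dvd hd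
        rw [Nat.add_mod, Nat.mod_eq_of_lt (by omega : 1 < r), Nat.mod_eq_of_lt h] at this
        omega
      rw [Nat.succ_div_of_not_dvd hnd]
    have h2 : (j + 1) % r = j % r + 1 := by
      rw [Nat.add_mod, Nat.mod_eq_of_lt (by omega : 1 < r), Nat.mod_eq_of_lt h]
    rw [galleryElt, galleryElt, h1, h2, htake]
    simp [mul_assoc]
  · refine ⟨v, Or.inr rfl, ?_⟩
    have h0 : j % r + 1 = r := by omega
    have hd : r ∣ j + 1 := by
      rw [← Nat.div_add_mod j r, add_assoc, h0]
      exact Dvd.dvd.add ⟨_, rfl⟩ dvd_rfl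
    have h1 : (j + 1) / r = j / r + 1 := Nat.succ_div_of_dvd hd
    have h2 : (j + 1) % r = 0 := Nat.mod_eq_zero_of_dvd hd
    have h3 : (List.ofFn β).take (j % r + 1) = List.ofFn β := by
      rw [h0]
      exact List.take_of_length_le (by simp)
    rw [h3] at htake
    have h4 : φ = (((List.ofFn β).take (j % r)).map (b.coxeterGen θ)).prod *
        b.coxeterGen θ (β ⟨j % r, hlt⟩) * v := by
      conv_lhs => rw [hφ, htake]
      simp
    rw [galleryElt, galleryElt, h1, h2, pow_succ]
    nth_rw 2 [h4]
    simp [mul_assoc]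

lemma Base.length_mul_eq_of_image_eq {θ : ι} (w : P.AffineTransf) {v : P.AffineTransf}
    (hv : v ∈ P.extAffineWeyl) (hvC : v '' b.chamber = b.chamber) :
    b.length θ (w * v) = b.length θ w := by
  have hvi : (v⁻¹ : P.AffineTransf) '' b.chamber = b.chamber := by
    have : (v⁻¹ : P.AffineTransf) ∘ v = id := funext v.symm_apply_apply
    nth_rw 1 [← hvC]
    rw [← Set.image_comp, this, Set.image_id]
  have key : ∀ u u' : P.AffineTransf, u ∈ P.extAffineWeyl → u '' b.chamber = b.chamber →
      u' ∈ P.extAffineWeyl → u' '' b.chamber = b.chamber →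
      u * u' ∈ P.extAffineWeyl ∧ (u * u') '' b.chamber = b.chamber := by
    intro u u' hu huC hu' huC'
    refine ⟨mul_mem hu hu', ?_⟩
    rw [AffineEquiv.mul_def, AffineEquiv.coe_trans, Set.image_comp, huC', huC]
  unfold length
  congr 1
  ext n
  constructor
  · rintro ⟨l, u, hu, huC, hl, h⟩
    obtain ⟨h1, h2⟩ := key u v⁻¹ hu huC (inv_mem hv) hvi
    exact ⟨l, u * v⁻¹, h1, h2, hl, by rw [← mul_assoc, ← h, mul_inv_cancel_right]⟩
  · rintro ⟨l, u, hu, huC, hl, h⟩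
    obtain ⟨h1, h2⟩ := key u v hu huC hv hvC
    exact ⟨l, u * v, h1, h2, hl, by rw [← mul_assoc, ← h]⟩

lemma IsCrossing.sum_abs [Fintype ι] {k k' : ι → ℤ} {ε : ι} {y : P.Apartment}
    (h : P.IsCrossing k k' ε y) : ∑ i, |k' i - k i| = 2 := by
  rw [sum_eq_sum_add_of_ne (fun i => |k' i - k i|) 0 (P.reflectionPerm_ne_self ε).symm]
  · simp [h.apply_self, h.apply_neg]
  · intro i h1 h2
    simp [h.apply_of_ne i h1 h2]

/-- In a gallery given by a straight element which has a power in common with a minuscule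
coweight `τ`, all hyperplanes are crossed in the direction of a positive root `ε` with
`⟨ε, τ⟩ = 1`. -/
theorem Base.gallery_crossing [Finite ι] [P.IsReduced] {θ : ι} (hθ : b.IsHighestRoot θ)
    {τ : P.AdjointCochar} (hτ : b.IsMinuscule τ)
    {φ v : P.AffineTransf} (hφ : φ ∈ P.extAffineWeyl) {r m n : ℕ} (hr : 0 < r) (hn : 0 < n)
    (hrφ : r = b.length θ φ) (hpow : b.IsPowerMultiplicative θ φ)
    (hφτ : φ ^ n = P.translation τ ^ m) (hv : v ∈ P.extAffineWeyl)
    (hvC : v '' b.chamber = b.chamber) {β : Fin r → Option b.support}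
    (hφv : φ = ((List.ofFn β).map (b.coxeterGen θ)).prod * v)
    {x₀ : P.Apartment} (hx₀ : x₀ ∈ b.openChamber) (j : ℕ) :
    ∃ ε y, b.IsPos ε ∧ τ (P.rootSpanMem ℤ ε) = 1 ∧
      P.IsCrossing (fun i => ⌊P.rootFunctional i (b.galleryElt θ φ β j x₀)⌋)
        (fun i => ⌊P.rootFunctional i (b.galleryElt θ φ β (j + 1) x₀)⌋) ε y := by
  cases nonempty_fintype ι
  set V : ℕ → ι → ℤ := fun j i => ⌊P.rootFunctional i (b.galleryElt θ φ β j x₀)⌋ with hV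
  have hstep : ∀ j, ∃ ε y, P.IsCrossing (V j) (V (j + 1)) ε y := by
    intro j
    obtain ⟨s, u, hu, hsucc⟩ := galleryElt_succ hr hφv j
    have hu0 : u x₀ ∈ b.openChamber := by
      rcases hu with rfl | rfl
      · exact hx₀
      · exact map_mem_openChamber hv hvC hx₀
    have hw := galleryElt_mem (θ := θ) hφ β j
    obtain ⟨ε, y, h⟩ := isCrossing_mul_coxeterGen hθ hw s hu0
    refine ⟨ε, y, ?_⟩
    -- Both `u x₀` and `x₀` are interior to the base chamber, so replacing one by the other does not
    -- change the floors.
    convert h using 1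
    · funext i
      obtain ⟨π, c, h⟩ := P.exists_perm_of_mem_extAffineWeyl hw
      simp only [hV, h, Int.floor_add_intCast, floor_eq_chamberFloor hx₀, floor_eq_chamberFloor hu0]
    · funext i
      simp only [hV, hsucc]
      rfl
  -- The cut-off `J = nqr` must exceed `j` and be a multiple of `nr`, so that the gallery element
  -- there is a pure translation by a multiple of τ.
  obtain ⟨q, hq⟩ : ∃ q : ℕ, q = j + 1 := ⟨_, rfl⟩
  set J := n * q * r with hJ
  have hjJ : j < J := by
    have : 1 * q * 1 ≤ n * q * r := by gcongr <;> omega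
    omega
  have helt : b.galleryElt θ φ β J = P.translation τ ^ (m * q) := by
    rw [galleryElt, hJ, Nat.mul_div_cancel _ hr, Nat.mul_mod_left, pow_mul, hφτ, ← pow_mul]
    simp
  have helt' : b.galleryElt θ φ β J = φ ^ (n * q) := by
    rw [helt, pow_mul, ← hφτ, pow_mul]
  have helt0 : b.galleryElt θ φ β 0 = 1 := by simp [galleryElt]
  have hend : ∀ i, V J i - V 0 i = (m * q : ℕ) * τ (P.rootSpanMem ℤ i) := by
    intro i
    simp only [hV, helt, helt0, translation_pow_apply]
    rw [← Int.cast_natCast, ← Int.cast_mul, Int.floor_add_intCast]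
    simp
  have hlen : 2 * (J : ℤ) ≤ ∑ i, |V J i - V 0 i| := by
    have h1 := two_mul_length_le hθ hx₀ (pow_mem hφ (n * q))
    rw [hpow, ← hrφ, ← hJ] at h1
    refine h1.trans (le_of_eq (Finset.sum_congr rfl fun i _ => ?_))
    rw [abs_sub_comm]
    simp only [hV, helt', helt0]
    rfl
  have hle : ∀ i ∈ Finset.univ, |V J i - V 0 i| ≤ ∑ l ∈ Finset.range J, |V (l + 1) i - V l i| := by
    intro i _
    rw [← Finset.sum_range_sub (fun l => V l i) J]
    exact Finset.abs_sum_le_sum_abs _ _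
  have htot : ∑ i, ∑ l ∈ Finset.range J, |V (l + 1) i - V l i| = 2 * (J : ℤ) := by
    rw [Finset.sum_comm, Finset.sum_congr rfl (g := fun _ => (2 : ℤ))]
    · simp [mul_comm]
    · intro l _
      obtain ⟨ε, y, h⟩ := hstep l
      exact h.sum_abs
  -- The sum of the net changes is at least `2J` by straightness, and the total variation is exactly
  -- `2J`. So the triangle inequality is an equality for each root separately.
  have heq := (Finset.sum_eq_sum_iff_of_le hle).1
    (le_antisymm (Finset.sum_le_sum hle) (htot ▸ hlen))
  have hmono : ∀ i, b.IsPos i → ∀ l < J, V l i ≤ V (l + 1) i := by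
    intro i hi l hl
    have h0 : 0 ≤ V J i - V 0 i := by
      rw [hend]
      rcases hτ i hi with h | h <;> rw [h] <;> positivity
    have h1 := heq i (Finset.mem_univ i)
    rw [abs_of_nonneg h0, ← Finset.sum_range_sub (fun l => V l i) J] at h1
    have h2 := (Finset.sum_eq_sum_iff_of_le fun l _ => le_abs_self _).1 h1 l (Finset.mem_range.2 hl)
    have := abs_nonneg (V (l + 1) i - V l i)
    omega
  obtain ⟨ε, y, h⟩ := hstep j
  have hpos : b.IsPos ε := by
    by_contra hneg
    have := hmono _ ((b.isPos_neg_iff ε).2 hneg) j hjJ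
    have := h.apply_neg
    omega
  -- If ⟨ε, τ⟩ were 0, the net change of ε and hence its variation would vanish, but step `j`
  -- changes its floor.
  refine ⟨ε, y, hpos, (hτ ε hpos).resolve_left fun h0 => ?_, h⟩
  have h1 := heq ε (Finset.mem_univ ε)
  rw [hend, h0, mul_zero, abs_zero] at h1
  have h2 := (Finset.sum_eq_zero_iff_of_nonneg fun l _ => abs_nonneg _).1 h1.symm j
    (Finset.mem_range.2 hjJ)
  rw [abs_eq_zero] at h2
  have := h.apply_self
  omega

end RootPairing

/-! ### Conjugation by the exponential of a nilpotent element -/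

section ExpConj

open IsNilpotent

variable {A : Type*} [Ring A] [Algebra ℚ A]

/-- The commutator with `a`, as a linear map. -/
def commMap (a : A) : Module.End ℚ A := LinearMap.mulLeft ℚ a - LinearMap.mulRight ℚ a

lemma commMap_apply (a x : A) : commMap a x = ⁅a, x⁆ := rfl

lemma isNilpotent_commMap {a : A} (ha : IsNilpotent a) : IsNilpotent (commMap a) :=
  (LinearMap.commute_mulLeft_right (R := ℚ) a a).isNilpotent_sub
    ((LinearMap.isNilpotent_mulLeft_iff ℚ a).2 ha) ((LinearMap.isNilpotent_mulRight_iff ℚ a).2 ha)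

/-- This is Ad(exp a) = exp(ad a): left and right multiplication by `a` commute, so the exponential
of their difference factors. The series may be cut off as soon as it kills the given `b`. -/
lemma IsNilpotent.exp_mul_mul_exp_neg {a : A} (ha : IsNilpotent a) (b : A) {n : ℕ}
    (hn : (commMap a ^ n) b = 0) :
    exp a * b * exp (-a) =
      ∑ i ∈ Finset.range n, (i.factorial : ℚ)⁻¹ • (commMap a ^ i) b := by
  have hL : IsNilpotent (LinearMap.mulLeft ℚ a) := (LinearMap.isNilpotent_mulLeft_iff ℚ a).2 ha
  have hR : IsNilpotent (LinearMap.mulRight ℚ a) := (LinearMap.isNilpotent_mulRight_iff ℚ a).2 ha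
  have h1 := exp_smul_eq_sum (A := Module.End ℚ A) hn (isNilpotent_commMap ha)
  simp only [Module.End.smul_def] at h1
  rw [← h1, commMap, sub_eq_add_neg,
    exp_add_of_commute ((LinearMap.commute_mulLeft_right (R := ℚ) a a).neg_right) hL hR.neg,
    Module.End.mul_apply]
  obtain ⟨N, hN⟩ := ha
  have hN' : (-a) ^ N = 0 := by rw [neg_pow, hN, mul_zero]
  have hLN : LinearMap.mulLeft ℚ a ^ N = 0 := by rw [LinearMap.pow_mulLeft, hN]; ext; simp
  have hRN : LinearMap.mulRight ℚ (-a) ^ N = 0 := by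
    rw [LinearMap.pow_mulRight, hN']; ext; simp
  have hRa : -LinearMap.mulRight ℚ a = LinearMap.mulRight ℚ (-a) := by ext; simp
  rw [hRa, exp_eq_sum hLN, exp_eq_sum hRN, exp_eq_sum hN, exp_eq_sum hN']
  simp [LinearMap.pow_mulLeft, LinearMap.pow_mulRight, Finset.sum_mul, Finset.mul_sum, mul_assoc]

end ExpConj

/-! ### The adjoint action of root elements on root vectors and Cartan elements -/

namespace ChevalleyRep

open IsNilpotent Matrix

variable {p : ℕ} [Fact p.Prime] {ι X Y : Type*} [Finite ι] [AddCommGroup X] [AddCommGroup Y]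
  {P : RootPairing ι ℤ X Y} {κ : Type*} [Fintype κ] [DecidableEq κ] (R : ChevalleyRep p P κ)

/-- The adjoint action of `GL_κ` on matrices. -/
noncomputable def adj (g : GL κ ℚ_[p]) : Matrix κ κ ℚ_[p] →ₗ[ℚ_[p]] Matrix κ κ ℚ_[p] where
  toFun A := g * A * (g⁻¹ : GL κ ℚ_[p])
  map_add' A B := by rw [mul_add, add_mul]
  map_smul' c A := by simp

lemma adj_apply (g : GL κ ℚ_[p]) (A : Matrix κ κ ℚ_[p]) :
    adj g A = g * A * (g⁻¹ : GL κ ℚ_[p]) := rfl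

lemma adj_mul (g h : GL κ ℚ_[p]) (A : Matrix κ κ ℚ_[p]) : adj (g * h) A = adj g (adj h A) := by
  simp only [adj_apply, _root_.mul_inv_rev, Units.val_mul, mul_assoc]

@[simp]
lemma adj_one (A : Matrix κ κ ℚ_[p]) : adj (1 : GL κ ℚ_[p]) A = A := by simp [adj_apply]

@[simp]
lemma adj_inv_adj (g : GL κ ℚ_[p]) (A : Matrix κ κ ℚ_[p]) : adj g⁻¹ (adj g A) = A := by
  rw [← adj_mul, inv_mul_cancel, adj_one]

/-- The element `x_α(u)` of the root subgroup. -/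
noncomputable def rootElt (i : ι) (u : ℚ_[p]) : GL κ ℚ_[p] := R.rootHom i (Multiplicative.ofAdd u)

lemma coe_rootElt (i : ι) (u : ℚ_[p]) :
    (R.rootElt i u : Matrix κ κ ℚ_[p]) = IsNilpotent.exp (u • R.E i) := rfl

lemma rootElt_add (i : ι) (u v : ℚ_[p]) : R.rootElt i (u + v) = R.rootElt i u * R.rootElt i v := by
  rw [rootElt, ofAdd_add, map_mul]
  rfl

lemma rootElt_zero (i : ι) : R.rootElt i 0 = 1 := by
  rw [rootElt, ofAdd_zero, map_one]

lemma rootElt_neg (i : ι) (u : ℚ_[p]) : R.rootElt i (-u) = (R.rootElt i u)⁻¹ := by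
  rw [rootElt, ofAdd_neg, map_inv]
  rfl

/-- The diagonal matrix by which the additive character `χ` of the weight lattice acts. -/
noncomputable def cartan (χ : X →+ ℚ_[p]) : Matrix κ κ ℚ_[p] := diagonal fun k => χ (R.wt k)

lemma cartan_add (χ ψ : X →+ ℚ_[p]) : R.cartan (χ + ψ) = R.cartan χ + R.cartan ψ := by
  simp [cartan, diagonal_add]

lemma cartan_smul (c : ℤ) (χ : X →+ ℚ_[p]) : R.cartan (c • χ) = c • R.cartan χ := by
  rw [cartan, cartan, ← diagonal_smul]
  rfl

/-- The coroot as an additive character of the weight lattice. -/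
noncomputable def corootChar (p : ℕ) [Fact p.Prime] (P : RootPairing ι ℤ X Y) (i : ι) : X →+ ℚ_[p] :=
  (Int.castAddHom ℚ_[p]).comp (P.coroot' i).toAddMonoidHom

omit [Finite ι] in
lemma corootChar_root (i j : ι) : corootChar p P i (P.root j) = (P.pairing j i : ℚ_[p]) := rfl

lemma lie_E_neg (i : ι) :
    ⁅R.E i, R.E (P.reflectionPerm i i)⁆ = R.cartan (corootChar p P i) := R.bracket_neg i

lemma lie_E_cartan (i : ι) (χ : X →+ ℚ_[p]) :
    ⁅R.E i, R.cartan χ⁆ = -(χ (P.root i) • R.E i) := by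
  ext k l
  rw [Ring.lie_def, cartan, Matrix.sub_apply, mul_diagonal, diagonal_mul, Matrix.neg_apply,
    Matrix.smul_apply, smul_eq_mul]
  by_cases h : R.E i k l = 0
  · simp [h]
  · rw [R.wt_eq_of_E_ne_zero i k l h, map_add]
    ring

lemma adj_rootElt (i : ι) (u : ℚ_[p]) (A : Matrix κ κ ℚ_[p]) {n : ℕ}
    (hn : (commMap (u • R.E i) ^ n) A = 0) :
    adj (R.rootElt i u) A = ∑ m ∈ Finset.range n,
      (m.factorial : ℚ)⁻¹ • (commMap (u • R.E i) ^ m) A := by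
  rw [← IsNilpotent.exp_mul_mul_exp_neg ((R.isNilpotent_E i).smul u) A hn, adj_apply,
    ← rootElt_neg, coe_rootElt, coe_rootElt, neg_smul]

omit [DecidableEq κ] in
lemma smul_lie_matrix (u : ℚ_[p]) (A B : Matrix κ κ ℚ_[p]) : ⁅u • A, B⁆ = u • ⁅A, B⁆ := by
  simp [Ring.lie_def, smul_sub]

omit [DecidableEq κ] in
lemma lie_smul_matrix (u : ℚ_[p]) (A B : Matrix κ κ ℚ_[p]) : ⁅A, u • B⁆ = u • ⁅A, B⁆ := by
  simp [Ring.lie_def, smul_sub]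

lemma lie_smul_E_cartan (i : ι) (u : ℚ_[p]) (χ : X →+ ℚ_[p]) :
    ⁅u • R.E i, R.cartan χ⁆ = -((u * χ (P.root i)) • R.E i) := by
  rw [smul_lie_matrix, lie_E_cartan, smul_neg, smul_smul]

lemma lie_smul_E_self (i : ι) (u c : ℚ_[p]) : ⁅u • R.E i, c • R.E i⁆ = 0 := by
  rw [smul_lie_matrix, lie_smul_matrix, Ring.lie_def, sub_self, smul_zero, smul_zero]

lemma adj_rootElt_cartan (i : ι) (u : ℚ_[p]) (χ : X →+ ℚ_[p]) :
    adj (R.rootElt i u) (R.cartan χ) = R.cartan χ - (u * χ (P.root i)) • R.E i := by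
  have h1 : commMap (u • R.E i) (R.cartan χ) = -((u * χ (P.root i)) • R.E i) := by
    rw [commMap_apply, lie_smul_E_cartan]
  have h2 : (commMap (u • R.E i) ^ 2) (R.cartan χ) = 0 := by
    rw [pow_two, Module.End.mul_apply, h1, map_neg, commMap_apply, lie_smul_E_self, neg_zero]
  rw [R.adj_rootElt i u _ h2]
  simp [Finset.sum_range_succ, h1, sub_eq_add_neg]

lemma adj_rootElt_self (i : ι) (u : ℚ_[p]) : adj (R.rootElt i u) (R.E i) = R.E i := by
  have h1 : (commMap (u • R.E i) ^ 1) (R.E i) = 0 := by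
    rw [pow_one, commMap_apply]
    simpa using R.lie_smul_E_self i u 1
  rw [R.adj_rootElt i u _ h1]
  simp

/-- The series stops after the quadratic term, as in sl₂. Its factor 1/2! cancels against ⟨α, α^∨⟩ =
2, so no denominators appear. -/
lemma adj_rootElt_neg (i : ι) (u : ℚ_[p]) :
    adj (R.rootElt i u) (R.E (P.reflectionPerm i i)) =
      R.E (P.reflectionPerm i i) + u • R.cartan (corootChar p P i) - u ^ 2 • R.E i := by
  have h1 : commMap (u • R.E i) (R.E (P.reflectionPerm i i)) =
      u • R.cartan (corootChar p P i) := by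
    rw [commMap_apply, smul_lie_matrix, lie_E_neg]
  have h2 : (commMap (u • R.E i) ^ 2) (R.E (P.reflectionPerm i i)) =
      -((2 * u ^ 2) • R.E i) := by
    rw [pow_two, Module.End.mul_apply, h1, commMap_apply, lie_smul_matrix, lie_smul_E_cartan,
      corootChar_root, P.pairing_same, smul_neg, smul_smul]
    congr 2
    push_cast
    ring
  have h3 : (commMap (u • R.E i) ^ 3) (R.E (P.reflectionPerm i i)) = 0 := by
    rw [pow_succ', Module.End.mul_apply, h2, map_neg, commMap_apply, lie_smul_E_self,
      neg_zero]
  rw [R.adj_rootElt i u _ h3]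
  have h4 : (2⁻¹ : ℚ) • -((2 * u ^ 2) • R.E i) = -(u ^ 2 • R.E i) := by
    rw [smul_neg, mul_smul, ofNat_smul_eq_nsmul ℚ_[p] 2, ← ofNat_smul_eq_nsmul ℚ 2, smul_smul]
    norm_num
  simp [Finset.sum_range_succ, h1, h2, h4, sub_eq_add_neg]

/-- Chevalley's integrality argument. Climbing the root string from β multiplies by ±(q + 1), ±(q +
2), …, ±(q + n), where q is the distance of β from the bottom of the string. The product is ±n!
times a binomial coefficient, so dividing by n! leaves an integer. The clause on `chainBotCoeff`
keeps the induction going. -/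
lemma adj_pow_E_of_ne [P.IsReduced] {i j : ι} (hj : j ≠ i) (hj' : j ≠ P.reflectionPerm i i)
    (u : ℚ_[p]) (n : ℕ) :
    (commMap (u • R.E i) ^ n) (R.E j) = 0 ∨ ∃ (k : ι) (z : ℤ),
      P.root k = P.root j + n • P.root i ∧
      P.chainBotCoeff i k = P.chainBotCoeff i j + n ∧
      (z = (P.chainBotCoeff i j + n).choose n ∨ z = -(P.chainBotCoeff i j + n).choose n) ∧
      (commMap (u • R.E i) ^ n) (R.E j) = (n.factorial * (u ^ n * z)) • R.E k := by
  have hind : LinearIndependent ℤ ![P.root i, P.root j] := by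
    refine RootPairing.IsReduced.linearIndependent P hj.symm fun h => hj' ?_
    rw [RootPairing.root_eq_neg_iff] at h
    rw [h, RootPairing.reflectionPerm_neg_neg]
  induction n with
  | zero => exact Or.inr ⟨j, 1, by simp, by simp, by simp, by simp⟩
  | succ n ih =>
    rcases ih with ih | ⟨k, z, hk, hq, hz, ih⟩
    · left
      rw [pow_succ', Module.End.mul_apply, ih, map_zero]
    · have hind' : LinearIndependent ℤ ![P.root i, P.root k] := by
        rw [hk, add_comm (P.root j), ← natCast_zsmul,
          LinearIndependent.pair_add_smul_right_iff]
        exact hind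
      have h1 : (commMap (u • R.E i) ^ (n + 1)) (R.E j) =
          (n.factorial * (u ^ (n + 1) * z)) • ⁅R.E i, R.E k⁆ := by
        rw [pow_succ', Module.End.mul_apply, ih, commMap_apply, smul_lie_matrix, lie_smul_matrix, smul_smul]
        congr 1
        ring
      -- The passage from n to n + 1 brings in the structure constant q + n + 1; this identity
      -- trades it for the factor n + 1 of the factorial.
      have hch : ((P.chainBotCoeff i j + (n + 1)).choose (n + 1) * (n + 1) : ℚ_[p]) =
          (P.chainBotCoeff i j + n + 1) * (P.chainBotCoeff i j + n).choose n := by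
        have := Nat.add_one_mul_choose_eq (P.chainBotCoeff i j + n) n
        rw [← add_assoc]
        exact_mod_cast this.symm
      by_cases hr : P.root i + P.root k ∈ Set.range P.root
      · right
        obtain ⟨k', hk'⟩ := hr
        have hq' := RootPairing.chainBotCoeff_of_add hind' (hk'.trans (add_comm _ _))
        obtain ⟨ε, hε, hE⟩ : ∃ ε : ℤ, (ε = 1 ∨ ε = -1) ∧ ⁅R.E i, R.E k⁆ =
            (ε * ((P.chainBotCoeff i k : ℚ_[p]) + 1)) • R.E k' := by
          rcases R.bracket_root i k k' hk' with h | h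
          · exact ⟨1, Or.inl rfl, by rw [h]; simp⟩
          · exact ⟨-1, Or.inr rfl, by rw [h]; simp [-neg_add_rev, ← neg_smul]⟩
        obtain ⟨ε', hε', hz'⟩ : ∃ ε' : ℤ, (ε' = 1 ∨ ε' = -1) ∧
            z = ε' * (P.chainBotCoeff i j + n).choose n := by
          rcases hz with h | h
          · exact ⟨1, Or.inl rfl, by rw [h]; simp⟩
          · exact ⟨-1, Or.inr rfl, by rw [h]; simp⟩
        refine ⟨k', ε * ε' * (P.chainBotCoeff i j + (n + 1)).choose (n + 1), ?_, ?_, ?_, ?_⟩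
        · rw [hk', hk]
          module
        · rw [hq', hq]
          ring
        · rcases hε with rfl | rfl <;> rcases hε' with rfl | rfl <;> simp
        · rw [h1, hE, smul_smul, hq, hz', Nat.factorial_succ]
          congr 1
          push_cast
          linear_combination (-(n.factorial : ℚ_[p]) * u ^ (n + 1) * ε * ε') * hch
      · left
        rw [h1, R.bracket_eq_zero i k ?_ hr, smul_zero]
        intro h0
        have := LinearIndependent.pair_iff.1 hind' 1 1 (by simpa using h0)
        simp at this

/-- The difference of `x_α(u) e_β x_α(u)⁻¹` and `e_β` is a combination with integral coefficients
of the `u ^ n e_{β + nα}`. -/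
lemma adj_rootElt_sub_mem [P.IsReduced] {i j : ι} (hj : j ≠ i) (hj' : j ≠ P.reflectionPerm i i)
    (u c : ℚ_[p]) (L : AddSubgroup (Matrix κ κ ℚ_[p]))
    (hL : ∀ n k, 1 ≤ n → P.root k = P.root j + n • P.root i → (u ^ n * c) • R.E k ∈ L) :
    adj (R.rootElt i u) (c • R.E j) - c • R.E j ∈ L := by
  obtain ⟨N, hN⟩ := isNilpotent_commMap ((R.isNilpotent_E i).smul u)
  have h0 : (commMap (u • R.E i) ^ (N + 1)) (R.E j) = 0 := by
    rw [pow_succ', hN]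
    simp
  rw [map_smul, R.adj_rootElt i u _ h0, Finset.sum_range_succ', smul_add]
  simp only [Nat.factorial_zero, Nat.cast_one, inv_one, pow_zero, one_smul, Module.End.one_apply,
    add_sub_cancel_right, Finset.smul_sum]
  refine sum_mem fun n _ => ?_
  rcases R.adj_pow_E_of_ne hj hj' u (n + 1) with h | ⟨k, z, hk, -, -, h⟩
  · rw [h, smul_zero, smul_zero]
    exact zero_mem _
  · have hf : ((n + 1).factorial : ℚ_[p]) ≠ 0 := by exact_mod_cast (n + 1).factorial_ne_zero
    have : c • ((n + 1).factorial : ℚ)⁻¹ • (((n + 1).factorial : ℚ_[p]) * (u ^ (n + 1) * z)) • R.E k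
        = z • ((u ^ (n + 1) * c) • R.E k) := by
      rw [← Rat.cast_smul_eq_qsmul ℚ_[p], smul_smul, smul_smul, ← Int.cast_smul_eq_zsmul ℚ_[p],
        smul_smul]
      congr 1
      push_cast
      field_simp
    rw [h, this]
    exact zsmul_mem (hL (n + 1) k (by omega) hk) z

end ChevalleyRep

namespace ChevalleyRep

open Matrix

variable {p : ℕ} [Fact p.Prime] {ι X Y : Type*} [Finite ι] [AddCommGroup X] [AddCommGroup Y]
  {P : RootPairing ι ℤ X Y} {κ : Type*} [Fintype κ] [DecidableEq κ] (R : ChevalleyRep p P κ)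

/-! ### Stable lattices -/

/-- The stabilizer of an additive group of matrices under the adjoint action. -/
noncomputable def adjStabilizer (L : AddSubgroup (Matrix κ κ ℚ_[p])) : Subgroup (GL κ ℚ_[p]) where
  carrier := {g | ∀ A ∈ L, adj g A ∈ L ∧ adj g⁻¹ A ∈ L}
  one_mem' A hA := by simpa using hA
  mul_mem' {g h} hg hh A hA := by
    rw [_root_.mul_inv_rev, adj_mul, adj_mul]
    exact ⟨(hg _ (hh A hA).1).1, (hh _ (hg A hA).2).2⟩
  inv_mem' {g} hg A hA := by
    rw [inv_inv]
    exact (hg A hA).symm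

/-- The additive group generated by the multiples `c e_α`, `c ∈ B α`, of the root vectors and the
elements of the Cartan subalgebra on which all weights take values in `B₀`. -/
noncomputable def lieLattice (B : ι → AddSubgroup ℚ_[p]) (B₀ : AddSubgroup ℚ_[p]) :
    AddSubgroup (Matrix κ κ ℚ_[p]) :=
  AddSubgroup.closure ({A | ∃ i, ∃ c ∈ B i, A = c • R.E i} ∪
    {A | ∃ χ : X →+ ℚ_[p], (∀ μ, χ μ ∈ B₀) ∧ A = R.cartan χ})

variable {R} {B : ι → AddSubgroup ℚ_[p]} {B₀ : AddSubgroup ℚ_[p]}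

lemma smul_E_mem_lieLattice {i : ι} {c : ℚ_[p]} (hc : c ∈ B i) : c • R.E i ∈ R.lieLattice B B₀ :=
  AddSubgroup.subset_closure (Or.inl ⟨i, c, hc, rfl⟩)

lemma cartan_mem_lieLattice {χ : X →+ ℚ_[p]} (hχ : ∀ μ, χ μ ∈ B₀) :
    R.cartan χ ∈ R.lieLattice B B₀ :=
  AddSubgroup.subset_closure (Or.inr ⟨χ, hχ, rfl⟩)

/-- The integrality of χ is dropped: only off-diagonal entries, which do not see the Cartan part,
are read off later. -/
lemma exists_sum_of_mem_lieLattice [Fintype ι] {A : Matrix κ κ ℚ_[p]}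
    (hA : A ∈ R.lieLattice B B₀) :
    ∃ (c : ι → ℚ_[p]) (χ : X →+ ℚ_[p]), (∀ i, c i ∈ B i) ∧ A = ∑ i, c i • R.E i + R.cartan χ := by
  classical
  induction hA using AddSubgroup.closure_induction with
  | mem A hA =>
    rcases hA with ⟨i, c, hc, rfl⟩ | ⟨χ, -, rfl⟩
    · refine ⟨Pi.single i c, 0, fun j => ?_, ?_⟩
      · by_cases h : j = i
        · subst h
          simpa using hc
        · simp [h]
      · rw [Finset.sum_eq_single i]
        · simp [cartan]
        · intro j _ hj
          simp [hj]
        · simp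
    · exact ⟨0, χ, fun i => zero_mem _, by simp⟩
  | zero => exact ⟨0, 0, fun i => zero_mem _, by simp [cartan]⟩
  | add A A' _ _ h h' =>
    obtain ⟨c, χ, hc, rfl⟩ := h
    obtain ⟨c', χ', hc', rfl⟩ := h'
    refine ⟨c + c', χ + χ', fun i => add_mem (hc i) (hc' i), ?_⟩
    simp only [cartan_add, Pi.add_apply, add_smul, Finset.sum_add_distrib]
    abel
  | neg A _ h =>
    obtain ⟨c, χ, hc, rfl⟩ := h
    refine ⟨-c, (-1 : ℤ) • χ, fun i => neg_mem (hc i), ?_⟩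
    rw [cartan_smul]
    simp only [Pi.neg_apply, neg_smul, Finset.sum_neg_distrib, one_smul, neg_add_rev]
    abel

variable (R) in
lemma E_apply_eq_zero {i j : ι} {k l : κ} (h : R.E i k l ≠ 0) (hj : j ≠ i) : R.E j k l = 0 := by
  by_contra h'
  have := (R.wt_eq_of_E_ne_zero i k l h).symm.trans (R.wt_eq_of_E_ne_zero j k l h')
  exact hj (P.root.injective (add_left_cancel this)).symm

variable (R) in
lemma ne_of_E_ne_zero {i : ι} {k l : κ} (h : R.E i k l ≠ 0) : k ≠ l := by
  rintro rfl
  exact P.ne_zero i (by simpa using R.wt_eq_of_E_ne_zero i k k h)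

/-- A matrix position determines a difference of weights, so at most one root vector has a nonzero
entry there. Hence one entry reveals the coefficient of a root vector. -/
lemma exists_entry_of_mem_lieLattice {A : Matrix κ κ ℚ_[p]} (hA : A ∈ R.lieLattice B B₀)
    {i : ι} {k l : κ} (h : R.E i k l ≠ 0) : ∃ c ∈ B i, A k l = c * R.E i k l := by
  cases nonempty_fintype ι
  obtain ⟨c, χ, hc, rfl⟩ := exists_sum_of_mem_lieLattice hA
  refine ⟨c i, hc i, ?_⟩
  rw [Matrix.add_apply, cartan, diagonal_apply_ne _ (R.ne_of_E_ne_zero h), add_zero,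
    Matrix.sum_apply, Finset.sum_eq_single i]
  · rfl
  · intro j _ hj
    rw [Matrix.smul_apply, R.E_apply_eq_zero h hj, smul_zero]
  · simp

/-- The conditions on `u` under which `x_α(u)` stabilizes `lieLattice B B₀`. -/
structure Compatible (P : RootPairing ι ℤ X Y) (B : ι → AddSubgroup ℚ_[p])
    (B₀ : AddSubgroup ℚ_[p]) (i : ι) (u : ℚ_[p]) : Prop where
  mul_mem : ∀ c ∈ B₀, u * c ∈ B i
  mul_mem_zero : ∀ c ∈ B (P.reflectionPerm i i), u * c ∈ B₀
  sq_mul_mem : ∀ c ∈ B (P.reflectionPerm i i), u ^ 2 * c ∈ B i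
  pow_mul_mem : ∀ j k n, 1 ≤ n → P.root k = P.root j + n • P.root i → j ≠ P.reflectionPerm i i →
    ∀ c ∈ B j, u ^ n * c ∈ B k

omit [Finite ι] in
lemma Compatible.neg {i : ι} {u : ℚ_[p]} (h : Compatible P B B₀ i u) :
    Compatible P B B₀ i (-u) where
  mul_mem c hc := by rw [neg_mul]; exact neg_mem (h.mul_mem c hc)
  mul_mem_zero c hc := by rw [neg_mul]; exact neg_mem (h.mul_mem_zero c hc)
  sq_mul_mem c hc := by rw [neg_sq]; exact h.sq_mul_mem c hc
  pow_mul_mem j k n hn hk hj c hc := by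
    have := h.pow_mul_mem j k n hn hk hj c hc
    rw [neg_pow, mul_assoc]
    rcases neg_one_pow_eq_or ℚ_[p] n with h | h <;> rw [h]
    · rwa [one_mul]
    · rw [neg_one_mul]
      exact neg_mem this

/-- Check on generators: the same root, the opposite root, any other root and Cartan elements. The
fields of `Compatible` are the conditions which the formulas for these cases require. -/
lemma adj_rootElt_mem_lieLattice [P.IsReduced] {i : ι} {u : ℚ_[p]} (h : Compatible P B B₀ i u)
    {A : Matrix κ κ ℚ_[p]} (hA : A ∈ R.lieLattice B B₀) :
    adj (R.rootElt i u) A ∈ R.lieLattice B B₀ := by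
  induction hA using AddSubgroup.closure_induction with
  | mem A hA =>
    rcases hA with ⟨j, c, hc, rfl⟩ | ⟨χ, hχ, rfl⟩
    · by_cases hj : j = i
      · subst hj
        rw [map_smul, adj_rootElt_self]
        exact smul_E_mem_lieLattice hc
      by_cases hj' : j = P.reflectionPerm i i
      · subst hj'
        rw [map_smul, adj_rootElt_neg, smul_sub, smul_add, smul_smul, smul_smul]
        refine sub_mem (add_mem (smul_E_mem_lieLattice hc) ?_) (smul_E_mem_lieLattice ?_)
        · have hcart : (c * u) • R.cartan (corootChar p P i) =
              R.cartan ((AddMonoidHom.mulLeft (c * u)).comp (corootChar p P i)) := by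
            rw [cartan, cartan, ← diagonal_smul]
            rfl
          rw [hcart]
          refine cartan_mem_lieLattice fun μ => ?_
          have h1 := zsmul_mem (h.mul_mem_zero c hc) (P.coroot' i μ)
          convert h1 using 1
          simp only [corootChar, AddMonoidHom.coe_comp, Function.comp_apply,
            AddMonoidHom.coe_mulLeft, Int.coe_castAddHom, LinearMap.toAddMonoidHom_coe, zsmul_eq_mul]
          ring
        · rw [mul_comm]
          exact h.sq_mul_mem c hc
      · rw [← sub_add_cancel (adj (R.rootElt i u) (c • R.E j)) (c • R.E j)]
        refine add_mem (R.adj_rootElt_sub_mem hj hj' u c _ fun n k hn hk => ?_)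
          (smul_E_mem_lieLattice hc)
        exact smul_E_mem_lieLattice (h.pow_mul_mem j k n hn hk hj' c hc)
    · rw [adj_rootElt_cartan]
      exact sub_mem (cartan_mem_lieLattice hχ) (smul_E_mem_lieLattice (h.mul_mem _ (hχ _)))
  | zero => simp
  | add A A' _ _ h h' => rw [map_add]; exact add_mem h h'
  | neg A _ h => rw [map_neg]; exact neg_mem h

lemma rootElt_mem_adjStabilizer [P.IsReduced] {i : ι} {u : ℚ_[p]} (h : Compatible P B B₀ i u) :
    R.rootElt i u ∈ adjStabilizer (R.lieLattice B B₀) := fun A hA => by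
  rw [← rootElt_neg]
  exact ⟨adj_rootElt_mem_lieLattice h hA, adj_rootElt_mem_lieLattice h.neg hA⟩

/-! ### The torus -/

variable (R)

lemma coe_torusHom (t : Torus p X) :
    (R.torusHom t : Matrix κ κ ℚ_[p]) = diagonal fun k => (evalChar (R.wt k) t : ℚ_[p]) := rfl

lemma torusHom_mul_E (t : Torus p X) (i : ι) :
    (R.torusHom t : Matrix κ κ ℚ_[p]) * R.E i =
      (evalChar (P.root i) t : ℚ_[p]) • (R.E i * R.torusHom t) := by
  ext k l
  rw [coe_torusHom, diagonal_mul, Matrix.smul_apply, mul_diagonal, smul_eq_mul]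
  by_cases h : R.E i k l = 0
  · simp [h]
  · rw [R.wt_eq_of_E_ne_zero i k l h]
    simp only [evalChar, ofAdd_add, map_mul, Units.val_mul]
    ring

lemma adj_torusHom_E (t : Torus p X) (i : ι) :
    adj (R.torusHom t) (R.E i) = (evalChar (P.root i) t : ℚ_[p]) • R.E i := by
  rw [adj_apply, torusHom_mul_E, smul_mul_assoc, mul_assoc, Units.mul_inv, mul_one]

lemma adj_torusHom_cartan (t : Torus p X) (χ : X →+ ℚ_[p]) :
    adj (R.torusHom t) (R.cartan χ) = R.cartan χ := by
  have : (R.torusHom t : Matrix κ κ ℚ_[p]) * R.cartan χ = R.cartan χ * R.torusHom t := by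
    rw [coe_torusHom, cartan, diagonal_mul_diagonal, diagonal_mul_diagonal]
    congr 1
    ext k
    exact mul_comm _ _
  rw [adj_apply, this, mul_assoc, Units.mul_inv, mul_one]

lemma adj_torusHom_mem_lieLattice {t : Torus p X}
    (ht : ∀ i, ∀ c ∈ B i, (evalChar (P.root i) t : ℚ_[p]) * c ∈ B i)
    {A : Matrix κ κ ℚ_[p]} (hA : A ∈ R.lieLattice B B₀) :
    adj (R.torusHom t) A ∈ R.lieLattice B B₀ := by
  induction hA using AddSubgroup.closure_induction with
  | mem A hA =>
    rcases hA with ⟨j, c, hc, rfl⟩ | ⟨χ, hχ, rfl⟩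
    · rw [map_smul, adj_torusHom_E, smul_smul, mul_comm]
      exact smul_E_mem_lieLattice (ht j c hc)
    · rw [adj_torusHom_cartan]
      exact cartan_mem_lieLattice hχ
  | zero => simp
  | add A A' _ _ h h' => rw [map_add]; exact add_mem h h'
  | neg A _ h => rw [map_neg]; exact neg_mem h

/-! ### Lattices belonging to points of the apartment -/

/-- The elements of valuation at least `t`. -/
noncomputable def valGE (p : ℕ) [Fact p.Prime] (t : ℝ) : AddSubgroup ℚ_[p] where
  carrier := {u | ‖u‖ ≤ (p : ℝ) ^ (-t)}
  zero_mem' := by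
    simp only [Set.mem_ofPred_eq, norm_zero]
    positivity
  add_mem' {a b} ha hb := (Padic.nonarchimedean a b).trans (max_le ha hb)
  neg_mem' {a} ha := by simpa using ha

/-- The elements of valuation greater than `t`. -/
noncomputable def valGT (p : ℕ) [Fact p.Prime] (t : ℝ) : AddSubgroup ℚ_[p] where
  carrier := {u | ‖u‖ < (p : ℝ) ^ (-t)}
  zero_mem' := by
    simp only [Set.mem_ofPred_eq, norm_zero]
    have : (0 : ℝ) < p := by exact_mod_cast (Fact.out : p.Prime).pos
    positivity
  add_mem' {a b} ha hb := (Padic.nonarchimedean a b).trans_lt (max_lt ha hb)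
  neg_mem' {a} ha := by simpa using ha

lemma mem_valGE {t : ℝ} {u : ℚ_[p]} : u ∈ valGE p t ↔ ‖u‖ ≤ (p : ℝ) ^ (-t) := Iff.rfl

lemma mem_valGT {t : ℝ} {u : ℚ_[p]} : u ∈ valGT p t ↔ ‖u‖ < (p : ℝ) ^ (-t) := Iff.rfl

lemma valGT_le_valGE {t : ℝ} {u : ℚ_[p]} (h : u ∈ valGT p t) : u ∈ valGE p t :=
  le_of_lt (mem_valGT.1 h)

lemma prime_pos_real : (0 : ℝ) < p := by exact_mod_cast (Fact.out : p.Prime).pos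

lemma mul_mem_valGE {s t : ℝ} {u v : ℚ_[p]} (hu : u ∈ valGE p s) (hv : v ∈ valGE p t) :
    u * v ∈ valGE p (s + t) := by
  have hp := prime_pos_real (p := p)
  rw [mem_valGE, norm_mul, neg_add, Real.rpow_add hp]
  exact mul_le_mul hu hv (norm_nonneg _) (by positivity)

lemma mul_mem_valGT {s t : ℝ} {u v : ℚ_[p]} (hu : u ∈ valGE p s) (hv : v ∈ valGT p t) :
    u * v ∈ valGT p (s + t) := by
  have hp := prime_pos_real (p := p)
  rw [mem_valGT, norm_mul, neg_add, Real.rpow_add hp]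
  exact mul_lt_mul_of_le_of_lt_of_nonneg_of_pos hu hv (norm_nonneg _) (by positivity)

lemma one_mem_valGE : (1 : ℚ_[p]) ∈ valGE p 0 := by simp [mem_valGE]

lemma pow_mem_valGE {s : ℝ} {u : ℚ_[p]} (hu : u ∈ valGE p s) (n : ℕ) :
    u ^ n ∈ valGE p (n * s) := by
  induction n with
  | zero => simpa using one_mem_valGE
  | succ n ih =>
    rw [pow_succ]
    convert mul_mem_valGE ih hu using 2
    push_cast
    ring

lemma pow_mem_valGT {s : ℝ} {u : ℚ_[p]} (hu : u ∈ valGT p s) {n : ℕ} (hn : 1 ≤ n) :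
    u ^ n ∈ valGT p (n * s) := by
  obtain ⟨n, rfl⟩ : ∃ m, n = m + 1 := ⟨n - 1, by omega⟩
  rw [pow_succ]
  convert mul_mem_valGT (pow_mem_valGE (valGT_le_valGE hu) n) hu using 2
  push_cast
  ring

/-- The lattice in the Lie algebra stabilized by the parahoric subgroup of the point `x`. -/
noncomputable def pointLattice (x : P.Apartment) : AddSubgroup (Matrix κ κ ℚ_[p]) :=
  R.lieLattice (fun i => valGE p (P.rootFunctional i x)) (valGE p 0)

/-- The sublattice of `pointLattice` of elements of greater valuation. -/
noncomputable def pointSublattice (x : P.Apartment) : AddSubgroup (Matrix κ κ ℚ_[p]) :=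
  R.lieLattice (fun i => valGT p (P.rootFunctional i x)) (valGT p 0)

omit [Finite ι] in
lemma rootFunctional_of_root_eq {i j k : ι} {n : ℕ} (h : P.root k = P.root j + n • P.root i)
    (x : P.Apartment) :
    P.rootFunctional k x = P.rootFunctional j x + n * P.rootFunctional i x := by
  have : P.rootSpanMem ℤ k = P.rootSpanMem ℤ j + n • P.rootSpanMem ℤ i := Subtype.ext h
  change x _ = _
  rw [this, map_add, map_nsmul, nsmul_eq_mul]
  rfl

omit [Finite ι] in
lemma compatible_valGE {x : P.Apartment} {i : ι} {u : ℚ_[p]}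
    (hu : u ∈ valGE p (P.rootFunctional i x)) :
    Compatible P (fun i => valGE p (P.rootFunctional i x)) (valGE p 0) i u where
  mul_mem c hc := by simpa using mul_mem_valGE hu hc
  mul_mem_zero c hc := by
    rw [RootPairing.rootFunctional_neg] at hc
    simpa using mul_mem_valGE hu hc
  sq_mul_mem c hc := by
    rw [RootPairing.rootFunctional_neg] at hc
    convert mul_mem_valGE (pow_mem_valGE hu 2) hc using 2
    push_cast
    ring
  pow_mul_mem j k n _ hk _ c hc := by
    rw [rootFunctional_of_root_eq hk, add_comm]
    exact mul_mem_valGE (pow_mem_valGE hu n) hc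

omit [Finite ι] in
-- The same `u` that preserve the lattice at `x` preserve the sublattice, so they act on the
-- quotient. Strictness survives because the coefficient acted on, or `1` times a Cartan value,
-- already has strictly larger valuation.
lemma compatible_valGT {x : P.Apartment} {i : ι} {u : ℚ_[p]}
    (hu : u ∈ valGE p (P.rootFunctional i x)) :
    Compatible P (fun i => valGT p (P.rootFunctional i x)) (valGT p 0) i u where
  mul_mem c hc := by simpa using mul_mem_valGT hu hc
  mul_mem_zero c hc := by
    rw [RootPairing.rootFunctional_neg] at hc
    simpa using mul_mem_valGT hu hc
  sq_mul_mem c hc := by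
    rw [RootPairing.rootFunctional_neg] at hc
    convert mul_mem_valGT (pow_mem_valGE hu 2) hc using 2
    push_cast
    ring
  pow_mul_mem j k n _ hk _ c hc := by
    rw [rootFunctional_of_root_eq hk, add_comm]
    exact mul_mem_valGT (pow_mem_valGE hu n) hc

lemma T₀_le_adjStabilizer (x : P.Apartment) : R.T₀ ≤ adjStabilizer (R.pointLattice x) := by
  rw [T₀, Subgroup.closure_le]
  rintro _ ⟨t, ht, rfl⟩
  have key : ∀ t : Torus p X, (∀ μ, ‖(evalChar μ t : ℚ_[p])‖ = 1) →
      ∀ A ∈ R.pointLattice x, adj (R.torusHom t) A ∈ R.pointLattice x := by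
    intro t ht A hA
    refine R.adj_torusHom_mem_lieLattice (fun i c hc => ?_) hA
    rw [mem_valGE, norm_mul, ht, one_mul]
    exact hc
  intro A hA
  rw [← map_inv]
  refine ⟨key t ht A hA, key t⁻¹ (fun μ => ?_) A hA⟩
  have h1 : evalChar μ t⁻¹ = (evalChar μ t)⁻¹ := rfl
  rw [h1, Units.val_inv_eq_inv_val, norm_inv, ht, inv_one]

lemma mem_rootSubgroupFix_iff {i : ι} {Ω : Set P.Apartment} {g : GL κ ℚ_[p]} :
    g ∈ R.rootSubgroupFix i Ω ↔
      ∃ u, (∀ x ∈ Ω, u ∈ valGE p (P.rootFunctional i x)) ∧ R.rootElt i u = g := by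
  constructor
  · intro hg
    induction hg using Subgroup.closure_induction with
    | mem g hg =>
      obtain ⟨u, hu, rfl⟩ := hg
      exact ⟨u, hu, rfl⟩
    | one => exact ⟨0, fun x _ => zero_mem _, R.rootElt_zero i⟩
    | mul g h _ _ hg hh =>
      obtain ⟨u, hu, rfl⟩ := hg
      obtain ⟨v, hv, rfl⟩ := hh
      exact ⟨u + v, fun x hx => add_mem (hu x hx) (hv x hx), R.rootElt_add i u v⟩
    | inv g _ hg =>
      obtain ⟨u, hu, rfl⟩ := hg
      exact ⟨-u, fun x hx => neg_mem (hu x hx), R.rootElt_neg i u⟩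
  · rintro ⟨u, hu, rfl⟩
    exact Subgroup.subset_closure ⟨u, hu, rfl⟩

/-- An upper bound for a group defined by generators: membership in the stabilizer of a lattice is
what limits the coefficients of its elements. -/
lemma parahoric_le_adjStabilizer [P.IsReduced] {Ω : Set P.Apartment} {x : P.Apartment}
    (hx : x ∈ Ω) : R.parahoric Ω ≤ adjStabilizer (R.pointLattice x) := by
  refine sup_le (R.T₀_le_adjStabilizer x) (iSup_le fun i => ?_)
  intro g hg
  obtain ⟨u, hu, rfl⟩ := R.mem_rootSubgroupFix_iff.1 hg
  exact rootElt_mem_adjStabilizer (compatible_valGE (hu x hx))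

lemma rootElt_mem_parahoric {i : ι} {Ω : Set P.Apartment} {u : ℚ_[p]}
    (hu : ∀ x ∈ Ω, u ∈ valGE p (P.rootFunctional i x)) : R.rootElt i u ∈ R.parahoric Ω :=
  Subgroup.mem_sup_right (Subgroup.mem_iSup_of_mem i (R.mem_rootSubgroupFix_iff.2 ⟨u, hu, rfl⟩))

end ChevalleyRep

/-! ### Extending functionals from the root lattice to all characters -/

namespace RootPairing

variable {ι X Y : Type*} [AddCommGroup X] [AddCommGroup Y] {P : RootPairing ι ℤ X Y}

lemma HasConnectedCenter.isTorsionFree (h : P.HasConnectedCenter) :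
    Module.IsTorsionFree ℤ (X ⧸ P.rootSpan ℤ) := by
  refine .of_smul_eq_zero fun n x hx => ?_
  by_cases hn : n = 0
  · exact Or.inl hn
  · obtain ⟨x, rfl⟩ := Submodule.mkQ_surjective _ x
    rw [← map_smul] at hx
    refine Or.inr ?_
    rw [Submodule.mkQ_apply, Submodule.Quotient.mk_eq_zero] at hx ⊢
    exact h n x hn hx

/-- If the centre is connected then functionals on the root lattice extend to the weight lattice. -/
lemma HasConnectedCenter.exists_extension [Module.Finite ℤ X] (h : P.HasConnectedCenter)
    (f : P.AdjointCochar) : ∃ g : X →ₗ[ℤ] ℤ, ∀ x : P.rootSpan ℤ, g x = f x := by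
  have := h.isTorsionFree
  have : Module.Free ℤ (X ⧸ P.rootSpan ℤ) := Module.free_of_finite_type_torsion_free'
  obtain ⟨s, hs⟩ := Module.projective_lifting_property (P.rootSpan ℤ).mkQ LinearMap.id
    (Submodule.mkQ_surjective _)
  have hmem : ∀ x, (LinearMap.id - s ∘ₗ (P.rootSpan ℤ).mkQ : X →ₗ[ℤ] X) x ∈ P.rootSpan ℤ := fun x => by
    have := LinearMap.congr_fun hs ((P.rootSpan ℤ).mkQ x)
    simp only [LinearMap.comp_apply, LinearMap.id_apply] at this
    rw [← Submodule.Quotient.mk_eq_zero, ← Submodule.mkQ_apply, LinearMap.sub_apply, map_sub,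
      LinearMap.comp_apply, this, LinearMap.id_apply, sub_self]
  refine ⟨f ∘ₗ (LinearMap.id - s ∘ₗ (P.rootSpan ℤ).mkQ).codRestrict (P.rootSpan ℤ) hmem,
    fun x => ?_⟩
  rw [LinearMap.comp_apply]
  congr 1
  apply Subtype.ext
  have : (P.rootSpan ℤ).mkQ x = 0 := by simp
  simp [this]

/-- Roots are primitive in the root lattice. -/
lemma Base.exists_apply_root_eq_one [Finite ι] [P.IsReduced] (b : P.Base) (i : ι) :
    ∃ f : P.AdjointCochar, f (P.rootSpanMem ℤ i) = 1 := by
  refine b.induction_reflect (p := fun i => ∃ f : P.AdjointCochar, f (P.rootSpanMem ℤ i) = 1)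
    i ?_ ?_ ?_
  · rintro i ⟨f, hf⟩
    exact ⟨-f, by simp [rootSpanMem_neg, hf]⟩
  · intro i hi
    refine ⟨b.toWeightBasisInt.coord ⟨i, hi⟩, ?_⟩
    rw [show P.rootSpanMem ℤ i = b.toWeightBasisInt ⟨i, hi⟩ from
      (b.toWeightBasisInt_eq ⟨i, hi⟩).symm]
    simp
  · rintro i j ⟨f, hf⟩ -
    -- This is `f` composed with the reflection in `j`.
    refine ⟨f - f (P.rootSpanMem ℤ j) • P.adjointCoroot j, ?_⟩
    rw [rootSpanMem_reflectionPerm, LinearMap.sub_apply, LinearMap.smul_apply, map_sub, map_sub,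
      map_smul, map_smul, hf, adjointCoroot_apply, adjointCoroot_apply, pairing_same]
    simp only [smul_eq_mul]
    ring

/-- The height of roots extends to the weight lattice. -/
lemma Base.exists_height_extension [Module.Finite ℤ X] (b : P.Base) (h : P.HasConnectedCenter) :
    ∃ g : X →ₗ[ℤ] ℤ, ∀ i, g (P.root i) = b.height i := by
  obtain ⟨g, hg⟩ := h.exists_extension (b.toWeightBasisInt.constr ℤ fun _ => (1 : ℤ))
  refine ⟨g, fun i => ?_⟩
  obtain ⟨f, -, -, hf⟩ := b.exists_root_eq_sum_int i
  rw [b.height_eq_sum hf, hf, map_sum]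
  refine Finset.sum_congr rfl fun j hj => ?_
  have h1 : g (P.root j) = b.toWeightBasisInt.constr ℤ (fun _ => (1 : ℤ)) (P.rootSpanMem ℤ j) :=
    hg (P.rootSpanMem ℤ j)
  rw [← b.toWeightBasisInt_eq ⟨j, hj⟩, Module.Basis.constr_basis] at h1
  rw [map_smul, h1, smul_eq_mul, mul_one]

end RootPairing

namespace ChevalleyRep

open Matrix

variable {p : ℕ} [Fact p.Prime] {ι X Y : Type*} [Finite ι] [AddCommGroup X] [AddCommGroup Y]
  {P : RootPairing ι ℤ X Y} {κ : Type*} [Fintype κ] [DecidableEq κ] (R : ChevalleyRep p P κ)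

/-- If e_α were 0 then so would be h_α = [e_α, e_{-α}], and α^∨ would kill all weights. These
generate X, while ⟨α, α^∨⟩ = 2. -/
lemma exists_E_ne_zero (i : ι) : ∃ k l, R.E i k l ≠ 0 := by
  by_contra! h
  have hE : R.E i = 0 := by
    ext k l
    exact h k l
  have h1 := R.bracket_neg i
  rw [hE, Ring.lie_def, zero_mul, mul_zero, sub_zero] at h1
  have h2 : ∀ x : X, P.coroot' i x = 0 := by
    intro x
    have hx : x ∈ AddSubgroup.closure (Set.range R.wt) := by rw [R.closure_wt]; trivial
    induction hx using AddSubgroup.closure_induction with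
    | mem x hx =>
      obtain ⟨k, rfl⟩ := hx
      have := congrFun (congrFun h1 k) k
      rw [diagonal_apply_eq] at this
      simp only [Matrix.zero_apply] at this
      exact_mod_cast this.symm
    | zero => exact map_zero _
    | add x y _ _ hx hy => rw [map_add, hx, hy, add_zero]
    | neg x _ hx => rw [map_neg, hx, neg_zero]
  have h3 := h2 (P.root i)
  rw [RootPairing.root_coroot'_eq_pairing, RootPairing.pairing_same] at h3
  norm_num at h3

/-! ### The filtration of matrices by height -/

variable (lam : X →ₗ[ℤ] ℤ)

/-- The matrices which increase the height of weights by at least `m`. -/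
def Raises (m : ℤ) : AddSubgroup (Matrix κ κ ℚ_[p]) where
  carrier := {A | ∀ k l, lam (R.wt k) < lam (R.wt l) + m → A k l = 0}
  zero_mem' _ _ _ := rfl
  add_mem' {A B} hA hB k l h := by rw [Matrix.add_apply, hA k l h, hB k l h, add_zero]
  neg_mem' {A} hA k l h := by rw [Matrix.neg_apply, hA k l h, neg_zero]

variable {R lam}

lemma raises_mono {m n : ℤ} (h : m ≤ n) {A : Matrix κ κ ℚ_[p]} (hA : A ∈ R.Raises lam n) :
    A ∈ R.Raises lam m := fun k l hkl => hA k l (by omega)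

lemma raises_mul {m n : ℤ} {A B : Matrix κ κ ℚ_[p]} (hA : A ∈ R.Raises lam m)
    (hB : B ∈ R.Raises lam n) : A * B ∈ R.Raises lam (m + n) := by
  intro k l h
  rw [Matrix.mul_apply]
  refine Finset.sum_eq_zero fun q _ => ?_
  by_cases h1 : lam (R.wt k) < lam (R.wt q) + m
  · rw [hA k q h1, zero_mul]
  · rw [hB q l (by omega), mul_zero]

lemma raises_smul {m : ℤ} {A : Matrix κ κ ℚ_[p]} (hA : A ∈ R.Raises lam m) (c : ℚ_[p]) :
    c • A ∈ R.Raises lam m := fun k l h => by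
  rw [Matrix.smul_apply, hA k l h, smul_zero]

lemma diagonal_mem_raises (d : κ → ℚ_[p]) : diagonal d ∈ R.Raises lam 0 := fun k l h => by
  refine diagonal_apply_ne _ ?_
  rintro rfl
  simp at h

lemma E_pow_mem_raises (i : ι) (n : ℕ) : R.E i ^ n ∈ R.Raises lam (n * lam (P.root i)) := by
  intro k l h
  by_contra h'
  have := R.wt_eq_of_E_pow_ne_zero i n k l h'
  rw [this] at h
  simp at h

lemma E_mem_raises (i : ι) : R.E i ∈ R.Raises lam (lam (P.root i)) := by
  simpa using E_pow_mem_raises (R := R) (lam := lam) i 1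

lemma one_mem_raises : (1 : Matrix κ κ ℚ_[p]) ∈ R.Raises lam 0 := by
  rw [← diagonal_one]
  exact diagonal_mem_raises _

variable (R lam) in
lemma exists_raises_eq_zero : ∃ M : ℕ, ∀ A ∈ R.Raises lam M, A = 0 := by
  obtain ⟨M, hM⟩ := (Set.finite_range fun q : κ × κ => lam (R.wt q.1) - lam (R.wt q.2)).bddAbove
  refine ⟨(M + 1).toNat, fun A hA => ?_⟩
  ext k l
  apply hA
  have := hM ⟨(k, l), rfl⟩
  simp only at this
  omega

lemma rootElt_sub_mem_raises {i : ι} (u : ℚ_[p]) (hi : 0 ≤ lam (P.root i)) :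
    (R.rootElt i u : Matrix κ κ ℚ_[p]) - 1 - u • R.E i ∈ R.Raises lam (2 * lam (P.root i)) := by
  obtain ⟨N, hN⟩ := (R.isNilpotent_E i).smul u
  -- The exponent `N + 2` guarantees that the constant and linear terms are present and can be split
  -- off.
  have hN2 : (u • R.E i) ^ (N + 2) = 0 := by rw [pow_add, hN, zero_mul]
  rw [coe_rootElt, IsNilpotent.exp_eq_sum hN2, Finset.sum_range_succ', Finset.sum_range_succ']
  simp only [zero_add, Nat.factorial_one, Nat.factorial_zero, Nat.cast_one, inv_one, one_smul,
    pow_one, pow_zero]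
  rw [add_sub_cancel_right, add_sub_cancel_right]
  refine sum_mem fun n _ => ?_
  rw [smul_pow, ← Rat.cast_smul_eq_qsmul ℚ_[p]]
  refine raises_mono ?_ (raises_smul (raises_smul (E_pow_mem_raises i _) _) _)
  push_cast
  nlinarith

lemma rootElt_sub_one_mem_raises {i : ι} (u : ℚ_[p]) (hi : 0 ≤ lam (P.root i)) :
    (R.rootElt i u : Matrix κ κ ℚ_[p]) - 1 ∈ R.Raises lam (lam (P.root i)) := by
  have h1 := rootElt_sub_mem_raises (R := R) u hi
  have h2 := raises_smul (E_mem_raises (R := R) (lam := lam) i) u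
  have := add_mem (raises_mono (by omega) h1) h2
  rwa [sub_add_cancel] at this

variable {b : P.Base}

variable (R b) in
/-- The group generated by the `x_α(u)`, for positive `α` and `u ∈ B α`. -/
noncomputable def unipotentGroup (B : ι → Set ℚ_[p]) : Subgroup (GL κ ℚ_[p]) :=
  Subgroup.closure {h | ∃ i, b.IsPos i ∧ ∃ u ∈ B i, h = R.rootElt i u}

lemma rootElt_mem_unipotentGroup {B : ι → Set ℚ_[p]} {i : ι} (hi : b.IsPos i) {u : ℚ_[p]}
    (hu : u ∈ B i) : R.rootElt i u ∈ R.unipotentGroup b B :=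
  Subgroup.subset_closure ⟨i, hi, u, hu, rfl⟩

lemma unipotentGroup_le_iff {B : ι → Set ℚ_[p]} {S : Subgroup (GL κ ℚ_[p])} :
    R.unipotentGroup b B ≤ S ↔ ∀ i, b.IsPos i → ∀ u ∈ B i, R.rootElt i u ∈ S := by
  rw [unipotentGroup, Subgroup.closure_le]
  constructor
  · exact fun h i hi u hu => h ⟨i, hi, u, hu, rfl⟩
  · rintro h _ ⟨i, hi, u, hu, rfl⟩
    exact h i hi u hu

/-- Each `B i` is closed under negation, so inverses of generators are generators and `C` need not
be stable under inverses. -/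
lemma unipotentGroup_induction {B : ι → AddSubgroup ℚ_[p]} {C : GL κ ℚ_[p] → Prop} (hone : C 1)
    (hmul : ∀ g h, C g → C h → C (g * h))
    (helt : ∀ i u, b.IsPos i → u ∈ B i → C (R.rootElt i u))
    {g : GL κ ℚ_[p]} (hg : g ∈ R.unipotentGroup b fun i => B i) : C g := by
  rw [← Subgroup.mem_toSubmonoid, unipotentGroup, Subgroup.closure_toSubmonoid] at hg
  induction hg using Submonoid.closure_induction with
  | mem g hg =>
    rcases hg with ⟨i, hi, u, hu, rfl⟩ | ⟨i, hi, u, hu, h⟩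
    · exact helt i u hi hu
    · rw [← inv_inv g, h, ← rootElt_neg]
      exact helt i (-u) hi (neg_mem hu)
  | one => exact hone
  | mul g h _ _ hg hh => exact hmul g h hg hh

lemma N_eq_unipotentGroup :
    R.N b = R.unipotentGroup b fun _ => ((⊤ : AddSubgroup ℚ_[p]) : Set ℚ_[p]) := by
  apply le_antisymm
  · refine iSup₂_le fun i hi => ?_
    rintro _ ⟨u, rfl⟩
    exact rootElt_mem_unipotentGroup hi (u := u.toAdd) trivial
  · rw [unipotentGroup_le_iff]
    exact fun i hi u _ => Subgroup.mem_iSup_of_mem i (Subgroup.mem_iSup_of_mem hi ⟨_, rfl⟩)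

lemma N_induction {C : GL κ ℚ_[p] → Prop} (hone : C 1)
    (hmul : ∀ g h, C g → C h → C (g * h)) (helt : ∀ i u, b.IsPos i → C (R.rootElt i u))
    {g : GL κ ℚ_[p]} (hg : g ∈ R.N b) : C g :=
  unipotentGroup_induction hone hmul (fun i u hi _ => helt i u hi) (N_eq_unipotentGroup.le hg)

lemma rootElt_mem_N {i : ι} (hi : b.IsPos i) (u : ℚ_[p]) : R.rootElt i u ∈ R.N b :=
  Subgroup.mem_iSup_of_mem i (Subgroup.mem_iSup_of_mem hi ⟨_, rfl⟩)

lemma N_sub_one_mem_raises (hlam : ∀ i, lam (P.root i) = b.height i) {g : GL κ ℚ_[p]}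
    (hg : g ∈ R.N b) : (g : Matrix κ κ ℚ_[p]) - 1 ∈ R.Raises lam 1 := by
  refine N_induction (C := fun g => (g : Matrix κ κ ℚ_[p]) - 1 ∈ R.Raises lam 1) ?_ ?_ ?_ hg
  · simp
  · intro g h hg hh
    have : ((g * h : GL κ ℚ_[p]) : Matrix κ κ ℚ_[p]) - 1 =
        ((g : Matrix κ κ ℚ_[p]) - 1) * ((h : Matrix κ κ ℚ_[p]) - 1) +
          ((g : Matrix κ κ ℚ_[p]) - 1) + ((h : Matrix κ κ ℚ_[p]) - 1) := by
      rw [Units.val_mul]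
      noncomm_ring
    rw [this]
    exact add_mem (add_mem (raises_mono (by omega) (raises_mul hg hh)) hg) hh
  · intro i u hi
    rw [RootPairing.Base.isPos_iff] at hi
    exact raises_mono (by rw [hlam]; omega)
      (rootElt_sub_one_mem_raises (R := R) (i := i) (lam := lam) u (by rw [hlam]; omega))

lemma N_mem_raises (hlam : ∀ i, lam (P.root i) = b.height i) {g : GL κ ℚ_[p]}
    (hg : g ∈ R.N b) : (g : Matrix κ κ ℚ_[p]) ∈ R.Raises lam 0 := by
  have := add_mem (raises_mono (by omega : (0 : ℤ) ≤ 1) (N_sub_one_mem_raises hlam hg))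
    (one_mem_raises (R := R) (lam := lam))
  rwa [sub_add_cancel] at this

/-- If `g ∈ N` is congruent to `1` up to height `m`, then `g χ g⁻¹ - χ` has leading term
`[g - 1, χ]`. -/
lemma adj_cartan_apply (hlam : ∀ i, lam (P.root i) = b.height i) {g : GL κ ℚ_[p]}
    (hg : g ∈ R.N b) {m : ℤ} (hm : (g : Matrix κ κ ℚ_[p]) - 1 ∈ R.Raises lam m)
    (χ : X →+ ℚ_[p]) {k l : κ} (hkl : lam (R.wt k) = lam (R.wt l) + m) :
    (adj g (R.cartan χ) - R.cartan χ) k l =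
      ((g : Matrix κ κ ℚ_[p]) - 1) k l * (χ (R.wt l) - χ (R.wt k)) := by
  set A := (g : Matrix κ κ ℚ_[p]) - 1 with hA
  set H := R.cartan χ with hH
  have h1 : (g : Matrix κ κ ℚ_[p]) = A + 1 := by rw [hA, sub_add_cancel]
  have hH0 : H ∈ R.Raises lam 0 := diagonal_mem_raises _
  have hinv := N_sub_one_mem_raises (R := R) hlam (inv_mem hg)
  -- The difference is [A, H]g⁻¹, and g⁻¹ is 1 plus terms raising the height. Their contribution
  -- lies in heights above m, invisible at the position considered.
  have h2 : adj g H - H = (A * H - H * A) +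
      (A * H - H * A) * (((g⁻¹ : GL κ ℚ_[p]) : Matrix κ κ ℚ_[p]) - 1) := by
    have h3 : (g : Matrix κ κ ℚ_[p]) * ((g⁻¹ : GL κ ℚ_[p]) : Matrix κ κ ℚ_[p]) = 1 :=
      Units.mul_inv g
    have h4 : A * H - H * A = g * H - H * g := by rw [h1]; noncomm_ring
    rw [h4, adj_apply]
    have h5 : (g * H - H * g) + (g * H - H * g) *
        (((g⁻¹ : GL κ ℚ_[p]) : Matrix κ κ ℚ_[p]) - 1) =
        g * H * ((g⁻¹ : GL κ ℚ_[p]) : Matrix κ κ ℚ_[p]) -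
          H * (g * ((g⁻¹ : GL κ ℚ_[p]) : Matrix κ κ ℚ_[p])) := by noncomm_ring
    rw [h5, h3, mul_one]
  have h6 : A * H - H * A ∈ R.Raises lam m := by
    refine sub_mem ?_ ?_
    · simpa using raises_mul hm hH0
    · simpa using raises_mul hH0 hm
  rw [h2, Matrix.add_apply, raises_mul h6 hinv k l (by omega), add_zero, hH, cartan, Matrix.sub_apply,
    mul_diagonal, diagonal_mul]
  ring

/-- The Lie algebra of the Borel subgroup belonging to the base. -/
noncomputable def borelLattice (R : ChevalleyRep p P κ) (b : P.Base) :
    AddSubgroup (Matrix κ κ ℚ_[p]) :=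
  R.lieLattice (fun i => ⨆ _ : b.IsPos i, ⊤) ⊤

omit [Finite ι] in
lemma mem_iSup_isPos {i : ι} {c : ℚ_[p]} :
    c ∈ (⨆ _ : b.IsPos i, ⊤ : AddSubgroup ℚ_[p]) ↔ (b.IsPos i ∨ c = 0) := by
  by_cases h : b.IsPos i <;> simp [h]

/-- No integrality is asked here. The point is that conjugates of Cartan elements remain
combinations of root vectors and a Cartan element, which is what identifies leading terms of
elements of N. -/
lemma N_le_adjStabilizer [P.IsReduced] : R.N b ≤ adjStabilizer (R.borelLattice b) := by
  intro g hg
  refine N_induction (C := fun g => g ∈ adjStabilizer (R.borelLattice b)) (one_mem _)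
    (fun g h hg hh => mul_mem hg hh) (fun i u hi => rootElt_mem_adjStabilizer ?_) hg
  have hneg : ∀ c ∈ (⨆ _ : b.IsPos (P.reflectionPerm i i), ⊤ : AddSubgroup ℚ_[p]), c = 0 := by
    intro c hc
    rw [mem_iSup_isPos, b.isPos_neg_iff] at hc
    exact hc.resolve_left (not_not_intro hi)
  refine ⟨fun c _ => mem_iSup_isPos.2 (Or.inl hi), fun c hc => ?_, fun c hc => ?_,
    fun j k n hn hk hj c hc => ?_⟩
  · trivial
  · rw [hneg c hc, mul_zero]
    exact zero_mem _
  · rw [mem_iSup_isPos] at hc ⊢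
    rcases hc with hc | rfl
    · left
      rw [RootPairing.Base.isPos_iff] at hc hi ⊢
      have hk' : P.root k = P.root j + (n : ℤ) • P.root i := by rw [hk, natCast_zsmul]
      rw [b.height_add_zsmul hk', smul_eq_mul]
      positivity
    · exact Or.inr (mul_zero _)

/-- The leading term of an element of `N` is a combination of root vectors. -/
lemma exists_leading_term [Fintype ι] [P.IsReduced] (hlam : ∀ i, lam (P.root i) = b.height i)
    {g : GL κ ℚ_[p]} (hg : g ∈ R.N b) {m : ℤ} (hm1 : 1 ≤ m)
    (hm : (g : Matrix κ κ ℚ_[p]) - 1 ∈ R.Raises lam m) :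
    ∃ u : ι → ℚ_[p], (∀ i, b.height i ≠ m → u i = 0) ∧
      (g : Matrix κ κ ℚ_[p]) - 1 - ∑ i, u i • R.E i ∈ R.Raises lam (m + 1) := by
  -- The commutator with the height element multiplies the part of height m by -m, which is
  -- invertible in characteristic 0. So that part of g - 1 is recovered from a matrix known to be a
  -- combination of root vectors.
  set χ : X →+ ℚ_[p] := (Int.castAddHom ℚ_[p]).comp lam.toAddMonoidHom with hχ
  have h1 : adj g (R.cartan χ) ∈ R.borelLattice b :=
    (N_le_adjStabilizer hg _ (cartan_mem_lieLattice fun μ => trivial)).1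
  obtain ⟨c, ψ, -, hc⟩ := exists_sum_of_mem_lieLattice h1
  have hm0 : (m : ℚ_[p]) ≠ 0 := by exact_mod_cast (by omega : m ≠ 0)
  classical
  refine ⟨fun i => if b.height i = m then -(c i / m) else 0, fun i hi => if_neg hi, ?_⟩
  intro k l hkl
  rw [Matrix.sub_apply, Matrix.sum_apply]
  by_cases hkl' : lam (R.wt k) < lam (R.wt l) + m
  · rw [hm k l hkl', Finset.sum_eq_zero, sub_zero]
    intro i _
    by_cases hi : b.height i = m
    · rw [Matrix.smul_apply, E_mem_raises (lam := lam) i k l (by rw [hlam, hi]; exact hkl'),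
        smul_zero]
    · simp [hi]
  · have heq : lam (R.wt k) = lam (R.wt l) + m := by omega
    have hne : k ≠ l := by
      rintro rfl
      omega
    have h2 := adj_cartan_apply hlam hg hm χ heq
    rw [hc, Matrix.sub_apply, Matrix.add_apply, cartan, cartan, diagonal_apply_ne _ hne,
      diagonal_apply_ne _ hne, Matrix.sum_apply] at h2
    have h3 : χ (R.wt l) - χ (R.wt k) = -m := by
      simp only [hχ, AddMonoidHom.coe_comp, Function.comp_apply, Int.coe_castAddHom,
        LinearMap.toAddMonoidHom_coe, heq]
      push_cast
      ring
    rw [h3] at h2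
    have h4 : ∑ i, ((if b.height i = m then -(c i / m) else 0 : ℚ_[p]) • R.E i) k l =
        -(∑ i, (c i • R.E i) k l) / m := by
      rw [neg_div, Finset.sum_div, ← Finset.sum_neg_distrib]
      refine Finset.sum_congr rfl fun i _ => ?_
      by_cases hi : b.height i = m
      · rw [if_pos hi, Matrix.smul_apply, Matrix.smul_apply, smul_eq_mul, smul_eq_mul]
        ring
      · have h5 : R.E i k l = 0 := by
          by_contra h
          have := R.wt_eq_of_E_ne_zero i k l h
          rw [this, map_add, hlam] at heq
          omega
        simp [h5]
    rw [h4]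
    field_simp
    linear_combination h2

/-- An element of `N` belongs to the group generated by the `x_α(u)`, `u ∈ B α`, if it belongs to
a group `S` containing them with the property that the leading coefficients of its elements
belong to the sets `B α`. -/
theorem mem_unipotentGroup_of_mem_N [P.IsReduced] (hlam : ∀ i, lam (P.root i) = b.height i)
    (S : Subgroup (GL κ ℚ_[p])) (B : ι → Set ℚ_[p])
    (hS : ∀ i, b.IsPos i → ∀ u ∈ B i, R.rootElt i u ∈ S)
    (hB : ∀ g ∈ S, ∀ i, b.IsPos i → ∀ u k l, R.E i k l ≠ 0 →
      (∀ χ : X →+ ℚ_[p], (adj g (R.cartan χ) - R.cartan χ) k l =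
        -(u * χ (P.root i)) * R.E i k l) → u ∈ B i)
    {g : GL κ ℚ_[p]} (hg : g ∈ R.N b) (hgS : g ∈ S) :
    g ∈ R.unipotentGroup b B := by
  cases nonempty_fintype ι
  classical
  set Γ := R.unipotentGroup b B with hΓ
  have hΓS : Γ ≤ S := unipotentGroup_le_iff.2 hS
  have hΓN : Γ ≤ R.N b := unipotentGroup_le_iff.2 fun i hi u _ => rootElt_mem_N hi u
  obtain ⟨M, hM⟩ := R.exists_raises_eq_zero lam
  -- Descending induction on the height m up to which `g` is trivial: `n` bounds the number of
  -- heights left before `M`, where `g = 1`.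
  suffices H : ∀ n : ℕ, ∀ m : ℤ, 1 ≤ m → (M : ℤ) ≤ m + n → ∀ g, g ∈ R.N b → g ∈ S →
      (g : Matrix κ κ ℚ_[p]) - 1 ∈ R.Raises lam m → g ∈ Γ from
    H M 1 le_rfl (by omega) g hg hgS (N_sub_one_mem_raises hlam hg)
  intro n
  induction n with
  | zero =>
    intro m _ hmM g _ _ hgm
    have h0 := hM _ (raises_mono (by simpa using hmM) hgm)
    have : g = 1 := Units.ext (sub_eq_zero.1 h0)
    rw [this]
    exact one_mem _
  | succ n ih =>
    intro m hm1 hmM g hg hgS hgm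
    obtain ⟨u, hu0, hu⟩ := exists_leading_term hlam hg hm1 hgm
    have huB : ∀ i, b.height i = m → u i ∈ B i := by
      intro i hi
      obtain ⟨k, l, hkl⟩ := R.exists_E_ne_zero i
      have hwt := R.wt_eq_of_E_ne_zero i k l hkl
      have heq : lam (R.wt k) = lam (R.wt l) + m := by rw [hwt, map_add, hlam, hi]
      refine hB g hgS i (by rw [RootPairing.Base.isPos_iff]; omega) (u i) k l hkl fun χ => ?_
      rw [adj_cartan_apply hlam hg hgm χ heq, hwt, map_add]
      have h1 := hu k l (by omega)
      rw [Matrix.sub_apply, Matrix.sum_apply, Finset.sum_eq_single i] at h1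
      · rw [sub_eq_zero.1 h1, Matrix.smul_apply, smul_eq_mul]
        ring
      · intro j _ hj
        rw [Matrix.smul_apply, R.E_apply_eq_zero hkl hj, smul_zero]
      · simp
    -- A product of root elements of height m, in any order, has the sum of their linear terms as
    -- leading term. For all roots together this is the leading term of `g`, so g h⁻¹ is trivial one
    -- height further.
    have hprod : ∀ s : Finset ι, ∃ h ∈ Γ,
        (h : Matrix κ κ ℚ_[p]) - 1 - ∑ i ∈ s, u i • R.E i ∈ R.Raises lam (m + 1) := by
      intro s
      induction s using Finset.induction_on with
      | empty => exact ⟨1, one_mem _, by simp⟩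
      | insert i s hi ihs =>
        obtain ⟨h, hh, hhm⟩ := ihs
        by_cases hht : b.height i = m
        · have hipos : b.IsPos i := by rw [RootPairing.Base.isPos_iff]; omega
          refine ⟨h * R.rootElt i (u i),
            mul_mem hh (rootElt_mem_unipotentGroup hipos (huB i hht)), ?_⟩
          rw [Finset.sum_insert hi]
          set x : Matrix κ κ ℚ_[p] := (R.rootElt i (u i) : Matrix κ κ ℚ_[p]) with hx
          have hx0 : x ∈ R.Raises lam 0 := N_mem_raises hlam (rootElt_mem_N hipos _)
          have hx1 : x - 1 ∈ R.Raises lam m := by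
            rw [← hht, ← hlam]
            exact rootElt_sub_one_mem_raises _ (by rw [hlam]; omega)
          have hx2 : x - 1 - u i • R.E i ∈ R.Raises lam (m + 1) :=
            raises_mono (by rw [hlam]; omega)
              (rootElt_sub_mem_raises (R := R) (i := i) (lam := lam) _ (by rw [hlam]; omega))
          have hsum : ∑ j ∈ s, u j • R.E j ∈ R.Raises lam m := by
            refine sum_mem fun j _ => ?_
            by_cases hj : b.height j = m
            · rw [← hj, ← hlam]
              exact raises_smul (E_mem_raises j) _
            · rw [hu0 j hj, zero_smul]
              exact zero_mem _
          have : ((h * R.rootElt i (u i) : GL κ ℚ_[p]) : Matrix κ κ ℚ_[p]) - 1 -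
              (u i • R.E i + ∑ j ∈ s, u j • R.E j) =
              ((h : Matrix κ κ ℚ_[p]) - 1 - ∑ j ∈ s, u j • R.E j) * x +
                (∑ j ∈ s, u j • R.E j) * (x - 1) + (x - 1 - u i • R.E i) := by
            rw [Units.val_mul, ← hx]
            noncomm_ring
          rw [this]
          refine add_mem (add_mem ?_ (raises_mono (by omega) (raises_mul hsum hx1))) hx2
          simpa using raises_mul hhm hx0
        · refine ⟨h, hh, ?_⟩
          rwa [Finset.sum_insert hi, hu0 i hht, zero_smul, zero_add]
    obtain ⟨h, hh, hhm⟩ := hprod Finset.univ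
    have hinv : (((h⁻¹ : GL κ ℚ_[p])) : Matrix κ κ ℚ_[p]) ∈ R.Raises lam 0 :=
      N_mem_raises hlam (hΓN (inv_mem hh))
    have hdiff : ((g * h⁻¹ : GL κ ℚ_[p]) : Matrix κ κ ℚ_[p]) - 1 ∈ R.Raises lam (m + 1) := by
      have h1 := raises_mul (sub_mem hu hhm) hinv
      rw [add_zero] at h1
      convert h1 using 1
      have h3 : (h : Matrix κ κ ℚ_[p]) * ((h⁻¹ : GL κ ℚ_[p]) : Matrix κ κ ℚ_[p]) = 1 :=
        Units.mul_inv h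
      rw [Units.val_mul, ← h3]
      noncomm_ring
    have := ih (m + 1) (by omega) (by push_cast at hmM; omega) (g * h⁻¹)
      (mul_mem hg (hΓN (inv_mem hh))) (mul_mem hgS (hΓS (inv_mem hh))) hdiff
    simpa using mul_mem this hh

end ChevalleyRep

namespace ChevalleyRep

open Matrix

variable {p : ℕ} [Fact p.Prime] {ι X Y : Type*} [Finite ι] [AddCommGroup X] [AddCommGroup Y]
  {P : RootPairing ι ℤ X Y} {κ : Type*} [Fintype κ] [DecidableEq κ] (R : ChevalleyRep p P κ)

/-! ### Valuations -/

lemma mem_valGE_intCast {n : ℤ} {u : ℚ_[p]} : u ∈ valGE p n ↔ ‖u‖ ≤ (p : ℝ) ^ (-n) := by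
  rw [mem_valGE, ← Int.cast_neg, Real.rpow_intCast]

lemma mem_valGT_intCast {n : ℤ} {u : ℚ_[p]} : u ∈ valGT p n ↔ ‖u‖ < (p : ℝ) ^ (-n) := by
  rw [mem_valGT, ← Int.cast_neg, Real.rpow_intCast]

lemma one_lt_prime_real : (1 : ℝ) < p := by exact_mod_cast (Fact.out : p.Prime).one_lt

lemma valGE_anti {s t : ℝ} (h : s ≤ t) : valGE p t ≤ valGE p s := fun _ hu =>
  (mem_valGE.1 hu).trans (Real.rpow_le_rpow_of_exponent_le one_lt_prime_real.le (neg_le_neg h))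

lemma valGT_intCast (n : ℤ) : valGT p n = valGE p ((n + 1 : ℤ) : ℝ) := by
  ext u
  rw [mem_valGT_intCast, mem_valGE_intCast, Padic.norm_lt_pow_iff_norm_le_pow_sub_one, neg_add,
    sub_eq_add_neg]

/-- Valuations are integers, so a real threshold may be rounded up. -/
lemma valGE_eq_of_lt_of_le {n : ℤ} {t : ℝ} (h1 : n < t) (h2 : t ≤ (n + 1 : ℤ)) :
    valGE p t = valGE p ((n + 1 : ℤ) : ℝ) := by
  refine le_antisymm (fun u hu => ?_) (valGE_anti h2)
  rw [← valGT_intCast, mem_valGT]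
  exact (mem_valGE.1 hu).trans_lt (Real.rpow_lt_rpow_of_exponent_lt one_lt_prime_real
    (neg_lt_neg h1))

lemma valGT_eq_of_le_of_lt {n : ℤ} {t : ℝ} (h1 : n ≤ t) (h2 : t < (n + 1 : ℤ)) :
    valGT p t = valGE p ((n + 1 : ℤ) : ℝ) := by
  refine le_antisymm (fun u hu => ?_) (fun u hu => ?_)
  · rw [← valGT_intCast, mem_valGT]
    exact (mem_valGT.1 hu).trans_le (Real.rpow_le_rpow_of_exponent_le one_lt_prime_real.le
      (neg_le_neg h1))
  · rw [mem_valGT]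
    exact (mem_valGE.1 hu).trans_lt (Real.rpow_lt_rpow_of_exponent_lt one_lt_prime_real
      (neg_lt_neg h2))

lemma intCast_mem_valGE (n : ℤ) : (n : ℚ_[p]) ∈ valGE p 0 := by
  rw [mem_valGE, neg_zero, Real.rpow_zero]
  exact Padic.norm_int_le_one n

/-- Multiplication by p^(-n) followed by reduction modulo p maps onto `ZMod p`, with the next step
of the filtration as kernel. -/
lemma valGE_relIndex_succ (n : ℤ) :
    (valGE p ((n + 1 : ℤ) : ℝ)).relIndex (valGE p n) = p := by
  have hp0 : (p : ℚ_[p]) ≠ 0 := by exact_mod_cast (Fact.out : p.Prime).ne_zero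
  have hnorm : ∀ u : ℚ_[p], ‖(p : ℚ_[p]) ^ (-n) * u‖ = (p : ℝ) ^ n * ‖u‖ := fun u => by
    rw [norm_mul, Padic.norm_p_zpow, neg_neg]
  have hpos : (0 : ℝ) < (p : ℝ) ^ n := zpow_pos prime_pos_real n
  let f₀ : valGE p (n : ℝ) →+ ℤ_[p] :=
    { toFun := fun u => ⟨(p : ℚ_[p]) ^ (-n) * u, by
        have := mem_valGE_intCast.1 u.2
        rw [hnorm]
        calc (p : ℝ) ^ n * ‖(u : ℚ_[p])‖ ≤ (p : ℝ) ^ n * (p : ℝ) ^ (-n) := by gcongr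
          _ = 1 := by rw [_root_.zpow_neg, mul_inv_cancel₀ hpos.ne']⟩
      map_zero' := Subtype.ext (by simp)
      map_add' := fun u v => Subtype.ext (mul_add _ _ _) }
  let f : valGE p (n : ℝ) →+ ZMod p := (PadicInt.toZMod (p := p)).toAddMonoidHom.comp f₀
  have hker : f.ker = (valGE p ((n + 1 : ℤ) : ℝ)).addSubgroupOf (valGE p n) := by
    ext u
    rw [AddMonoidHom.mem_ker, AddSubgroup.mem_addSubgroupOf]
    change PadicInt.toZMod (f₀ u) = 0 ↔ _
    rw [← RingHom.mem_ker, PadicInt.ker_toZMod, IsLocalRing.mem_maximalIdeal, PadicInt.mem_nonunits,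
      ← valGT_intCast, mem_valGT_intCast]
    change ‖(p : ℚ_[p]) ^ (-n) * u‖ < 1 ↔ _
    rw [hnorm, _root_.zpow_neg, ← mul_inv_cancel₀ hpos.ne', mul_lt_mul_iff_right₀ hpos]
  have hsurj : Function.Surjective f := by
    intro c
    obtain ⟨z, rfl⟩ := ZMod.ringHom_surjective (PadicInt.toZMod (p := p)) c
    have hz : (p : ℚ_[p]) ^ n * z ∈ valGE p (n : ℝ) := by
      rw [mem_valGE_intCast, norm_mul, Padic.norm_p_zpow]
      exact mul_le_of_le_one_right (by positivity) z.2
    refine ⟨⟨_, hz⟩, ?_⟩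
    change PadicInt.toZMod (f₀ ⟨_, hz⟩) = _
    congr 1
    apply Subtype.ext
    change (p : ℚ_[p]) ^ (-n) * ((p : ℚ_[p]) ^ n * z) = z
    rw [← mul_assoc, ← zpow_add₀ hp0]
    simp
  rw [AddSubgroup.relIndex, ← hker, AddSubgroup.index_ker, AddMonoidHom.range_eq_top.2 hsurj]
  simp

/-! ### The root subgroups of parahoric groups -/

/-- With such a χ, conjugation by x_α(u) shows u itself. The coroot would only show 2u, which loses
a power of p when p = 2. Connectedness of the centre enters here, and again for the height
functional. -/
lemma exists_integral_char [Module.Finite ℤ X] [P.IsReduced] (hc : P.HasConnectedCenter)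
    (b : P.Base) (i : ι) :
    ∃ χ : X →+ ℚ_[p], (∀ μ, χ μ ∈ valGE p 0) ∧ χ (P.root i) = 1 := by
  obtain ⟨f, hf⟩ := b.exists_apply_root_eq_one i
  obtain ⟨g, hg⟩ := hc.exists_extension f
  refine ⟨(Int.castAddHom ℚ_[p]).comp g.toAddMonoidHom, fun μ => intCast_mem_valGE _, ?_⟩
  have : g (P.root i) = 1 := (hg (P.rootSpanMem ℤ i)).trans hf
  simp [this]

variable {R}

lemma mem_of_adj_cartan_sub_mem {B : ι → AddSubgroup ℚ_[p]} {B₀ : AddSubgroup ℚ_[p]}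
    {g : GL κ ℚ_[p]} {i : ι} {χ : X →+ ℚ_[p]} (hχi : χ (P.root i) = 1)
    (hg : adj g (R.cartan χ) - R.cartan χ ∈ R.lieLattice B B₀) {u : ℚ_[p]} {k l : κ}
    (h : R.E i k l ≠ 0)
    (hu : (adj g (R.cartan χ) - R.cartan χ) k l = -(u * χ (P.root i)) * R.E i k l) :
    u ∈ B i := by
  obtain ⟨c, hc, hc'⟩ := exists_entry_of_mem_lieLattice hg h
  rw [hc', hχi, mul_one] at hu
  rw [← neg_neg u, ← mul_right_cancel₀ h hu]
  exact neg_mem hc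

lemma adj_cartan_sub_mem_pointLattice {x : P.Apartment} {g : GL κ ℚ_[p]}
    (hg : g ∈ adjStabilizer (R.pointLattice x)) {χ : X →+ ℚ_[p]} (hχ : ∀ μ, χ μ ∈ valGE p 0) :
    adj g (R.cartan χ) - R.cartan χ ∈ R.pointLattice x :=
  sub_mem (hg _ (cartan_mem_lieLattice hχ)).1 (cartan_mem_lieLattice hχ)

variable (R) in
lemma rootElt_mem_rootSubgroup (i : ι) (u : ℚ_[p]) : R.rootElt i u ∈ R.rootSubgroup i := ⟨_, rfl⟩

/-- For χ with χ(α) = 1, conjugation by x_α(u) moves χ by -u e_α, which must lie in the lattice of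
every point of Ω. -/
lemma parahoric_inf_rootSubgroup [P.IsReduced] {i : ι}
    (hχ : ∃ χ : X →+ ℚ_[p], (∀ μ, χ μ ∈ valGE p 0) ∧ χ (P.root i) = 1) (Ω : Set P.Apartment) :
    R.parahoric Ω ⊓ R.rootSubgroup i = R.rootSubgroupFix i Ω := by
  apply le_antisymm
  · rintro g ⟨hg, u, rfl⟩
    obtain ⟨χ, hχ, hχi⟩ := hχ
    refine R.mem_rootSubgroupFix_iff.2 ⟨u.toAdd, fun x hx => ?_, rfl⟩
    obtain ⟨k, l, hkl⟩ := R.exists_E_ne_zero i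
    refine mem_of_adj_cartan_sub_mem hχi (adj_cartan_sub_mem_pointLattice
      (R.parahoric_le_adjStabilizer hx hg) hχ) hkl ?_
    change (adj (R.rootElt i u.toAdd) (R.cartan χ) - R.cartan χ) k l = _
    rw [adj_rootElt_cartan, sub_sub_cancel_left, Matrix.neg_apply, Matrix.smul_apply, smul_eq_mul,
      neg_mul]
  · intro g hg
    obtain ⟨u, hu, rfl⟩ := R.mem_rootSubgroupFix_iff.1 hg
    exact ⟨R.rootElt_mem_parahoric hu, R.rootElt_mem_rootSubgroup i u⟩

variable {b : P.Base} {lam : X →ₗ[ℤ] ℤ}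

/-- The peeling argument applies to the parahoric group: an integral χ with χ(α) = 1 turns the
stability of the lattices of the points of Ω into bounds for leading coefficients. -/
lemma parahoric_inf_N [P.IsReduced] (hlam : ∀ i, lam (P.root i) = b.height i)
    (hχ : ∀ i, ∃ χ : X →+ ℚ_[p], (∀ μ, χ μ ∈ valGE p 0) ∧ χ (P.root i) = 1)
    (Ω : Set P.Apartment) :
    R.parahoric Ω ⊓ R.N b =
      R.unipotentGroup b fun i => {u | ∀ x ∈ Ω, u ∈ valGE p (P.rootFunctional i x)} := by
  apply le_antisymm
  · rintro g ⟨hg, hgN⟩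
    refine mem_unipotentGroup_of_mem_N hlam (R.parahoric Ω) _
      (fun i _ u hu => R.rootElt_mem_parahoric hu) (fun g hg i _ u k l hkl hu x hx => ?_) hgN hg
    obtain ⟨χ, hχ, hχi⟩ := hχ i
    exact mem_of_adj_cartan_sub_mem hχi (adj_cartan_sub_mem_pointLattice
      (R.parahoric_le_adjStabilizer hx hg) hχ) hkl (hu χ)
  · rw [unipotentGroup_le_iff]
    exact fun i hi u hu => ⟨R.rootElt_mem_parahoric hu, rootElt_mem_N hi u⟩

lemma rootHom_injective (i : ι) : Function.Injective (R.rootHom i) := by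
  rw [injective_iff_map_eq_one]
  intro u hu
  obtain ⟨k, l, hkl⟩ := R.exists_E_ne_zero i
  have h1 := R.adj_rootElt_cartan i u.toAdd (corootChar p P i)
  rw [show R.rootElt i u.toAdd = 1 from hu, adj_one, eq_comm, sub_eq_self] at h1
  have h2 := congrFun (congrFun h1 k) l
  rw [Matrix.smul_apply, smul_eq_mul, Matrix.zero_apply, corootChar_root,
    RootPairing.pairing_same] at h2
  have h3 : u.toAdd = 0 := by simpa [hkl] using h2
  exact h3

variable (R) in
/-- The elements `x_α(u)`, `u ∈ B`. -/
noncomputable def rootImage (i : ι) (B : AddSubgroup ℚ_[p]) : Subgroup (GL κ ℚ_[p]) :=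
  B.toSubgroup.map (R.rootHom i)

lemma mem_rootImage {i : ι} {B : AddSubgroup ℚ_[p]} {g : GL κ ℚ_[p]} :
    g ∈ R.rootImage i B ↔ ∃ u ∈ B, R.rootElt i u = g := Iff.rfl

lemma rootImage_mono {i : ι} {B B' : AddSubgroup ℚ_[p]} (h : B ≤ B') :
    R.rootImage i B ≤ R.rootImage i B' := by
  rintro _ ⟨u, hu, rfl⟩
  exact ⟨u, h hu, rfl⟩

lemma rootImage_relIndex_succ (i : ι) (n : ℤ) :
    (R.rootImage i (valGE p ((n + 1 : ℤ) : ℝ))).relIndex (R.rootImage i (valGE p n)) = p := by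
  rw [rootImage, rootImage, Subgroup.relIndex_map_map_of_injective _ _ (rootHom_injective i)]
  exact valGE_relIndex_succ n

/-! ### Chambers -/

/-- The closed chamber given by a family of integers. -/
def closedAlcove (P : RootPairing ι ℤ X Y) (k : ι → ℤ) : Set P.Apartment :=
  {x | ∀ i, (k i : ℝ) ≤ P.rootFunctional i x ∧ P.rootFunctional i x ≤ k i + 1}

/-- The integers `k` describe a chamber, i.e. the corresponding open chamber is nonempty. -/
def HasInterior (P : RootPairing ι ℤ X Y) (k : ι → ℤ) : Prop :=
  ∃ x, ∀ i, (k i : ℝ) < P.rootFunctional i x ∧ P.rootFunctional i x < k i + 1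

omit [Finite ι] in
-- A single interior point suffices: there α lies strictly above `k i`, and discreteness of the
-- valuation rounds the condition up to the supremum `k i + 1`.
lemma forall_mem_closedAlcove_iff {k : ι → ℤ} (hk : HasInterior P k) (i : ι) (u : ℚ_[p]) :
    (∀ x ∈ closedAlcove P k, u ∈ valGE p (P.rootFunctional i x)) ↔
      u ∈ valGE p ((k i + 1 : ℤ) : ℝ) := by
  constructor
  · obtain ⟨x, hx⟩ := hk
    intro h
    rw [← valGE_eq_of_lt_of_le (hx i).1 (by push_cast; exact (hx i).2.le)]
    exact h x fun i => ⟨(hx i).1.le, (hx i).2.le⟩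
  · exact fun h x hx => valGE_anti (by push_cast; exact (hx i).2) h

lemma iwahori_inf_rootSubgroup [P.IsReduced] {i : ι}
    (hχ : ∃ χ : X →+ ℚ_[p], (∀ μ, χ μ ∈ valGE p 0) ∧ χ (P.root i) = 1) {k : ι → ℤ}
    (hk : HasInterior P k) :
    R.iwahori (closedAlcove P k) ⊓ R.rootSubgroup i =
      R.rootImage i (valGE p ((k i + 1 : ℤ) : ℝ)) := by
  rw [iwahori, parahoric_inf_rootSubgroup hχ]
  ext g
  simp_rw [mem_rootSubgroupFix_iff, mem_rootImage, forall_mem_closedAlcove_iff hk]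

lemma iwahori_inf_N [P.IsReduced] (hlam : ∀ i, lam (P.root i) = b.height i)
    (hχ : ∀ i, ∃ χ : X →+ ℚ_[p], (∀ μ, χ μ ∈ valGE p 0) ∧ χ (P.root i) = 1) {k : ι → ℤ}
    (hk : HasInterior P k) :
    R.iwahori (closedAlcove P k) ⊓ R.N b =
      R.unipotentGroup b fun i => (valGE p ((k i + 1 : ℤ) : ℝ) : Set ℚ_[p]) := by
  rw [iwahori, parahoric_inf_N hlam hχ]
  simp_rw [forall_mem_closedAlcove_iff hk]
  rfl

lemma isCrossingRoot_of_isCrossing [P.IsReduced]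
    (hχ : ∀ i, ∃ χ : X →+ ℚ_[p], (∀ μ, χ μ ∈ valGE p 0) ∧ χ (P.root i) = 1) {k k' : ι → ℤ}
    (hk : HasInterior P k) (hk' : HasInterior P k') {ε : ι} {y : P.Apartment}
    (h : P.IsCrossing k k' ε y) :
    R.IsCrossingRoot (closedAlcove P k) (closedAlcove P k') ε := by
  simp only [IsCrossingRoot, iwahori_inf_rootSubgroup (hχ _) hk,
    iwahori_inf_rootSubgroup (hχ _) hk']
  refine ⟨fun j h1 h2 => by rw [h.apply_of_ne j h1 h2], ⟨?_, ?_⟩, ?_, ?_⟩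
  · refine rootImage_mono (valGE_anti ?_)
    rw [h.apply_neg]
    exact_mod_cast (by omega)
  · rw [h.apply_neg, sub_add_cancel]
    exact rootImage_relIndex_succ _ _
  · refine rootImage_mono (valGE_anti ?_)
    rw [h.apply_self]
    exact_mod_cast (by omega)
  · rw [h.apply_self]
    exact rootImage_relIndex_succ _ _

/-- Two crossing roots that are neither equal nor opposite give an equality where the index should
be p. Opposite ones give inclusions both ways, again of index 1. -/
lemma IsCrossingRoot.unique {D D' : Set P.Apartment} {δ ε : ι} (hδ : R.IsCrossingRoot D D' δ)
    (hε : R.IsCrossingRoot D D' ε) : δ = ε := by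
  have hp : p ≠ 1 := (Fact.out : p.Prime).one_lt.ne'
  by_contra hne
  by_cases hneg : δ = P.reflectionPerm ε ε
  · subst hneg
    have h1 := hδ.2.2.1
    have h2 := hε.2.1.2
    rw [Subgroup.relIndex_eq_one.2 h1] at h2
    exact hp h2.symm
  · have h1 := hε.1 δ hne hneg
    have h2 := hδ.2.2.2
    rw [h1, Subgroup.relIndex_self] at h2
    exact hp h2.symm

/-! ### Indices -/

/-- The hypothesis, applied to n⁻¹, says that every left coset of `H'` in `H` meets `K`. Normality
of `H'` is not required. -/
lemma _root_.Subgroup.relIndex_eq_relIndex_of_mul_mem {G : Type*} [Group G] {H' H K : Subgroup G}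
    (hK : K ≤ H) (hmul : ∀ n ∈ H, ∃ k ∈ K, n * k ∈ H') :
    H'.relIndex H = H'.relIndex K := by
  symm
  rw [Subgroup.relIndex, Subgroup.relIndex, Subgroup.index, Subgroup.index]
  refine Nat.card_eq_of_bijective (Subgroup.quotientSubgroupOfEmbeddingOfLE H' hK)
    ⟨(Subgroup.quotientSubgroupOfEmbeddingOfLE H' hK).injective, fun q => ?_⟩
  obtain ⟨⟨n, hn⟩, rfl⟩ := QuotientGroup.mk_surjective q
  obtain ⟨k, hk, hnk⟩ := hmul n⁻¹ (inv_mem hn)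
  refine ⟨QuotientGroup.mk ⟨k, hk⟩, ?_⟩
  rw [Subgroup.quotientSubgroupOfEmbeddingOfLE_apply_mk, QuotientGroup.eq, Subgroup.mem_subgroupOf]
  simpa using inv_mem hnk

variable (R) in
/-- The group of elements which preserve `pointLattice y` and `pointSublattice y` and act
trivially on the image of the Cartan subalgebra in the quotient. -/
noncomputable def cartanStabilizer (y : P.Apartment) : Subgroup (GL κ ℚ_[p]) where
  carrier := {g | g ∈ adjStabilizer (R.pointLattice y) ∧ g ∈ adjStabilizer (R.pointSublattice y) ∧
    ∀ χ : X →+ ℚ_[p], (∀ μ, χ μ ∈ valGE p 0) →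
      adj g (R.cartan χ) - R.cartan χ ∈ R.pointSublattice y}
  one_mem' := ⟨one_mem _, one_mem _, fun χ _ => by simp⟩
  mul_mem' {g h} hg hh := ⟨mul_mem hg.1 hh.1, mul_mem hg.2.1 hh.2.1, fun χ hχ => by
    have := add_mem (hg.2.1 _ (hh.2.2 χ hχ)).1 (hg.2.2 χ hχ)
    rwa [map_sub, ← adj_mul, sub_add_sub_cancel] at this⟩
  inv_mem' {g} hg := ⟨inv_mem hg.1, inv_mem hg.2.1, fun χ hχ => by
    have := neg_mem (hg.2.1 _ (hg.2.2 χ hχ)).2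
    rwa [map_sub, adj_inv_adj, neg_sub] at this⟩

lemma rootElt_mem_cartanStabilizer [P.IsReduced] {y : P.Apartment} {i : ι} {u : ℚ_[p]}
    (hu : u ∈ valGT p (P.rootFunctional i y)) : R.rootElt i u ∈ R.cartanStabilizer y := by
  refine ⟨rootElt_mem_adjStabilizer (compatible_valGE (valGT_le_valGE hu)),
    rootElt_mem_adjStabilizer (compatible_valGT (valGT_le_valGE hu)), fun χ hχ => ?_⟩
  rw [adj_rootElt_cartan, sub_sub_cancel_left, mul_comm]
  refine neg_mem (smul_E_mem_lieLattice ?_)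
  simpa using mul_mem_valGT (hχ (P.root i)) hu

lemma mem_unipotentGroup_of_mem_cartanStabilizer [P.IsReduced]
    (hlam : ∀ i, lam (P.root i) = b.height i)
    (hχ : ∀ i, ∃ χ : X →+ ℚ_[p], (∀ μ, χ μ ∈ valGE p 0) ∧ χ (P.root i) = 1) {y : P.Apartment}
    {g : GL κ ℚ_[p]} (hg : g ∈ R.N b) (hgy : g ∈ R.cartanStabilizer y) :
    g ∈ R.unipotentGroup b fun i => (valGT p (P.rootFunctional i y) : Set ℚ_[p]) := by
  refine mem_unipotentGroup_of_mem_N hlam (R.cartanStabilizer y) _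
    (fun i _ u hu => rootElt_mem_cartanStabilizer hu) (fun g hg i _ u k l hkl hu => ?_) hg hgy
  obtain ⟨χ, hχ, hχi⟩ := hχ i
  exact mem_of_adj_cartan_sub_mem hχi (hg.2.2 χ hχ) hkl (hu χ)

/-- Modulo `cartanStabilizer y`, the positive part of the parahoric group of a point `y` lying on
a single wall is given by the root subgroup of that wall. -/
lemma exists_mul_rootElt_mem_cartanStabilizer [P.IsReduced] {y : P.Apartment} {ε : ι}
    (hε : b.IsPos ε)
    (hy : ∀ i, b.IsPos i → i ≠ ε →
      valGE p (P.rootFunctional i y) ≤ valGT p (P.rootFunctional i y))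
    {g : GL κ ℚ_[p]}
    (hg : g ∈ R.unipotentGroup b fun i => (valGE p (P.rootFunctional i y) : Set ℚ_[p])) :
    ∃ a ∈ valGE p (P.rootFunctional ε y), g * R.rootElt ε a ∈ R.cartanStabilizer y := by
  -- Modulo the sublattice at `y`, such `g` fix e_ε and move χ by -aχ(ε) e_ε. Therefore `a` is
  -- additive under products, and multiplying by x_ε(-a) yields an element acting trivially on the
  -- Cartan part.
  let C : GL κ ℚ_[p] → Prop := fun g => g ∈ adjStabilizer (R.pointLattice y) ∧
    g ∈ adjStabilizer (R.pointSublattice y) ∧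
    (∀ c ∈ valGE p (P.rootFunctional ε y),
      adj g (c • R.E ε) - c • R.E ε ∈ R.pointSublattice y) ∧
    ∃ a ∈ valGE p (P.rootFunctional ε y), ∀ χ : X →+ ℚ_[p], (∀ μ, χ μ ∈ valGE p 0) →
      adj g (R.cartan χ) - R.cartan χ + (a * χ (P.root ε)) • R.E ε ∈ R.pointSublattice y
  have hmul : ∀ g h, C g → C h → C (g * h) := by
    rintro g h ⟨hg1, hg2, hg3, a, ha, hg4⟩ ⟨hh1, hh2, hh3, c, hc, hh4⟩
    refine ⟨mul_mem hg1 hh1, mul_mem hg2 hh2, fun d hd => ?_, a + c, add_mem ha hc,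
      fun χ hχ => ?_⟩
    · have := add_mem (hg2 _ (hh3 d hd)).1 (hg3 d hd)
      rwa [map_sub, ← adj_mul, sub_add_sub_cancel] at this
    · have hcχ : c * χ (P.root ε) ∈ valGE p (P.rootFunctional ε y) := by
        simpa using mul_mem_valGE hc (hχ (P.root ε))
      have := add_mem (sub_mem (hg2 _ (hh4 χ hχ)).1 (hg3 _ hcχ)) (hg4 χ hχ)
      rw [map_add, map_sub, ← adj_mul] at this
      convert this using 1
      rw [add_mul, add_smul]
      abel
  have helt : ∀ i u, b.IsPos i → u ∈ valGE p (P.rootFunctional i y) → C (R.rootElt i u) := by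
    intro i u hi hu
    have h1 := rootElt_mem_adjStabilizer (R := R) (compatible_valGE hu)
    have h2 := rootElt_mem_adjStabilizer (R := R) (compatible_valGT hu)
    by_cases hiε : i = ε
    · subst hiε
      refine ⟨h1, h2, fun c _ => ?_, u, hu, fun χ _ => ?_⟩
      · rw [map_smul, adj_rootElt_self, sub_self]
        exact zero_mem _
      · rw [adj_rootElt_cartan, sub_sub_cancel_left, neg_add_cancel]
        exact zero_mem _
    · have hu' := hy i hi hiε hu
      refine ⟨h1, h2, fun c hc => ?_, 0, zero_mem _, fun χ hχ => ?_⟩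
      · refine R.adj_rootElt_sub_mem (Ne.symm hiε) ?_ u c _ fun n k hn hk =>
          smul_E_mem_lieLattice ?_
        · rintro rfl
          exact (b.isPos_neg_iff i).1 hε hi
        · rw [rootFunctional_of_root_eq hk, mul_comm (u ^ n)]
          exact mul_mem_valGT hc (pow_mem_valGT hu' hn)
      · rw [zero_mul, zero_smul, add_zero]
        exact (rootElt_mem_cartanStabilizer hu').2.2 χ hχ
  have hone : C 1 := by
    rw [← R.rootElt_zero ε]
    exact helt ε 0 hε (zero_mem _)
  obtain ⟨hg1, hg2, hg3, a, ha, hg4⟩ := unipotentGroup_induction hone hmul helt hg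
  refine ⟨-a, neg_mem ha, ?_⟩
  refine ⟨mul_mem hg1 (rootElt_mem_adjStabilizer (compatible_valGE (neg_mem ha))),
    mul_mem hg2 (rootElt_mem_adjStabilizer (compatible_valGT (neg_mem ha))), fun χ hχ => ?_⟩
  have haχ : a * χ (P.root ε) ∈ valGE p (P.rootFunctional ε y) := by
    simpa using mul_mem_valGE ha (hχ (P.root ε))
  have := add_mem (hg4 χ hχ) (hg3 _ haχ)
  rw [adj_mul, adj_rootElt_cartan, map_sub, neg_mul, neg_smul, map_neg]
  convert this using 1
  abel

/-- At the facet point `y`, the first group is described by v(u) ≥ α(y) and the second by v(u) >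
α(y). The two conditions differ only for the positive root ε, as no other positive root is integral
at `y`. -/
theorem iwahori_inf_N_of_isCrossing [P.IsReduced] (hlam : ∀ i, lam (P.root i) = b.height i)
    (hχ : ∀ i, ∃ χ : X →+ ℚ_[p], (∀ μ, χ μ ∈ valGE p 0) ∧ χ (P.root i) = 1) {k k' : ι → ℤ}
    (hk : HasInterior P k) (hk' : HasInterior P k') {ε : ι} (hε : b.IsPos ε) {y : P.Apartment}
    (h : P.IsCrossing k k' ε y) :
    R.iwahori (closedAlcove P k') ⊓ R.N b ≤ R.iwahori (closedAlcove P k) ⊓ R.N b ∧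
      (R.iwahori (closedAlcove P k') ⊓ R.N b).relIndex
        (R.iwahori (closedAlcove P k) ⊓ R.N b) = p := by
  have hneg : ∀ i, b.IsPos i → i ≠ P.reflectionPerm ε ε := by
    rintro i hi rfl
    exact (b.isPos_neg_iff ε).1 hi hε
  have hle : ∀ i, b.IsPos i → k i ≤ k' i := by
    intro i hi
    by_cases hiε : i = ε
    · rw [hiε, h.apply_self]
      omega
    · rw [h.apply_of_ne i hiε (hneg i hi)]
  have hGE : ∀ i, b.IsPos i → valGE p ((k i + 1 : ℤ) : ℝ) = valGE p (P.rootFunctional i y) := by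
    intro i hi
    by_cases hiε : i = ε
    · rw [hiε, h.wall]
      push_cast
      rfl
    · obtain ⟨h1, h2⟩ := h.lt_wall i hiε (hneg i hi)
      exact (valGE_eq_of_lt_of_le h1 (by push_cast; exact h2.le)).symm
  have hGT : ∀ i, b.IsPos i → valGE p ((k' i + 1 : ℤ) : ℝ) = valGT p (P.rootFunctional i y) := by
    intro i hi
    by_cases hiε : i = ε
    · rw [hiε, h.wall, h.apply_self, ← valGT_intCast]
      push_cast
      rfl
    · obtain ⟨h1, h2⟩ := h.lt_wall i hiε (hneg i hi)
      rw [h.apply_of_ne i hiε (hneg i hi)]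
      exact (valGT_eq_of_le_of_lt h1.le (by push_cast; exact h2)).symm
  have hH := iwahori_inf_N (R := R) hlam hχ hk
  have hH' := iwahori_inf_N (R := R) hlam hχ hk'
  have hHy : R.iwahori (closedAlcove P k) ⊓ R.N b ≤
      R.unipotentGroup b fun i => (valGE p (P.rootFunctional i y) : Set ℚ_[p]) := by
    rw [hH, unipotentGroup_le_iff]
    intro i hi u hu
    rw [hGE i hi] at hu
    exact rootElt_mem_unipotentGroup hi hu
  have hHy' : (R.unipotentGroup b fun i => (valGT p (P.rootFunctional i y) : Set ℚ_[p])) ≤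
      R.iwahori (closedAlcove P k') ⊓ R.N b := by
    rw [hH', unipotentGroup_le_iff]
    intro i hi u hu
    rw [← hGT i hi] at hu
    exact rootElt_mem_unipotentGroup hi hu
  have hKN : R.rootSubgroup ε ≤ R.N b := by
    rintro _ ⟨u, rfl⟩
    exact rootElt_mem_N hε u.toAdd
  obtain ⟨-, -, hcr1, hcr2⟩ := isCrossingRoot_of_isCrossing (R := R) hχ hk hk' h
  constructor
  · rw [hH, hH', unipotentGroup_le_iff]
    exact fun i hi u hu => rootElt_mem_unipotentGroup hi
      (valGE_anti (by exact_mod_cast (by have := hle i hi; omega)) hu)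
  -- Every coset has a representative in the root subgroup of ε, which reduces the index to the one
  -- known there.
  · rw [Subgroup.relIndex_eq_relIndex_of_mul_mem
      (K := R.iwahori (closedAlcove P k) ⊓ R.rootSubgroup ε) (inf_le_inf_left _ hKN),
      ← Subgroup.inf_relIndex_right]
    · refine Eq.trans ?_ hcr2
      congr 1
      apply le_antisymm
      · exact le_inf (inf_le_left.trans inf_le_left) (inf_le_right.trans inf_le_right)
      · exact le_inf (inf_le_inf_left _ hKN) hcr1
    · intro n hn
      have hn' := hHy hn
      obtain ⟨a, ha, hna⟩ := exists_mul_rootElt_mem_cartanStabilizer hε (fun i hi hiε => by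
        obtain ⟨h1, h2⟩ := h.lt_wall i hiε (hneg i hi)
        rw [← hGE i hi, ← hGT i hi, h.apply_of_ne i hiε (hneg i hi)]) hn'
      refine ⟨R.rootElt ε a, ?_, ?_⟩
      · rw [iwahori_inf_rootSubgroup (hχ ε) hk, mem_rootImage]
        exact ⟨a, by rwa [hGE ε hε], rfl⟩
      · exact hHy' (mem_unipotentGroup_of_mem_cartanStabilizer hlam hχ
          (mul_mem hn.2 (rootElt_mem_N hε a)) hna)

/-- On the base chamber every positive root attains its maximum 0 at the origin, so the whole
chamber and the origin impose the same conditions. -/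
lemma iwahori_chamber_inf_N [P.IsReduced] (hlam : ∀ i, lam (P.root i) = b.height i)
    (hχ : ∀ i, ∃ χ : X →+ ℚ_[p], (∀ μ, χ μ ∈ valGE p 0) ∧ χ (P.root i) = 1) :
    R.iwahori b.chamber ⊓ R.N b = R.N₀ b := by
  have h0 : (0 : P.Apartment) ∈ b.chamber := fun i _ => by simp
  rw [iwahori, N₀, K, inf_comm (R.N b), parahoric_inf_N hlam hχ, parahoric_inf_N hlam hχ]
  apply le_antisymm <;> rw [unipotentGroup_le_iff] <;> intro i hi u hu <;>
    refine rootElt_mem_unipotentGroup hi ?_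
  · rintro x rfl
    exact hu 0 h0
  · intro x hx
    refine valGE_anti ?_ (hu 0 rfl)
    rw [map_zero]
    exact (hx i hi).2

end ChevalleyRep

namespace ChevalleyRep

open Matrix

variable {p : ℕ} [Fact p.Prime] {ι X Y : Type*} [Finite ι] [AddCommGroup X] [AddCommGroup Y]
  {P : RootPairing ι ℤ X Y} {κ : Type*} [Fintype κ] [DecidableEq κ] (R : ChevalleyRep p P κ)

/-! ### The action of the normalizer on the characters of the torus -/

lemma evalChar_add (μ ν : X) (t : Torus p X) : evalChar (μ + ν) t = evalChar μ t * evalChar ν t := by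
  rw [evalChar, ofAdd_add, map_mul]
  rfl

lemma evalChar_zero (t : Torus p X) : evalChar (0 : X) t = 1 := by
  rw [evalChar, ofAdd_zero, map_one]

lemma evalChar_neg (μ : X) (t : Torus p X) : evalChar (-μ) t = (evalChar μ t)⁻¹ := by
  rw [evalChar, ofAdd_neg, map_inv]
  rfl

/-- The element `p ^ f` of the torus. -/
noncomputable def uniformizerPow (p : ℕ) [Fact p.Prime] (f : X →+ ℤ) : Torus p X where
  toFun μ := Units.mk0 (p : ℚ_[p]) (by exact_mod_cast (Fact.out : p.Prime).ne_zero) ^ f μ.toAdd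
  map_one' := by simp
  map_mul' μ ν := by simp [_root_.zpow_add]

lemma coe_evalChar_uniformizerPow (f : X →+ ℤ) (μ : X) :
    (evalChar μ (uniformizerPow p f) : ℚ_[p]) = (p : ℚ_[p]) ^ f μ := by
  simp [evalChar, uniformizerPow]

lemma evalChar_uniformizerPow_eq_one {f : X →+ ℤ} {μ : X}
    (h : evalChar μ (uniformizerPow p f) = 1) : f μ = 0 := by
  have h1 : ‖(evalChar μ (uniformizerPow p f) : ℚ_[p])‖ = 1 := by rw [h]; simp
  rw [coe_evalChar_uniformizerPow, Padic.norm_p_zpow] at h1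
  have := zpow_right_injective₀ prime_pos_real (one_lt_prime_real (p := p)).ne'
    (h1.trans (_root_.zpow_zero (p : ℝ)).symm)
  omega

/-- The characters `μ` and `ν` correspond to each other under conjugation by `n`. -/
def MatchesChar (n : GL κ ℚ_[p]) (μ ν : X) : Prop :=
  ∀ t s, n * R.torusHom t = R.torusHom s * n → evalChar μ t = evalChar ν s

variable {R}

lemma MatchesChar.add {n : GL κ ℚ_[p]} {μ ν μ' ν' : X} (h : R.MatchesChar n μ ν)
    (h' : R.MatchesChar n μ' ν') : R.MatchesChar n (μ + μ') (ν + ν') := fun t s hts => by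
  rw [evalChar_add, evalChar_add, h t s hts, h' t s hts]

lemma MatchesChar.neg {n : GL κ ℚ_[p]} {μ ν : X} (h : R.MatchesChar n μ ν) :
    R.MatchesChar n (-μ) (-ν) := fun t s hts => by
  rw [evalChar_neg, evalChar_neg, h t s hts]

variable (R) in
lemma matchesChar_zero (n : GL κ ℚ_[p]) : R.MatchesChar n 0 0 := fun t s _ => by
  rw [evalChar_zero, evalChar_zero]

/-- Compare the (k, l) entries of n t = s n and cancel the nonzero entry of n. -/
lemma matchesChar_of_apply_ne_zero {n : GL κ ℚ_[p]} {k l : κ}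
    (h : (n : Matrix κ κ ℚ_[p]) k l ≠ 0) : R.MatchesChar n (R.wt l) (R.wt k) := fun t s hts => by
  have h0 : (n : Matrix κ κ ℚ_[p]) * (R.torusHom t : Matrix κ κ ℚ_[p]) =
      (R.torusHom s : Matrix κ κ ℚ_[p]) * n := by
    rw [← Units.val_mul, hts, Units.val_mul]
  have h1 := congrFun (congrFun h0 k) l
  rw [coe_torusHom, coe_torusHom, mul_diagonal, diagonal_mul,
    mul_comm] at h1
  exact Units.ext (mul_right_cancel₀ h h1)

lemma exists_torusHom_mul {n : GL κ ℚ_[p]} (hn : n ∈ R.normalizerT) (t : Torus p X) :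
    ∃ s, n * R.torusHom t = R.torusHom s * n := by
  obtain ⟨s, hs⟩ := (Subgroup.mem_normalizer_iff.1 hn.2 (R.torusHom t)).1 ⟨t, rfl⟩
  exact ⟨s, by rw [hs, inv_mul_cancel_right]⟩

lemma exists_mul_torusHom {n : GL κ ℚ_[p]} (hn : n ∈ R.normalizerT) (s : Torus p X) :
    ∃ t, n * R.torusHom t = R.torusHom s * n := by
  obtain ⟨t, ht⟩ := (Subgroup.mem_normalizer_iff.1 hn.2 (n⁻¹ * R.torusHom s * n)).2
    ⟨s, by group⟩
  exact ⟨t, by rw [ht]; group⟩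

/-- Every torus element is a conjugate by n, and the elements p^y separate characters because the
pairing is perfect. -/
lemma MatchesChar.right_unique {n : GL κ ℚ_[p]} (hn : n ∈ R.normalizerT) {μ ν ν' : X}
    (h : R.MatchesChar n μ ν) (h' : R.MatchesChar n μ ν') : ν = ν' := by
  rw [← sub_eq_zero]
  by_contra hne
  have h1 : ∀ s : Torus p X, evalChar (ν - ν') s = 1 := fun s => by
    obtain ⟨t, ht⟩ := exists_mul_torusHom hn s
    rw [sub_eq_add_neg, evalChar_add, evalChar_neg, ← h t s ht, ← h' t s ht, mul_inv_cancel]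
  refine hne (P.toPerfPair.injective ?_)
  ext y
  rw [map_zero]
  exact evalChar_uniformizerPow_eq_one (h1 (uniformizerPow p (P.toLinearMap.flip y).toAddMonoidHom))

/-- A column of an invertible matrix has a nonzero entry, which settles the weights; they generate
all characters. -/
lemma exists_matchesChar {n : GL κ ℚ_[p]} (μ : X) : ∃ ν, R.MatchesChar n μ ν := by
  have hμ : μ ∈ AddSubgroup.closure (Set.range R.wt) := by rw [R.closure_wt]; trivial
  induction hμ using AddSubgroup.closure_induction with
  | mem μ hμ =>
    obtain ⟨l, rfl⟩ := hμ
    by_contra! h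
    have h1 : ∀ k, (n : Matrix κ κ ℚ_[p]) k l = 0 := fun k => by
      by_contra hk
      exact h _ (matchesChar_of_apply_ne_zero hk)
    have h2 := congrFun (congrFun (Units.inv_mul n) l) l
    rw [Matrix.mul_apply, Finset.sum_eq_zero fun k _ => by rw [h1, mul_zero], one_apply_eq] at h2
    exact zero_ne_one h2
  | zero => exact ⟨0, R.matchesChar_zero n⟩
  | add μ μ' _ _ h h' =>
    obtain ⟨ν, hν⟩ := h
    obtain ⟨ν', hν'⟩ := h'
    exact ⟨ν + ν', hν.add hν'⟩
  | neg μ _ h =>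
    obtain ⟨ν, hν⟩ := h
    exact ⟨-ν, hν.neg⟩

lemma exists_matchesChar_left {n : GL κ ℚ_[p]} (ν : X) : ∃ μ, R.MatchesChar n μ ν := by
  have hν : ν ∈ AddSubgroup.closure (Set.range R.wt) := by rw [R.closure_wt]; trivial
  induction hν using AddSubgroup.closure_induction with
  | mem ν hν =>
    obtain ⟨k, rfl⟩ := hν
    by_contra! h
    have h1 : ∀ l, (n : Matrix κ κ ℚ_[p]) k l = 0 := fun l => by
      by_contra hk
      exact h _ (matchesChar_of_apply_ne_zero hk)
    have h2 := congrFun (congrFun (Units.mul_inv n) k) k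
    rw [Matrix.mul_apply, Finset.sum_eq_zero fun l _ => by rw [h1, zero_mul], one_apply_eq] at h2
    exact zero_ne_one h2
  | zero => exact ⟨0, R.matchesChar_zero n⟩
  | add ν ν' _ _ h h' =>
    obtain ⟨μ, hμ⟩ := h
    obtain ⟨μ', hμ'⟩ := h'
    exact ⟨μ + μ', hμ.add hμ'⟩
  | neg ν _ h =>
    obtain ⟨μ, hμ⟩ := h
    exact ⟨-μ, hμ.neg⟩

/-- An element of the normalizer of the torus acts on the characters. -/
lemma exists_charMap {n : GL κ ℚ_[p]} (hn : n ∈ R.normalizerT) :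
    ∃ σ : X →+ X, ∀ μ, R.MatchesChar n μ (σ μ) := by
  choose σ hσ using exists_matchesChar (R := R) (n := n)
  exact ⟨AddMonoidHom.mk' σ fun μ ν => (hσ (μ + ν)).right_unique hn ((hσ μ).add (hσ ν)), hσ⟩

lemma torusHom_conj_rootElt (t : Torus p X) (i : ι) (u : ℚ_[p]) :
    R.torusHom t * R.rootElt i u * (R.torusHom t)⁻¹ = R.rootElt i (evalChar (P.root i) t * u) := by
  apply Units.ext
  have h1 := IsNilpotent.exp_smul (ConjAct.toConjAct (R.torusHom t)) ((R.isNilpotent_E i).smul u)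
  rw [ConjAct.units_smul_def, ConjAct.units_smul_def, ConjAct.ofConjAct_toConjAct] at h1
  rw [Units.val_mul, Units.val_mul, coe_rootElt, coe_rootElt, ← h1]
  congr 1
  rw [mul_comm, mul_smul, ← adj_torusHom_E, ← map_smul]
  rfl

/-- The lifting condition concerns filtered subgroups at points, so a point `x` is chosen where α(x)
= -N is negative enough for `u` to belong to the subgroup. -/
lemma exists_conj_rootElt {n : GL κ ℚ_[p]} {w : P.AffineTransf} {i j : ι}
    (h : ∀ x, (R.rootSubgroupFix i {x}).map (MulAut.conj n).toMonoidHom =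
      R.rootSubgroupFix j {w x}) (u : ℚ_[p]) :
    ∃ u', n * R.rootElt i u * n⁻¹ = R.rootElt j u' := by
  obtain ⟨N, hN⟩ := pow_unbounded_of_one_lt ‖u‖ (one_lt_prime_real (p := p))
  let x : P.Apartment := (-N / 2 : ℝ) • P.adjointCocharToApartment (P.adjointCoroot i)
  have hx : P.rootFunctional i x = -N := by
    rw [map_smul, RootPairing.rootFunctional_adjointCoroot, smul_eq_mul]
    ring
  have hu : R.rootElt i u ∈ R.rootSubgroupFix i {x} := by
    refine R.mem_rootSubgroupFix_iff.2 ⟨u, ?_, rfl⟩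
    rintro _ rfl
    rw [hx, mem_valGE, neg_neg, Real.rpow_natCast]
    exact hN.le
  have h1 : n * R.rootElt i u * n⁻¹ ∈ R.rootSubgroupFix j {w x} := by
    rw [← h]
    exact ⟨_, hu, rfl⟩
  obtain ⟨u', -, hu'⟩ := R.mem_rootSubgroupFix_iff.1 h1
  exact ⟨u', hu'.symm⟩

lemma rootElt_injective (i : ι) : Function.Injective (R.rootElt i) := rootHom_injective i

/-- Conjugation by n carries x_i(u) to x_j(f(u)) with f additive, and conjugating by a torus element
t with image s gives f(α_i(t)) = α_j(s) f(1). No continuity of f is needed: for t = p^g the value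
α_i(t) is rational, and additive maps are ℚ-linear. So α_i and α_j correspond on all p^g, which
separate characters. -/
lemma charMap_root {n : GL κ ℚ_[p]} (hn : n ∈ R.normalizerT) {σ : X →+ X}
    (hσ : ∀ μ, R.MatchesChar n μ (σ μ)) {w : P.AffineTransf} {i j : ι}
    (h : ∀ x, (R.rootSubgroupFix i {x}).map (MulAut.conj n).toMonoidHom =
      R.rootSubgroupFix j {w x}) : σ (P.root i) = P.root j := by
  choose f hf using exists_conj_rootElt h
  let F : ℚ_[p] →+ ℚ_[p] := AddMonoidHom.mk' f fun u v => by
    apply rootElt_injective (R := R) j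
    rw [← hf, rootElt_add, rootElt_add, ← hf, ← hf]
    group
  have hf1 : f 1 ≠ 0 := fun h0 => by
    have h1 := hf 1
    rw [h0, rootElt_zero, mul_inv_eq_one, mul_eq_left, ← R.rootElt_zero i] at h1
    exact one_ne_zero (rootElt_injective i h1)
  rw [← sub_eq_zero]
  -- Pulling the difference back to a character μ of t allows testing on the elements t = p^g, whose
  -- images s are not known explicitly.
  obtain ⟨μ, hμ⟩ := exists_matchesChar_left (R := R) (n := n) (σ (P.root i) - P.root j)
  suffices hμ0 : μ = 0 by
    rw [hμ0] at hμ
    exact hμ.right_unique hn (R.matchesChar_zero n)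
  refine P.toPerfPair.injective ?_
  ext y
  rw [map_zero]
  set g : X →+ ℤ := (P.toLinearMap.flip y).toAddMonoidHom with hg
  set t := uniformizerPow p g with ht
  obtain ⟨s, hs⟩ := exists_torusHom_mul hn t
  suffices h1 : evalChar (P.root i) t = evalChar (P.root j) s by
    refine evalChar_uniformizerPow_eq_one (f := g) (p := p) ?_
    rw [hμ t s hs, sub_eq_add_neg, evalChar_add, evalChar_neg, ← hσ _ t s hs, h1, mul_inv_cancel]
  have h2 : R.rootElt j (f (evalChar (P.root i) t * 1)) =
      R.rootElt j (evalChar (P.root j) s * f 1) := by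
    rw [← hf, ← torusHom_conj_rootElt, ← torusHom_conj_rootElt, ← hf]
    have hs' : R.torusHom s = n * R.torusHom t * n⁻¹ := by rw [hs, mul_inv_cancel_right]
    rw [hs']
    group
  have h3 : (evalChar (P.root i) t : ℚ_[p]) * 1 = ((p : ℚ) ^ g (P.root i)) • (1 : ℚ_[p]) := by
    rw [ht, coe_evalChar_uniformizerPow, Rat.smul_def]
    push_cast
    rfl
  have h4 := rootElt_injective j h2
  rw [h3, show f (((p : ℚ) ^ g (P.root i)) • (1 : ℚ_[p])) =
    ((p : ℚ) ^ g (P.root i)) • f 1 from map_rat_smul F _ _, Rat.smul_def] at h4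
  apply Units.ext
  rw [← mul_right_cancel₀ hf1 h4, ht, coe_evalChar_uniformizerPow]
  push_cast
  rfl

/-- The centre acts trivially: a torus element on which all roots are trivial is central in `G`. -/
lemma commute_torusHom_of_evalChar_root_eq_one {t : Torus p X}
    (ht : ∀ i, evalChar (P.root i) t = 1) {g : GL κ ℚ_[p]} (hg : g ∈ R.G) :
    g * R.torusHom t = R.torusHom t * g := by
  have hle : R.G ≤ Subgroup.centralizer {R.torusHom t} := by
    refine sup_le ?_ (iSup_le fun i => ?_)
    · rintro _ ⟨s, rfl⟩
      rw [Subgroup.mem_centralizer_singleton_iff, ← map_mul, ← map_mul]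
      exact congrArg _ (mul_comm s t)
    · rintro _ ⟨u, rfl⟩
      rw [Subgroup.mem_centralizer_singleton_iff]
      have h1 := torusHom_conj_rootElt (R := R) t i u.toAdd
      rw [ht, Units.val_one, one_mul, mul_inv_eq_iff_eq_mul] at h1
      exact h1.symm
  exact Subgroup.mem_centralizer_singleton_iff.1 (hle hg)

/-- A functional on X/ℤΦ defines a central element p^f, which commutes with n, so f takes the same
value on μ and σμ. Since X/ℤΦ is free, such functionals separate its points. -/
lemma charMap_sub_mem_rootSpan [Module.Finite ℤ X] (hc : P.HasConnectedCenter)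
    {n : GL κ ℚ_[p]} (hn : n ∈ R.normalizerT) {σ : X →+ X}
    (hσ : ∀ μ, R.MatchesChar n μ (σ μ)) (μ : X) : σ μ - μ ∈ P.rootSpan ℤ := by
  have := hc.isTorsionFree
  have : Module.Free ℤ (X ⧸ P.rootSpan ℤ) := Module.free_of_finite_type_torsion_free'
  rw [← Submodule.Quotient.mk_eq_zero, ← Module.forall_dual_apply_eq_zero_iff ℤ]
  intro g
  let f : X →+ ℤ := (g ∘ₗ (P.rootSpan ℤ).mkQ).toAddMonoidHom
  have hroot : ∀ i, evalChar (P.root i) (uniformizerPow p f) = 1 := fun i => by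
    apply Units.ext
    have : f (P.root i) = 0 := by
      have h1 : (P.rootSpan ℤ).mkQ (P.root i) = 0 := by
        rw [Submodule.mkQ_apply, Submodule.Quotient.mk_eq_zero]
        exact (P.rootSpanMem ℤ i).2
      change g ((P.rootSpan ℤ).mkQ (P.root i)) = 0
      rw [h1, map_zero]
    rw [coe_evalChar_uniformizerPow, this, _root_.zpow_zero, Units.val_one]
  refine evalChar_uniformizerPow_eq_one (f := f) (p := p) ?_
  rw [sub_eq_add_neg, evalChar_add, evalChar_neg,
    ← hσ μ _ _ (commute_torusHom_of_evalChar_root_eq_one hroot hn.1), mul_inv_cancel]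

omit [Finite ι] in
/-- If a power of `w` is the translation by a multiple of `τ` then the linear part of `w`
fixes `τ`. -/
lemma apply_rootSpanMem_eq_of_pow_eq_translation {w : P.AffineTransf} {τ : P.AdjointCochar}
    {N m : ℕ} (hm : 0 < m) (h : w ^ N = P.translation τ ^ m) {i j : ι}
    (hij : ∀ x, P.rootFunctional j (w.linear x) = P.rootFunctional i x) :
    τ (P.rootSpanMem ℤ j) = τ (P.rootSpanMem ℤ i) := by
  -- `w` commutes with its own power. Applied to the origin, this says that the linear part of `w`
  -- fixes mτ.
  have h1 : w ((P.translation τ ^ m) 0) = (P.translation τ ^ m) (w 0) := by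
    rw [← h]
    change (w * w ^ N) 0 = (w ^ N * w) 0
    rw [← pow_succ, ← pow_succ']
  have h2 : w ((P.translation τ ^ m) 0) = w.linear ((P.translation τ ^ m) 0) + w 0 := by
    simpa using w.map_vadd 0 ((P.translation τ ^ m) 0)
  have h3 := congrArg (P.rootFunctional j) (h2.symm.trans h1)
  rw [map_add, hij, P.translation_pow_apply, P.translation_pow_apply, map_zero, zero_add,
    add_comm, add_left_cancel_iff] at h3
  have hm' : (m : ℝ) ≠ 0 := by exact_mod_cast hm.ne'
  exact_mod_cast (mul_left_cancel₀ hm' h3).symm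

/-- Let D = f∘σ - f for the functional f given by y. It vanishes on roots, hence is σ-invariant, so
f(σ^j μ) = f(μ) + jD(μ). For a weight μ the iterates remain in a finite set, so D(μ) = 0, and
positions with a nonzero entry of n join weights with equal f. -/
lemma torusHom_mul_comm_of_isLift [Module.Finite ℤ X] (hc : P.HasConnectedCenter)
    {w : P.AffineTransf} {n : GL κ ℚ_[p]} (hn : R.IsLift n w) (y : Y)
    (hy : ∀ i j, (∀ x, P.rootFunctional j (w.linear x) = P.rootFunctional i x) →
      P.toLinearMap (P.root j) y = P.toLinearMap (P.root i) y) (a : ℚ_[p]ˣ) :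
    R.torusHom (cochar p P y a) * n = n * R.torusHom (cochar p P y a) := by
  obtain ⟨σ, hσ⟩ := exists_charMap hn.1
  let f : X →ₗ[ℤ] ℤ := P.toLinearMap.flip y
  let D : X →ₗ[ℤ] ℤ := f ∘ₗ σ.toIntLinearMap - f
  have hDroot : ∀ ν ∈ P.rootSpan ℤ, D ν = 0 := by
    intro ν hν
    refine (Submodule.span_le (p := LinearMap.ker D)).2 ?_ hν
    rintro _ ⟨i, rfl⟩
    obtain ⟨j, hj, hconj⟩ := hn.2 i
    change f (σ (P.root i)) - f (P.root i) = 0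
    rw [charMap_root hn.1 hσ hconj]
    exact sub_eq_zero.2 (hy i j hj)
  have hDσ : ∀ μ, D (σ μ) = D μ := fun μ => by
    have := hDroot _ (charMap_sub_mem_rootSpan hc hn.1 hσ μ)
    rwa [map_sub, sub_eq_zero] at this
  have hfσ : ∀ μ, f (σ μ) = f μ + D μ := fun μ => (add_sub_cancel (f μ) (f (σ μ))).symm
  have hiter : ∀ (j : ℕ) μ, f (σ^[j] μ) = f μ + j * D μ := by
    intro j
    induction j with
    | zero => simp
    | succ j ih =>
      intro μ
      rw [Function.iterate_succ_apply, ih, hDσ, hfσ]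
      push_cast
      ring
  have hrange : ∀ (j : ℕ) l, σ^[j] (R.wt l) ∈ Set.range R.wt := by
    intro j
    induction j with
    | zero => exact fun l => ⟨l, rfl⟩
    | succ j ih =>
      intro l
      obtain ⟨l', hl'⟩ := ih l
      rw [Function.iterate_succ_apply', ← hl']
      obtain ⟨k, hk⟩ : ∃ k, (n : Matrix κ κ ℚ_[p]) k l' ≠ 0 := by
        by_contra! h1
        have h2 := congrFun (congrFun (Units.inv_mul n) l') l'
        rw [Matrix.mul_apply, Finset.sum_eq_zero fun k _ => by rw [h1, mul_zero],
          one_apply_eq] at h2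
        exact zero_ne_one h2
      exact ⟨k, (matchesChar_of_apply_ne_zero hk).right_unique hn.1 (hσ _)⟩
  have hDwt : ∀ l, D (R.wt l) = 0 := by
    intro l
    by_contra hD
    refine Set.infinite_range_of_injective (f := fun j : ℕ => f (σ^[j] (R.wt l))) ?_
      ((Set.finite_range fun k => f (R.wt k)).subset ?_)
    · intro j j' hjj'
      simp only [hiter] at hjj'
      exact_mod_cast mul_right_cancel₀ hD (add_left_cancel hjj')
    · rintro _ ⟨j, rfl⟩
      obtain ⟨k, hk⟩ := hrange j l
      exact ⟨k, congrArg f hk⟩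
  apply Units.ext
  ext k l
  rw [Units.val_mul, Units.val_mul, coe_torusHom, diagonal_mul, mul_diagonal]
  by_cases hkl : (n : Matrix κ κ ℚ_[p]) k l = 0
  · rw [hkl, mul_zero, zero_mul]
  · have h1 := (matchesChar_of_apply_ne_zero hkl).right_unique hn.1 (hσ _)
    have h2 := hfσ (R.wt l)
    rw [hDwt, add_zero, ← h1] at h2
    have h3 : evalChar (R.wt k) (cochar p P y a) = evalChar (R.wt l) (cochar p P y a) :=
      congrArg (a ^ ·) h2
    rw [h3, mul_comm]

end ChevalleyRep

/-! ### The chambers of the gallery and their adjacency -/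

namespace RootPairing

variable {ι X Y : Type*} [AddCommGroup X] [AddCommGroup Y] {P : RootPairing ι ℤ X Y} {b : P.Base}

lemma IsCrossing.adjacent {k k' : ι → ℤ} {ε : ι} {y : P.Apartment} (h : P.IsCrossing k k' ε y)
    (hk : ChevalleyRep.HasInterior P k) :
    P.Adjacent (ChevalleyRep.closedAlcove P k) (ChevalleyRep.closedAlcove P k') := by
  have hk'' : (k' ε : ℝ) = k ε + 1 := by exact_mod_cast h.apply_self
  have hneg : (k' (P.reflectionPerm ε ε) : ℝ) = k (P.reflectionPerm ε ε) - 1 := by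
    exact_mod_cast h.apply_neg
  obtain ⟨x, hx⟩ := hk
  -- Nonempty interior ties the integers of ε and -ε together; without it the families `k` would be
  -- arbitrary.
  have hsum : (k (P.reflectionPerm ε ε) : ℝ) = -k ε - 1 := by
    have h1 := hx ε
    have h2 := hx (P.reflectionPerm ε ε)
    rw [rootFunctional_neg] at h2
    have h3 : (k (P.reflectionPerm ε ε) : ℝ) < -k ε := by linarith
    have h4 : (-k ε - 2 : ℝ) < k (P.reflectionPerm ε ε) := by linarith
    have h5 : k (P.reflectionPerm ε ε) < -k ε := by exact_mod_cast h3
    have h6 : -k ε - 2 < k (P.reflectionPerm ε ε) := by exact_mod_cast h4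
    exact_mod_cast (by omega : k (P.reflectionPerm ε ε) = -k ε - 1)
  refine ⟨fun heq => ?_, y, ⟨fun i => ?_, fun i => ?_⟩, ε, ⟨k ε + 1, by rw [h.wall]; push_cast; rfl⟩,
    fun j hj => ?_⟩
  · have hxD : x ∈ ChevalleyRep.closedAlcove P k := fun i => ⟨(hx i).1.le, (hx i).2.le⟩
    rw [heq] at hxD
    have h1 := (hxD ε).1
    have h2 := (hx ε).2
    linarith
  · by_cases h1 : i = ε
    · subst h1
      rw [h.wall]
      constructor <;> linarith
    by_cases h2 : i = P.reflectionPerm ε ε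
    · subst h2
      rw [rootFunctional_neg, h.wall]
      constructor <;> linarith
    exact ⟨(h.lt_wall i h1 h2).1.le, (h.lt_wall i h1 h2).2.le⟩
  · by_cases h1 : i = ε
    · subst h1
      rw [h.wall]
      constructor <;> linarith
    by_cases h2 : i = P.reflectionPerm ε ε
    · subst h2
      rw [rootFunctional_neg, h.wall]
      constructor <;> linarith
    rw [h.apply_of_ne i h1 h2]
    exact ⟨(h.lt_wall i h1 h2).1.le, (h.lt_wall i h1 h2).2.le⟩
  · by_contra! hne
    obtain ⟨l, hl⟩ := hj
    obtain ⟨h1, h2⟩ := h.lt_wall j hne.1 hne.2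
    rw [hl] at h1 h2
    norm_cast at h1 h2
    omega

lemma Base.pow_mem_openChamber {v : P.AffineTransf} (hv : v ∈ P.extAffineWeyl)
    (hvC : v '' b.chamber = b.chamber) {x : P.Apartment} (hx : x ∈ b.openChamber) (n : ℕ) :
    (v ^ n) x ∈ b.openChamber := by
  induction n with
  | zero => exact hx
  | succ n ih =>
    rw [pow_succ']
    exact map_mem_openChamber hv hvC ih

lemma Base.gallery_eq_closedAlcove {θ : ι} {φ : P.AffineTransf} (hφ : φ ∈ P.extAffineWeyl) {r : ℕ}
    (β : Fin r → Option b.support) {x₀ : P.Apartment} (hx₀ : x₀ ∈ b.openChamber) (j : ℕ) :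
    b.gallery θ φ β j = ChevalleyRep.closedAlcove P
      fun i => ⌊P.rootFunctional i (b.galleryElt θ φ β j x₀)⌋ :=
  image_chamber (galleryElt_mem hφ β j) hx₀

end RootPairing

/-! ### Assembly of the two halves -/

theorem mainTheorem5
    {p : ℕ} [Fact p.Prime]
    {ι X Y : Type*} [Finite ι] [AddCommGroup X] [AddCommGroup Y]
    [Module.Finite ℤ X] [Module.Finite ℤ Y]
    (P : RootPairing ι ℤ X Y) [P.IsReduced]
    (hirr : P.IsIrreducibleDatum) (hcenter : P.HasConnectedCenter)
    (b : P.Base) (θ : ι) (hθ : b.IsHighestRoot θ)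
    {κ : Type*} [Fintype κ] [DecidableEq κ] (R : ChevalleyRep p P κ)
    (τ : P.AdjointCochar) (hτfund : b.IsFundamentalCoweight τ) (hτmin : b.IsMinuscule τ)
    (φ : P.AffineTransf) (hφ : φ ∈ P.extAffineWeyl) (hφ1 : φ ≠ 1)
    (hφpow : b.IsPowerMultiplicative θ φ)
    (hφτ : ∃ m n : ℕ, 0 < m ∧ 0 < n ∧ φ ^ n = P.translation τ ^ m)
    (φ' v : P.AffineTransf) (hφ' : φ' ∈ b.affineWeyl θ) (hv : v ∈ P.extAffineWeyl)
    (hvC : v '' b.chamber = b.chamber) (hφ'v : φ = φ' * v)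
    {r : ℕ} (hr : r = b.length θ φ') (β : Fin r → Option b.support)
    (hβ : φ' = ((List.ofFn β).map (b.coxeterGen θ)).prod)
    (τ' : Y) (hτ' : ∀ i, P.toLinearMap (P.root i) τ' = τ (P.rootSpanMem ℤ i)) :
    -- the chambers `C^{(j)}` form a gallery satisfying the index `p` chain condition,
    -- and the crossing roots `α^{(j)}` are well defined and positive
    (R.IsIndexPGallery b (b.gallery θ φ β) ∧
      ∀ j, (∃! δ : ι, R.IsCrossingRoot (b.gallery θ φ β j) (b.gallery θ φ β (j + 1)) δ) ∧
        ∀ δ, R.IsCrossingRoot (b.gallery θ φ β j) (b.gallery θ φ β (j + 1)) δ → b.IsPos δ) ∧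
    -- `α^{(j)} ∘ τ = id` on `ℤ_pˣ`
    (∀ j (δ : ι), R.IsCrossingRoot (b.gallery θ φ β j) (b.gallery θ φ β (j + 1)) δ →
      ∀ a : ℤ_[p]ˣ, ChevalleyRep.evalChar (P.root δ)
        (ChevalleyRep.cochar p P τ' (PadicInt.unitToPadic a)) = PadicInt.unitToPadic a) ∧
    -- `τ` commutes with every lifting of `φ` to `N(T)`
    (∀ n : GL κ ℚ_[p], R.IsLift n φ → ∀ a : ℤ_[p]ˣ,
      R.torusHom (ChevalleyRep.cochar p P τ' (PadicInt.unitToPadic a)) * n =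
        n * R.torusHom (ChevalleyRep.cochar p P τ' (PadicInt.unitToPadic a))) := by
  obtain ⟨m, n, hm, hn, hφτ⟩ := hφτ
  obtain ⟨x₀, hx₀⟩ := RootPairing.Base.exists_mem_openChamber hθ
  obtain ⟨lam, hlam⟩ := b.exists_height_extension hcenter
  have hχ := fun i => ChevalleyRep.exists_integral_char (p := p) hcenter b i
  have hrφ : r = b.length θ φ := by
    rw [hr, hφ'v, RootPairing.Base.length_mul_eq_of_image_eq φ' hv hvC]
  have hφv : φ = ((List.ofFn β).map (b.coxeterGen θ)).prod * v := by rw [hφ'v, hβ]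
  -- If r were 0, φ = v would preserve the open base chamber, and so would its power, the
  -- translation by mτ. But this raises the simple root dual to τ by m ≥ 1, more than the open strip
  -- of width 1 allows.
  have hr0 : 0 < r := by
    rw [Nat.pos_iff_ne_zero]
    rintro rfl
    have hφv' : φ = v := by rw [hφv]; simp
    obtain ⟨i, hi, hτi⟩ := hτfund
    have h1 := RootPairing.Base.pow_mem_openChamber hv hvC hx₀ n i
      (RootPairing.Base.isPos_of_mem_support hi)
    rw [← hφv', hφτ, RootPairing.translation_pow_apply, (hτi i hi).1 rfl] at h1
    have h2 := hx₀ i (RootPairing.Base.isPos_of_mem_support hi)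
    have h3 : (1 : ℝ) ≤ m := by exact_mod_cast hm
    push_cast at h1
    linarith [h1.2, h2.1]
  set k : ℕ → ι → ℤ := fun j i => ⌊P.rootFunctional i (b.galleryElt θ φ β j x₀)⌋ with hkdef
  have hgal : ∀ j, b.gallery θ φ β j = ChevalleyRep.closedAlcove P (k j) := fun j =>
    RootPairing.Base.gallery_eq_closedAlcove hφ β hx₀ j
  have hint : ∀ j, ChevalleyRep.HasInterior P (k j) := fun j =>
    ⟨b.galleryElt θ φ β j x₀, fun i =>
      ⟨((RootPairing.Base.isRegularPoint_of_mem_openChamber hx₀).map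
        (RootPairing.Base.galleryElt_mem hφ β j)).floor_lt i, Int.lt_floor_add_one _⟩⟩
  have hcross : ∀ j, ∃ ε y, b.IsPos ε ∧ τ (P.rootSpanMem ℤ ε) = 1 ∧
      P.IsCrossing (k j) (k (j + 1)) ε y := fun j =>
    RootPairing.Base.gallery_crossing hθ hτmin hφ hr0 hn hrφ hφpow hφτ hv hvC hφv hx₀ j
  have hroot : ∀ j, ∃ ε, b.IsPos ε ∧ τ (P.rootSpanMem ℤ ε) = 1 ∧
      R.IsCrossingRoot (b.gallery θ φ β j) (b.gallery θ φ β (j + 1)) ε := fun j => by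
    obtain ⟨ε, y, h1, h2, h3⟩ := hcross j
    refine ⟨ε, h1, h2, ?_⟩
    rw [hgal, hgal]
    exact ChevalleyRep.isCrossingRoot_of_isCrossing hχ (hint j) (hint (j + 1)) h3
  have hzero : b.gallery θ φ β 0 = b.chamber := by
    simp [RootPairing.Base.gallery]
  refine ⟨⟨⟨hzero, fun j => ?_, fun j => ?_, ?_, fun j => ?_⟩, fun j => ⟨?_, fun δ hδ => ?_⟩⟩,
    fun j δ hδ a => ?_, fun g hg a => ?_⟩
  · exact RootPairing.Base.isChamber_image (RootPairing.Base.galleryElt_mem hφ β j) hx₀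
  · obtain ⟨ε, y, -, -, h⟩ := hcross j
    rw [hgal, hgal]
    exact h.adjacent (hint j)
  · rw [hzero]
    exact ChevalleyRep.iwahori_chamber_inf_N hlam hχ
  · obtain ⟨ε, y, hε, -, h⟩ := hcross j
    rw [hgal, hgal]
    exact ChevalleyRep.iwahori_inf_N_of_isCrossing hlam hχ (hint j) (hint (j + 1)) hε h
  · obtain ⟨ε, -, -, h⟩ := hroot j
    exact ⟨ε, h, fun δ hδ => hδ.unique h⟩
  · obtain ⟨ε, hε, -, h⟩ := hroot j
    rwa [hδ.unique h]
  · obtain ⟨ε, -, hτε, h⟩ := hroot j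
    rw [hδ.unique h]
    change PadicInt.unitToPadic a ^ P.toLinearMap (P.root ε) τ' = _
    rw [hτ', hτε, zpow_one]
  · refine ChevalleyRep.torusHom_mul_comm_of_isLift hcenter hg τ' (fun i j hij => ?_) _
    rw [hτ', hτ']
    exact ChevalleyRep.apply_rootSpanMem_eq_of_pow_eq_translation hm hφτ hij
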